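/- Let $\ell>0$, $h,H\in\mathbb R$, let $q\in L^1(0,\ell)$ be real valued, and let $0<\varepsilon\le\ell$. For $\lambda\in\mathbb C$ let $y(\cdot,\lambda)$ be the solution of $-y''+q(x)y=\lambda y$ on $(0,\ell)$ with $y(0,\lambda)=1$, $y'(0,\lambda)=h$, and put $\Phi(\lambda)=y'(\ell,\lambda)+H\,y(\ell,\lambda)$. Then $\Phi$ is entire, and its zeros are real and form a strictly increasing sequence $\lambda_0<\lambda_1<\cdots$ (the eigenvalues). Moreover: 1. $\displaystyle \ell=\lim_{n\to\infty}\frac{n\pi}{\sqrt{\lambda_n}}$, and $\Phi$ is recovered from its zeros by $$\Phi(\lambda)=\ell(\lambda_0-\lambda)\prod_{n\ge1}\Bigl(\frac{\ell^2}{\pi^2n^2}(\lambda_n-\lambda)\Bigr),\qquad \lambda\in\mathbb C,$$ where the product converges unconditionally. 2. For every $n\ge0$, with $\alpha_n=\|y(\cdot,\lambda_n)\|_{L^2(0,\ell)}$, one has $\alpha_n^2=-y(\ell,\lambda_n)\,\Phi'(\lambda_n)$ and $\Phi'(\lambda_n)\ne0$. 3. Let $K$ be the transmutation kernel on $[0,\varepsilon]$,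 that is, the real continuous function on $0\le t\le x\le\varepsilon$ with $$\cos(x\sqrt\lambda)=y(x,\lambda)+\int_0^xK(x,t)\,y(t,\lambda)\,dt,\qquad 0<x<\varepsilon,\ \lambda\in\mathbb C,$$ and let $g_\varepsilon(x)=(x-\varepsilon)^2+\int_x^\varepsilon K(t,x)(t-\varepsilon)^2\,dt$ for $0<x<\varepsilon$ and $g_\varepsilon(x)=0$ for $\varepsilon\le x<\ell$. Let $u$ be the finite-energy weak solution of $$u_{tt}=u_{xx}-q(x)u\quad(0<x<\ell,\ t>0),\qquad u_x(0,t)-hu(0,t)=0,\quad u_x(\ell,t)+Hu(\ell,t)=0,$$ $$u(x,0)=0,\qquad u_t(x,0)=g_\varepsilon(x).$$ Then for every $t\ge0$ $$u(\ell,t)=2\sum_{n\ge0}\frac{\sin(\varepsilon\sqrt{\lambda_n})-\varepsilon\sqrt{\lambda_n}}{\lambda_n^2\,\Phi'(\lambda_n)}\,\sin(t\sqrt{\lambda_n}),$$ with unconditional convergence, where, if $\lambda_n=0$, the $n$-th summand including the factor $2$ is read as its limit $-\dfrac{\varepsilon^3t}{3\,\Phi'(0)}$. Thus $u(\ell,t)$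 is computed from $\varepsilon$ and the eigenvalues alone, without knowing $q$ or solving the wave equation. -/

import Mathlib

open MeasureTheory Filter Topology

noncomputable section

namespace WaveTrace

/-- A square root of a complex number. Every expression below in which it occurs is an even
function of it, so the choice of the branch does not matter. -/
def csqrt (z : ℂ) : ℂ := z ^ (1 / 2 : ℂ)

/-- `y (·, z)`, with derivative `y' (·, z)`, is for every complex `z` the solution of
`-y'' + q y = z y` on `[0, ℓ]`, `y (0, z) = 1`, `y' (0, z) = h`, in the Carathéodory sense
(`y` and `y'` are absolutely continuous and the equation holds almost everywhere), written in
integrated form because `q` is only integrable. -/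
structure IsFundamentalSolution (q : ℝ → ℝ) (h ℓ : ℝ) (y y' : ℝ → ℂ → ℂ) : Prop where
  continuousOn : ∀ z : ℂ, ContinuousOn (fun x => y x z) (Set.Icc 0 ℓ)
  continuousOn_deriv : ∀ z : ℂ, ContinuousOn (fun x => y' x z) (Set.Icc 0 ℓ)
  eq : ∀ z : ℂ, ∀ x ∈ Set.Icc 0 ℓ, y x z = 1 + ∫ s in (0 : ℝ)..x, y' s z
  deriv_eq : ∀ z : ℂ, ∀ x ∈ Set.Icc 0 ℓ,
    y' x z = (h : ℂ) + ∫ s in (0 : ℝ)..x, ((q s : ℂ) - z) * y s z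

/-- The characteristic function `Φ (z) = y' (ℓ, z) + H y (ℓ, z)`. -/
def charFun (ℓ H : ℝ) (y y' : ℝ → ℂ → ℂ) (z : ℂ) : ℂ := y' ℓ z + (H : ℂ) * y ℓ z

/-- The real zeros of `Φ` listed in increasing order: the least one, then, after each of them,
the least one that exceeds it. -/
def eigenvalue (Φ : ℂ → ℂ) : ℕ → ℝ
  | 0 => sInf {x : ℝ | Φ (x : ℂ) = 0}
  | n + 1 => sInf {x : ℝ | Φ (x : ℂ) = 0 ∧ eigenvalue Φ n < x}

/-- The factor `(ℓ² / (π² n²)) (λ_n - z)`, for the index `n + 1` in place of `n`. -/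
def hadamardFactor (ℓ : ℝ) (lam : ℕ → ℝ) (z : ℂ) (n : ℕ) : ℂ :=
  ((ℓ ^ 2 / (Real.pi ^ 2 * ((n : ℝ) + 1) ^ 2) : ℝ) : ℂ) * ((lam (n + 1) : ℂ) - z)

/-- `ℓ (λ_0 - z) ∏_{n ≥ 1} (ℓ² / (π² n²)) (λ_n - z)`. -/
def hadamardProduct (ℓ : ℝ) (lam : ℕ → ℝ) (z : ℂ) : ℂ :=
  (ℓ : ℂ) * ((lam 0 : ℂ) - z) * ∏' n : ℕ, hadamardFactor ℓ lam z n

/-- `K` is the (continuous) kernel of the transmutation operator on `[0, ε]`: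
`cos (x √z) = y (x, z) + ∫_0^x K (x, t) y (t, z) dt`. -/
structure IsTransmutationKernel (ε : ℝ) (y : ℝ → ℂ → ℂ) (K : ℝ → ℝ → ℝ) : Prop where
  continuousOn : ContinuousOn (fun p : ℝ × ℝ => K p.1 p.2) {p | 0 ≤ p.2 ∧ p.2 ≤ p.1 ∧ p.1 ≤ ε}
  eq : ∀ z : ℂ, ∀ x ∈ Set.Ioo 0 ε,
    Complex.cos ((x : ℂ) * csqrt z) = y x z + ∫ t in (0 : ℝ)..x, (K x t : ℂ) * y t z

/-- The initial velocity `g_ε (x) = ψ (x) + ∫_x^ε K (t, x) ψ (t) dt` on `(0, ε)` with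
`ψ (x) = (x - ε)²`, and `g_ε = 0` elsewhere. -/
def initialVelocity (ε : ℝ) (K : ℝ → ℝ → ℝ) (x : ℝ) : ℝ :=
  (Set.Ioo 0 ε).indicator
    (fun x => (x - ε) ^ 2 + ∫ t in x..ε, K t x * (t - ε) ^ 2) x

/-- `v` lies in the Sobolev space `H¹ (0, ℓ)` (continuous representative on `[0, ℓ]`), with weak
derivative `v'`. -/
def IsH1 (ℓ : ℝ) (v v' : ℝ → ℝ) : Prop :=
  MemLp v' 2 (volume.restrict (Set.Ioc 0 ℓ)) ∧
    ∀ x ∈ Set.Icc 0 ℓ, v x = v 0 + ∫ s in (0 : ℝ)..x, v' s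

/-- The bilinear form `∫_0^ℓ (v' w' + q v w) dx + h v (0) w (0) + H v (ℓ) w (ℓ)` of the operator
`-d²/dx² + q` with boundary conditions `v' (0) = h v (0)`, `v' (ℓ) = -H v (ℓ)`. -/
def energyForm (q : ℝ → ℝ) (h H ℓ : ℝ) (v v' w w' : ℝ → ℝ) : ℝ :=
  (∫ x in (0 : ℝ)..ℓ, (v' x * w' x + q x * v x * w x)) + h * v 0 * w 0 + H * v ℓ * w ℓ

/-- `u` is a finite-energy weak solution for `t ≥ 0` of `u_tt = u_xx - q u` on `(0, ℓ)`,
`u_x (0, t) = h u (0, t)`, `u_x (ℓ, t) = -H u (ℓ, t)`, `u (·, 0) = f`, `u_t (·, 0) = g`: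
`u (·, t)` is in `H¹ (0, ℓ)`, there is a velocity `u_t (·, t)` in `L² (0, ℓ)`, and for each test
function `v` in `H¹ (0, ℓ)` one has `d/dt ∫ u v = ∫ u_t v` and
`d/dt ∫ u_t v = - energyForm (u (·, t), v)` (one-sided derivatives at `t = 0`). -/
def IsWeakSolution (q : ℝ → ℝ) (h H ℓ : ℝ) (f g : ℝ → ℝ) (u : ℝ → ℝ → ℝ) : Prop :=
  ∃ ux ut : ℝ → ℝ → ℝ,
    (∀ t, 0 ≤ t → IsH1 ℓ (fun x => u x t) (fun x => ux x t)) ∧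
    (∀ t, 0 ≤ t → MemLp (fun x => ut x t) 2 (volume.restrict (Set.Ioc 0 ℓ))) ∧
    (∀ v v' : ℝ → ℝ, IsH1 ℓ v v' → ∀ t, 0 ≤ t →
      HasDerivWithinAt (fun τ => ∫ x in (0 : ℝ)..ℓ, u x τ * v x)
        (∫ x in (0 : ℝ)..ℓ, ut x t * v x) (Set.Ici 0) t ∧
      HasDerivWithinAt (fun τ => ∫ x in (0 : ℝ)..ℓ, ut x τ * v x)
        (-energyForm q h H ℓ (fun x => u x t) (fun x => ux x t) v v') (Set.Ici 0) t) ∧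
    (∀ x ∈ Set.Icc 0 ℓ, u x 0 = f x) ∧
    (∀ᵐ x ∂(volume.restrict (Set.Ioc 0 ℓ)), ut x 0 = g x)

/-- `2 (sin (ε √μ) - ε √μ) sin (t √μ) / μ²`, extended to `μ = 0` by its limit `-ε³ t / 3`. -/
def traceNumerator (ε t μ : ℝ) : ℂ :=
  if μ = 0 then -((ε : ℂ) ^ 3 * (t : ℂ) / 3)
  else 2 * (Complex.sin ((ε : ℂ) * csqrt (μ : ℂ)) - (ε : ℂ) * csqrt (μ : ℂ)) / (μ : ℂ) ^ 2
    * Complex.sin ((t : ℂ) * csqrt (μ : ℂ))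

end WaveTrace

end

open MeasureTheory Filter Topology

noncomputable section

namespace WaveTrace

/-! ### Integration by parts and Lagrange's identity for absolutely continuous functions. -/

section Triangle

variable {L : ℝ} (k : ℝ → ℝ → ℂ)

/-! Everything rests on comparing the problem with the free one (`q = h = H = 0`), whose
characteristic function is `-√z sin (ℓ √z)`, and on Lagrange's identity. The Volterra equation for
`y` has a unique solution depending analytically on `z`, so `Φ` is entire. Lagrange's identity for
two spectral parameters (`mul_integral_mul`) gives real zeros, orthogonality and, by letting the
parameters merge, `α_n² = -y(ℓ, λ_n) Φ'(λ_n)`; hence the zeros are simple.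

Variation of constants gives `Φ(k²) = -k sin(kℓ) + O(e^{|Im k| ℓ})`. On the circles `|k| = (N +
1/2)π/ℓ` the sine has full size, so Rouché's theorem counts `N + 1` zeros inside. This places one
eigenvalue in each interval for large `n`, gives the limit `ℓ`, and, with the asymptotics once more,
`λ_n = (nπ/ℓ)² + O(1)`. On the same circles the product over the `λ_n` and `Φ` are both asymptotic
to the free characteristic function. Their quotient is entire because the zeros of `Φ` are simple,
and it tends to 1 on growing circles, so it is 1 (`charFun_eq_hadamardProduct`).

For the trace, completeness of the eigenfunctions comes from the resolvent: if `w` is orthogonal to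
all of them, the pairing of `w` with its resolvent extends to an entire function bounded by `‖w‖² /
|Im z|`, hence vanishes, and the energy identity forces `w = 0` (`eq_zero_of_orthogonal`). A
continuous function with absolutely summable coefficients is then the sum of its expansion. The
coefficients of `u(·, t)` solve `c'' = -λ_n c`, `c(0) = 0`; transmutation turns `c'(0)` into the
elementary integral of `(x - ε)² cos(x √λ_n)`. At `x = ℓ` the factor `y(ℓ, λ_n)` cancels against the
norming constant, leaving only `ε`, `λ_n` and `Φ'(λ_n)`. -/

theorem integral_indicator_triangle_right {s : ℝ} (hs : s ∈ Set.Ioc 0 L) :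
    ∫ t in Set.Ioc 0 L, {p : ℝ × ℝ | p.2 ≤ p.1}.indicator (fun p => k p.1 p.2) (s, t)
      = ∫ t in (0 : ℝ)..s, k s t := by
  have : (fun t => {p : ℝ × ℝ | p.2 ≤ p.1}.indicator (fun p => k p.1 p.2) (s, t))
      = (Set.Iic s).indicator (fun t => k s t) := by
    ext t; simp [Set.indicator]
  simp only [this]
  rw [integral_indicator measurableSet_Iic, Measure.restrict_restrict measurableSet_Iic,
    intervalIntegral.integral_of_le hs.1.le]
  congr 2
  ext t; simp only [Set.mem_Ioc, Set.mem_inter_iff, Set.mem_Iic]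
  exact ⟨fun h => ⟨h.2.1, h.1⟩, fun h => ⟨h.2, h.1, h.2.trans hs.2⟩⟩

theorem integral_indicator_triangle_left {t : ℝ} (ht : t ∈ Set.Ioc 0 L) :
    ∫ s in Set.Ioc 0 L, {p : ℝ × ℝ | p.2 ≤ p.1}.indicator (fun p => k p.1 p.2) (s, t)
      = ∫ s in t..L, k s t := by
  have : (fun s => {p : ℝ × ℝ | p.2 ≤ p.1}.indicator (fun p => k p.1 p.2) (s, t))
      = (Set.Ici t).indicator (fun s => k s t) := by
    ext s; simp [Set.indicator]
  simp only [this]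
  rw [integral_indicator measurableSet_Ici, Measure.restrict_restrict measurableSet_Ici,
    intervalIntegral.integral_of_le ht.2, ← integral_Icc_eq_integral_Ioc]
  congr 2
  ext s; simp only [Set.mem_Ioc, Set.mem_inter_iff, Set.mem_Ici, Set.mem_Icc]
  exact ⟨fun h => ⟨h.1, h.2.2⟩, fun h => ⟨h.1, ht.1.trans_le h.1, h.2⟩⟩

/-- Fubini's theorem on the triangle `0 < t ≤ s ≤ L`. -/
theorem integral_triangle_swap (hL : 0 ≤ L)
    (hk : Integrable ({p : ℝ × ℝ | p.2 ≤ p.1}.indicator (fun p => k p.1 p.2))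
      ((volume.restrict (Set.Ioc 0 L)).prod (volume.restrict (Set.Ioc 0 L)))) :
    ∫ s in (0 : ℝ)..L, ∫ t in (0 : ℝ)..s, k s t = ∫ t in (0 : ℝ)..L, ∫ s in t..L, k s t := by
  rw [intervalIntegral.integral_of_le hL, intervalIntegral.integral_of_le hL,
    ← setIntegral_congr_fun measurableSet_Ioc fun s => integral_indicator_triangle_right k,
    ← setIntegral_congr_fun measurableSet_Ioc fun t => integral_indicator_triangle_left k]
  exact integral_integral_swap hk

end Triangle

/-- `F` is an absolutely continuous function on `[0, L]` with derivative `f`. -/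
structure IsPrimitive (L : ℝ) (F f : ℝ → ℂ) : Prop where
  integrable : IntervalIntegrable f volume 0 L
  eq : ∀ x ∈ Set.Icc 0 L, F x = F 0 + ∫ s in (0 : ℝ)..x, f s

theorem intervalIntegrable_mono_right {E : Type*} [NormedAddCommGroup E] {f : ℝ → E} {L x : ℝ}
    (hf : IntervalIntegrable f volume 0 L) (hx : x ∈ Set.Icc 0 L) :
    IntervalIntegrable f volume 0 x :=
  hf.mono_set (by rw [Set.uIcc_of_le hx.1, Set.uIcc_of_le (hx.1.trans hx.2)]
                  exact Set.Icc_subset_Icc_right hx.2)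

namespace IsPrimitive

variable {L : ℝ} {F f G g : ℝ → ℂ}

theorem mono {x : ℝ} (hF : IsPrimitive L F f) (hx : x ∈ Set.Icc 0 L) : IsPrimitive x F f :=
  ⟨intervalIntegrable_mono_right hF.integrable hx, fun s hs => hF.eq s ⟨hs.1, hs.2.trans hx.2⟩⟩

theorem continuousOn (hF : IsPrimitive L F f) : ContinuousOn F (Set.Icc 0 L) := by
  rcases lt_or_ge L 0 with hL | hL
  · simp [Set.Icc_eq_empty hL.not_ge]
  have : ContinuousOn (fun x => F 0 + ∫ s in (0 : ℝ)..x, f s) (Set.Icc 0 L) := by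
    have h := intervalIntegral.continuousOn_primitive_interval'
      hF.integrable (Set.left_mem_uIcc (a := (0 : ℝ)) (b := L))
    rw [Set.uIcc_of_le hL] at h
    exact continuousOn_const.add h
  exact this.congr hF.eq

theorem congr_deriv (hL : 0 ≤ L) (hF : IsPrimitive L F f) (hfg : ∀ x ∈ Set.Icc 0 L, f x = g x) :
    IsPrimitive L F g := by
  have key : ∀ x ∈ Set.Icc 0 L, Set.EqOn f g (Set.uIcc 0 x) := fun x hx s hs => by
    rw [Set.uIcc_of_le hx.1] at hs
    exact hfg s ⟨hs.1, hs.2.trans hx.2⟩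
  refine ⟨(intervalIntegrable_congr
    ((key L ⟨hL, le_rfl⟩).mono Set.uIoc_subset_uIcc)).1 hF.integrable, fun x hx => ?_⟩
  rw [hF.eq x hx, intervalIntegral.integral_congr (key x hx)]

theorem conj (hF : IsPrimitive L F f) :
    IsPrimitive L (fun x => starRingEnd ℂ (F x)) (fun x => starRingEnd ℂ (f x)) := by
  refine ⟨⟨Complex.conjCLE.toContinuousLinearMap.integrable_comp hF.integrable.1,
    Complex.conjCLE.toContinuousLinearMap.integrable_comp hF.integrable.2⟩, fun x hx => ?_⟩
  rw [hF.eq x hx, map_add, intervalIntegral.intervalIntegral_conj]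

theorem sub (hF : IsPrimitive L F f) (hG : IsPrimitive L G g) :
    IsPrimitive L (fun x => F x - G x) (fun x => f x - g x) := by
  refine ⟨hF.integrable.sub hG.integrable, fun x hx => ?_⟩
  rw [intervalIntegral.integral_sub (hF.mono hx).integrable (hG.mono hx).integrable,
    hF.eq x hx, hG.eq x hx]
  ring

theorem const_mul (hF : IsPrimitive L F f) (c : ℂ) :
    IsPrimitive L (fun x => c * F x) (fun x => c * f x) := by
  refine ⟨hF.integrable.const_mul c, fun x hx => ?_⟩
  rw [intervalIntegral.integral_const_mul, hF.eq x hx]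
  ring

theorem of_hasDerivAt (hd : ∀ x, HasDerivAt F (f x) x) (hf : Continuous f) :
    IsPrimitive L F f :=
  ⟨hf.intervalIntegrable _ _, fun x _ => by
    rw [intervalIntegral.integral_eq_sub_of_hasDerivAt (fun s _ => hd s)
      (hf.intervalIntegrable _ _)]; ring⟩

/-- Integration of the derivative of a product of absolutely continuous functions. -/
theorem mul (hL : 0 ≤ L) (hF : IsPrimitive L F f) (hG : IsPrimitive L G g) :
    ∫ s in (0 : ℝ)..L, (f s * G s + F s * g s) = F L * G L - F 0 * G 0 := by
  have hf := hF.integrable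
  have hg := hG.integrable
  have hLm : L ∈ Set.Icc 0 L := ⟨hL, le_rfl⟩
  -- Expanding `G` from the left endpoint and `F` from the right endpoint turns both integrals into
  -- double integrals of `f(s) g(t)` over the same triangle, with opposite signs.
  have e1 : ∫ s in (0 : ℝ)..L, f s * G s
      = (∫ s in (0 : ℝ)..L, f s) * G 0 + ∫ s in (0 : ℝ)..L, ∫ t in (0 : ℝ)..s, f s * g t := by
    rw [← intervalIntegral.integral_mul_const, ← intervalIntegral.integral_add]
    · refine intervalIntegral.integral_congr fun s hs => ?_
      rw [Set.uIcc_of_le hL] at hs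
      simp only [hG.eq s hs, intervalIntegral.integral_const_mul]
      ring
    · exact hf.mul_const _
    · have : ContinuousOn (fun s => ∫ t in (0 : ℝ)..s, g t) (Set.uIcc 0 L) :=
        intervalIntegral.continuousOn_primitive_interval' hg Set.left_mem_uIcc
      simpa only [intervalIntegral.integral_const_mul] using hf.mul_continuousOn this
  have e2 : ∫ s in (0 : ℝ)..L, F s * g s
      = F L * (∫ s in (0 : ℝ)..L, g s) - ∫ s in (0 : ℝ)..L, ∫ t in s..L, f t * g s := by
    rw [← intervalIntegral.integral_const_mul, ← intervalIntegral.integral_sub]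
    · refine intervalIntegral.integral_congr fun s hs => ?_
      rw [Set.uIcc_of_le hL] at hs
      have h1 := intervalIntegral.integral_add_adjacent_intervals
        (hF.mono hs).integrable (((hF.mono hs).integrable.symm).trans hf)
      simp only [hF.eq s hs, hF.eq L hLm, ← h1, intervalIntegral.integral_mul_const]
      ring
    · exact hg.const_mul _
    · have : ContinuousOn (fun s => ∫ t in s..L, f t) (Set.uIcc 0 L) := by
        have := intervalIntegral.continuousOn_primitive_interval' hf
          (Set.right_mem_uIcc (a := (0 : ℝ)) (b := L))
        simpa only [intervalIntegral.integral_symm L] using this.neg.congr fun s _ => by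
          simp [intervalIntegral.integral_symm s L]
      simpa only [intervalIntegral.integral_mul_const] using hg.continuousOn_mul this
  have e3 := integral_triangle_swap (fun s t => f s * g t) hL (by
    refine Integrable.indicator ?_ (measurableSet_le measurable_snd measurable_fst)
    exact ((intervalIntegrable_iff_integrableOn_Ioc_of_le hL).1 hf).mul_prod
      ((intervalIntegrable_iff_integrableOn_Ioc_of_le hL).1 hg))
  have hFc : ContinuousOn F (Set.uIcc 0 L) := by rw [Set.uIcc_of_le hL]; exact hF.continuousOn
  have hGc : ContinuousOn G (Set.uIcc 0 L) := by rw [Set.uIcc_of_le hL]; exact hG.continuousOn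
  rw [intervalIntegral.integral_add (hf.mul_continuousOn hGc) (hg.continuousOn_mul hFc), e1, e2, e3]
  have := hF.eq L hLm
  have := hG.eq L hLm
  linear_combination (-G 0) * hF.eq L hLm - F L * hG.eq L hLm

end IsPrimitive

/-- Lagrange's identity for absolutely continuous functions with `u'' = p`, `v'' = r`. -/
theorem lagrange_identity {L : ℝ} (hL : 0 ≤ L) {u u' p v v' r : ℝ → ℂ}
    (hu : IsPrimitive L u u') (hu' : IsPrimitive L u' p)
    (hv : IsPrimitive L v v') (hv' : IsPrimitive L v' r) :
    ∫ s in (0 : ℝ)..L, (p s * v s - u s * r s)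
      = u' L * v L - u L * v' L - (u' 0 * v 0 - u 0 * v' 0) := by
  have h1 := hu'.mul hL hv
  have h2 := hu.mul hL hv'
  have c : ∀ {w w' : ℝ → ℂ}, IsPrimitive L w w' → ContinuousOn w (Set.uIcc 0 L) := fun h => by
    rw [Set.uIcc_of_le hL]; exact h.continuousOn
  have i1 : IntervalIntegrable (fun s => p s * v s + u' s * v' s) volume 0 L :=
    (hu'.integrable.mul_continuousOn (c hv)).add (hv.integrable.continuousOn_mul (c hu'))
  have i2 : IntervalIntegrable (fun s => u' s * v' s + u s * r s) volume 0 L :=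
    (hu.integrable.mul_continuousOn (c hv')).add (hv'.integrable.continuousOn_mul (c hu))
  have : ∫ s in (0 : ℝ)..L, (p s * v s - u s * r s)
      = ∫ s in (0 : ℝ)..L, ((p s * v s + u' s * v' s) - (u' s * v' s + u s * r s)) := by
    congr 1; ext s; ring
  rw [this, intervalIntegral.integral_sub i1 i2, h1, h2]
  ring

/-! ### Volterra operators and the initial value problem. -/

section Volterra

variable {ℓ : ℝ}

/-- The Volterra operator `f ↦ ∫_0^x r f`. -/
def volterra (hℓ : 0 ≤ ℓ) (r : ℝ → ℂ) (hr : IntervalIntegrable r volume 0 ℓ) :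
    C(Set.Icc (0 : ℝ) ℓ, ℂ) →L[ℂ] C(Set.Icc (0 : ℝ) ℓ, ℂ) :=
  have hint : ∀ f : C(Set.Icc (0 : ℝ) ℓ, ℂ),
      IntervalIntegrable (fun s => r s * Set.IccExtend hℓ f s) volume 0 ℓ := fun f =>
    hr.mul_continuousOn (f.continuous.Icc_extend' (h := hℓ)).continuousOn
  LinearMap.mkContinuous
    { toFun := fun f => ⟨fun x => ∫ s in (0 : ℝ)..x, r s * Set.IccExtend hℓ f s, by
        have h := intervalIntegral.continuousOn_primitive_interval'
          (hint f) (Set.left_mem_uIcc (a := (0 : ℝ)) (b := ℓ))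
        rw [Set.uIcc_of_le hℓ] at h
        exact continuousOn_iff_continuous_domRestrict.1 h⟩
      map_add' := fun f g => by
        ext x
        change ∫ s in (0 : ℝ)..x, r s * (Set.IccExtend hℓ f s + Set.IccExtend hℓ g s)
          = (∫ s in (0 : ℝ)..x, r s * Set.IccExtend hℓ f s)
            + ∫ s in (0 : ℝ)..x, r s * Set.IccExtend hℓ g s
        rw [← intervalIntegral.integral_add (intervalIntegrable_mono_right (hint f) x.2)
          (intervalIntegrable_mono_right (hint g) x.2)]
        simp only [mul_add]
      map_smul' := fun c f => by
        ext x
        change ∫ s in (0 : ℝ)..x, r s * (c * Set.IccExtend hℓ f s)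
          = c * ∫ s in (0 : ℝ)..x, r s * Set.IccExtend hℓ f s
        rw [← intervalIntegral.integral_const_mul]
        congr 1; ext s; ring }
    (∫ s in (0 : ℝ)..ℓ, ‖r s‖) (fun f => by
      have h0 : 0 ≤ ∫ s in (0 : ℝ)..ℓ, ‖r s‖ :=
        intervalIntegral.integral_nonneg hℓ fun _ _ => norm_nonneg _
      refine (ContinuousMap.norm_le _ (by positivity)).2 fun x => ?_
      refine (intervalIntegral.norm_integral_le_integral_norm x.2.1).trans ?_
      rw [← intervalIntegral.integral_mul_const]
      calc ∫ s in (0 : ℝ)..x, ‖r s * Set.IccExtend hℓ f s‖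
          ≤ ∫ s in (0 : ℝ)..x, ‖r s‖ * ‖f‖ := by
            refine intervalIntegral.integral_mono_on x.2.1
              (intervalIntegrable_mono_right (hint f) x.2).norm
              ((intervalIntegrable_mono_right hr x.2).norm.mul_const _) fun s _ => ?_
            rw [norm_mul]
            exact mul_le_mul_of_nonneg_left (f.norm_coe_le_norm _) (norm_nonneg _)
        _ ≤ ∫ s in (0 : ℝ)..ℓ, ‖r s‖ * ‖f‖ :=
            intervalIntegral.integral_mono_interval le_rfl x.2.1 x.2.2
              (Eventually.of_forall fun s => by positivity) (hr.norm.mul_const _))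

theorem volterra_apply (hℓ : 0 ≤ ℓ) (r : ℝ → ℂ) (hr : IntervalIntegrable r volume 0 ℓ)
    (f : C(Set.Icc (0 : ℝ) ℓ, ℂ)) (x : Set.Icc (0 : ℝ) ℓ) :
    volterra hℓ r hr f x = ∫ s in (0 : ℝ)..x, r s * Set.IccExtend hℓ f s := rfl

/-- The value at `x` sees `f` only on `[0, x]`; a bound there, instead of the global norm, is what
keeps the powers of `x` in the iteration. -/
theorem norm_volterra_apply_le (hℓ : 0 ≤ ℓ) {r : ℝ → ℂ} (hr : IntervalIntegrable r volume 0 ℓ)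
    (f : C(Set.Icc (0 : ℝ) ℓ, ℂ)) (x : Set.Icc (0 : ℝ) ℓ) {B : ℝ}
    (hf : ∀ s : Set.Icc (0 : ℝ) ℓ, (s : ℝ) ≤ x → ‖f s‖ ≤ B) :
    ‖volterra hℓ r hr f x‖ ≤ (∫ s in (0 : ℝ)..ℓ, ‖r s‖) * B := by
  have hB : 0 ≤ B := (norm_nonneg _).trans (hf x le_rfl)
  rw [volterra_apply, ← intervalIntegral.integral_mul_const]
  refine (intervalIntegral.norm_integral_le_integral_norm x.2.1).trans ?_
  have hint : IntervalIntegrable (fun s => r s * Set.IccExtend hℓ f s) volume 0 ℓ :=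
    hr.mul_continuousOn (f.continuous.Icc_extend' (h := hℓ)).continuousOn
  calc ∫ s in (0 : ℝ)..x, ‖r s * Set.IccExtend hℓ f s‖
      ≤ ∫ s in (0 : ℝ)..x, ‖r s‖ * B := by
        refine intervalIntegral.integral_mono_on x.2.1
          (intervalIntegrable_mono_right hint x.2).norm
          ((intervalIntegrable_mono_right hr x.2).norm.mul_const _) fun s hs => ?_
        have hs' : s ∈ Set.Icc 0 ℓ := ⟨hs.1, hs.2.trans x.2.2⟩
        rw [norm_mul, Set.IccExtend_of_mem hℓ f hs']
        exact mul_le_mul_of_nonneg_left (hf ⟨s, hs'⟩ hs.2) (norm_nonneg _)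
    _ ≤ ∫ s in (0 : ℝ)..ℓ, ‖r s‖ * B :=
        intervalIntegral.integral_mono_interval le_rfl x.2.1 x.2.2
          (Eventually.of_forall fun s => by positivity) (hr.norm.mul_const _)

/-- As `r` is only integrable, the inner integration contributes just the constant `∫ |r|`; each
outer integration against 1 raises the power of `x` and so produces the factorial. -/
theorem norm_volterra_comp_pow_apply_le (hℓ : 0 ≤ ℓ) {r : ℝ → ℂ}
    (hr : IntervalIntegrable r volume 0 ℓ) (n : ℕ) (f : C(Set.Icc (0 : ℝ) ℓ, ℂ))
    (x : Set.Icc (0 : ℝ) ℓ) :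
    ‖((volterra hℓ 1 intervalIntegrable_const ∘L volterra hℓ r hr) ^ n) f x‖
      ≤ ((∫ s in (0 : ℝ)..ℓ, ‖r s‖) * x) ^ n / n.factorial * ‖f‖ := by
  set R := ∫ s in (0 : ℝ)..ℓ, ‖r s‖
  have hR : 0 ≤ R := intervalIntegral.integral_nonneg hℓ fun _ _ => norm_nonneg _
  induction n generalizing x with
  | zero => simpa using f.norm_coe_le_norm x
  | succ n ih =>
    rw [pow_succ', mul_apply_eq_comp, ContinuousLinearMap.comp_apply, volterra_apply]
    set g := ((volterra hℓ 1 intervalIntegrable_const ∘L volterra hℓ r hr) ^ n) f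
    have hb : ∀ s ∈ Set.Ioc 0 (x : ℝ), ‖(1 : ℝ → ℂ) s * Set.IccExtend hℓ (volterra hℓ r hr g) s‖
        ≤ R * ((R * s) ^ n / n.factorial * ‖f‖) := fun s hs => by
      have hs' : s ∈ Set.Icc 0 ℓ := ⟨hs.1.le, hs.2.trans x.2.2⟩
      rw [Pi.one_apply, one_mul, Set.IccExtend_of_mem hℓ _ hs']
      refine norm_volterra_apply_le hℓ hr g ⟨s, hs'⟩ fun t ht => (ih t).trans ?_
      have := t.2.1
      gcongr
    have hc : Continuous fun s : ℝ => R * ((R * s) ^ n / n.factorial * ‖f‖) := by fun_prop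
    refine (intervalIntegral.norm_integral_le_of_norm_le x.2.1 (Eventually.of_forall hb)
      (hc.intervalIntegrable _ _)).trans (le_of_eq ?_)
    have : ∀ s : ℝ, R * ((R * s) ^ n / n.factorial * ‖f‖)
        = (R ^ (n + 1) / n.factorial * ‖f‖) * s ^ n := fun s => by ring
    simp only [this]
    rw [intervalIntegral.integral_const_mul, integral_pow, Nat.factorial_succ]
    have : (n.factorial : ℝ) ≠ 0 := by positivity
    push_cast
    field_simp
    ring

theorem isUnit_one_sub_of_isUnit_one_sub_pow {R : Type*} [Ring R] {b : R} {n : ℕ}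
    (h : IsUnit (1 - b ^ n)) : IsUnit (1 - b) := by
  rw [← mul_neg_geom_sum] at h
  have hc : Commute (1 - b) (∑ i ∈ Finset.range n, b ^ i) :=
    Commute.sum_right _ _ _ fun i _ => ((Commute.one_left _).sub_left (Commute.refl b)).pow_right i
  exact (hc.isUnit_mul_iff.1 h).1

/-- The factorial bound makes some power of the operator a strict contraction, and `1 - b` divides
`1 - b ^ n` with a commuting cofactor. -/
theorem isUnit_one_sub_volterra_comp (hℓ : 0 ≤ ℓ) {r : ℝ → ℂ}
    (hr : IntervalIntegrable r volume 0 ℓ) :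
    IsUnit (1 - volterra hℓ 1 intervalIntegrable_const ∘L volterra hℓ r hr) := by
  set B := volterra hℓ 1 intervalIntegrable_const ∘L volterra hℓ r hr
  set R := ∫ s in (0 : ℝ)..ℓ, ‖r s‖
  have hR : 0 ≤ R := intervalIntegral.integral_nonneg hℓ fun _ _ => norm_nonneg _
  obtain ⟨n, hn⟩ := ((FloorSemiring.tendsto_pow_div_factorial_atTop (R * ℓ)).eventually
    (gt_mem_nhds one_pos)).exists
  have hB : ‖B ^ n‖ < 1 := by
    refine lt_of_le_of_lt (ContinuousLinearMap.opNorm_le_bound _ (by positivity) fun f => ?_) hn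
    refine (ContinuousMap.norm_le _ (by positivity)).2 fun x => ?_
    refine (norm_volterra_comp_pow_apply_le hℓ hr n f x).trans ?_
    have := x.2.1
    have := x.2.2
    gcongr
  have h := isUnit_one_sub_of_norm_lt_one
    (R := C(Set.Icc (0 : ℝ) ℓ, ℂ) →L[ℂ] C(Set.Icc (0 : ℝ) ℓ, ℂ)) hB
  exact isUnit_one_sub_of_isUnit_one_sub_pow h

end Volterra

section Solve

variable {ℓ : ℝ} {q : ℝ → ℝ}

theorem intervalIntegrable_ofReal (hq : IntervalIntegrable q volume 0 ℓ) :
    IntervalIntegrable (fun s => (q s : ℂ)) volume 0 ℓ :=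
  ⟨hq.1.ofReal, hq.2.ofReal⟩

/-- The integral operator of the equation `v'' = (q - z) v`. -/
def potentialOp (hℓ : 0 ≤ ℓ) (hq : IntervalIntegrable q volume 0 ℓ) (z : ℂ) :
    C(Set.Icc (0 : ℝ) ℓ, ℂ) →L[ℂ] C(Set.Icc (0 : ℝ) ℓ, ℂ) :=
  volterra hℓ 1 intervalIntegrable_const ∘L
      volterra hℓ (fun s => (q s : ℂ)) (intervalIntegrable_ofReal hq)
    - z • (volterra hℓ 1 intervalIntegrable_const ∘L volterra hℓ 1 intervalIntegrable_const)

/-- The definition displays affine dependence on `z`, which gives analyticity of the inverse; this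
single-composition form is the one to which the invertibility of Volterra operators applies. -/
theorem potentialOp_eq (hℓ : 0 ≤ ℓ) (hq : IntervalIntegrable q volume 0 ℓ) (z : ℂ) :
    potentialOp hℓ hq z = volterra hℓ 1 intervalIntegrable_const ∘L
      volterra hℓ (fun s => (q s : ℂ) - z)
        ((intervalIntegrable_ofReal hq).sub intervalIntegrable_const) := by
  have : volterra hℓ (fun s => (q s : ℂ) - z)
        ((intervalIntegrable_ofReal hq).sub intervalIntegrable_const)
      = volterra hℓ (fun s => (q s : ℂ)) (intervalIntegrable_ofReal hq)
        - z • volterra hℓ 1 intervalIntegrable_const := by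
    ext f x
    simp only [sub_apply, smul_apply,
      ContinuousMap.sub_apply, ContinuousMap.smul_apply, volterra_apply, smul_eq_mul]
    have hf := (f.continuous.Icc_extend' (h := hℓ)).continuousOn (s := Set.uIcc 0 (x : ℝ))
    rw [← intervalIntegral.integral_const_mul, ← intervalIntegral.integral_sub
      ((intervalIntegrable_mono_right (intervalIntegrable_ofReal hq) x.2).mul_continuousOn hf)]
    · congr 1; ext s; simp; ring
    · exact ((intervalIntegrable_const (c := (1 : ℂ))).mul_continuousOn hf).const_mul z
  rw [this, potentialOp, ContinuousLinearMap.comp_sub, ContinuousLinearMap.comp_smul]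

/-- The solution `v` of `v = g + potentialOp z v`. -/
def solve (hℓ : 0 ≤ ℓ) (hq : IntervalIntegrable q volume 0 ℓ) (z : ℂ)
    (g : C(Set.Icc (0 : ℝ) ℓ, ℂ)) : C(Set.Icc (0 : ℝ) ℓ, ℂ) :=
  Ring.inverse (1 - potentialOp hℓ hq z) g

theorem isUnit_one_sub_potentialOp (hℓ : 0 ≤ ℓ) (hq : IntervalIntegrable q volume 0 ℓ) (z : ℂ) :
    IsUnit (1 - potentialOp hℓ hq z) := by
  rw [potentialOp_eq]
  exact isUnit_one_sub_volterra_comp hℓ _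

theorem differentiable_ringInverse_apply {E : Type*} [NormedAddCommGroup E] [NormedSpace ℂ E]
    [CompleteSpace E] (A B : E →L[ℂ] E) (hu : ∀ z : ℂ, IsUnit (1 - (A - z • B))) (g : E) :
    Differentiable ℂ (fun z : ℂ => Ring.inverse (1 - (A - z • B)) g) := fun z => by
  have h1 : DifferentiableAt ℂ (fun z : ℂ => 1 - (A - z • B)) z :=
    ((differentiableAt_fun_id.smul_const _).const_sub _).const_sub _
  have h2 := (differentiableAt_inverse (𝕜 := ℂ) (hu z)).comp z h1
  exact h2.clm_apply (differentiableAt_const g)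

theorem differentiable_solve (hℓ : 0 ≤ ℓ) (hq : IntervalIntegrable q volume 0 ℓ)
    (g : C(Set.Icc (0 : ℝ) ℓ, ℂ)) : Differentiable ℂ (fun z => solve hℓ hq z g) := by
  exact differentiable_ringInverse_apply _ _ (isUnit_one_sub_potentialOp hℓ hq) g

theorem eq_solve (hℓ : 0 ≤ ℓ) (hq : IntervalIntegrable q volume 0 ℓ) {z : ℂ}
    {f g : C(Set.Icc (0 : ℝ) ℓ, ℂ)} (hf : f = g + potentialOp hℓ hq z f) :
    f = solve hℓ hq z g := by
  have : (1 - potentialOp hℓ hq z) f = g := by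
    rw [sub_apply, one_apply_eq_self, sub_eq_iff_eq_add]
    exact hf
  rw [solve, ← this, ← mul_apply_eq_comp,
    Ring.inverse_mul_cancel _ (isUnit_one_sub_potentialOp hℓ hq z), one_apply_eq_self]

theorem solve_eq (hℓ : 0 ≤ ℓ) (hq : IntervalIntegrable q volume 0 ℓ) (z : ℂ)
    (g : C(Set.Icc (0 : ℝ) ℓ, ℂ)) :
    solve hℓ hq z g = g + potentialOp hℓ hq z (solve hℓ hq z g) := by
  have h : (1 - potentialOp hℓ hq z) (solve hℓ hq z g) = g := by
    rw [solve, ← mul_apply_eq_comp,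
      Ring.mul_inverse_cancel _ (isUnit_one_sub_potentialOp hℓ hq z), one_apply_eq_self]
  rw [← sub_eq_iff_eq_add]
  exact h

/-- The restriction to `[0, ℓ]` of an absolutely continuous function. -/
def restrictIcc {F f : ℝ → ℂ} (hF : IsPrimitive ℓ F f) : C(Set.Icc (0 : ℝ) ℓ, ℂ) :=
  ⟨(Set.Icc 0 ℓ).domRestrict F, continuousOn_iff_continuous_domRestrict.1 hF.continuousOn⟩

/-- The affine function `a + b x` on `[0, ℓ]`. -/
def affineIcc (ℓ : ℝ) (a b : ℂ) : C(Set.Icc (0 : ℝ) ℓ, ℂ) :=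
  ⟨fun x => a + b * ((x : ℝ) : ℂ), by fun_prop⟩

/-- Uniqueness for the initial value problem: two integrations turn the equation into the
fixed-point equation, whose operator is invertible. -/
theorem restrictIcc_eq_solve (hℓ : 0 ≤ ℓ) (hq : IntervalIntegrable q volume 0 ℓ) {z : ℂ}
    {v v' : ℝ → ℂ} (hv : IsPrimitive ℓ v v')
    (hv' : IsPrimitive ℓ v' (fun s => ((q s : ℂ) - z) * v s)) :
    restrictIcc hv = solve hℓ hq z (affineIcc ℓ (v 0) (v' 0)) := by
  refine eq_solve hℓ hq ?_
  rw [potentialOp_eq]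
  ext x
  have e : ∀ s ∈ Set.Icc 0 ℓ, Set.IccExtend hℓ (volterra hℓ (fun s => (q s : ℂ) - z)
        ((intervalIntegrable_ofReal hq).sub intervalIntegrable_const) (restrictIcc hv)) s
      = v' s - v' 0 := fun s hs => by
    rw [Set.IccExtend_of_mem hℓ _ hs, volterra_apply, hv'.eq s hs, add_sub_cancel_left]
    refine intervalIntegral.integral_congr fun t ht => ?_
    rw [Set.uIcc_of_le hs.1] at ht
    simp only [Set.IccExtend_of_mem hℓ (restrictIcc hv) (x := t) ⟨ht.1, ht.2.trans hs.2⟩]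
    rfl
  change v x = v 0 + v' 0 * ((x : ℝ) : ℂ) + _
  rw [ContinuousLinearMap.comp_apply, volterra_apply, hv.eq x x.2]
  have : ∫ s in (0 : ℝ)..x, (1 : ℝ → ℂ) s * Set.IccExtend hℓ (volterra hℓ (fun s => (q s : ℂ) - z)
        ((intervalIntegrable_ofReal hq).sub intervalIntegrable_const) (restrictIcc hv)) s
      = ∫ s in (0 : ℝ)..x, (v' s - v' 0) := by
    refine intervalIntegral.integral_congr fun t ht => ?_
    rw [Set.uIcc_of_le x.2.1] at ht
    simp only [Pi.one_apply, one_mul]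
    exact e t ⟨ht.1, ht.2.trans x.2.2⟩
  rw [this, intervalIntegral.integral_sub (hv.mono x.2).integrable intervalIntegrable_const]
  simp
  ring

/-- The solution of `-v'' + (q - z) v = w`, `v (0) = v' (0) = 0`, which depends analytically
on `z`. -/
theorem exists_inhomogeneous_solution (hℓ : 0 ≤ ℓ) (hq : IntervalIntegrable q volume 0 ℓ)
    {w : ℝ → ℂ} (hw : IntervalIntegrable w volume 0 ℓ) :
    ∃ V : ℂ → C(Set.Icc (0 : ℝ) ℓ, ℂ), Differentiable ℂ V ∧ ∀ z, ∃ v' : ℝ → ℂ,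
      IsPrimitive ℓ (Set.IccExtend hℓ (V z)) v' ∧
      IsPrimitive ℓ v' (fun s => ((q s : ℂ) - z) * Set.IccExtend hℓ (V z) s - w s) ∧
      Set.IccExtend hℓ (V z) 0 = 0 ∧ v' 0 = 0 := by
  have h1 : IntervalIntegrable (1 : ℝ → ℂ) volume 0 ℓ := intervalIntegrable_const
  let one : C(Set.Icc (0 : ℝ) ℓ, ℂ) := 1
  let g := -(volterra hℓ 1 h1 (volterra hℓ w hw one))
  refine ⟨fun z => solve hℓ hq z g, differentiable_solve hℓ hq g, fun z => ?_⟩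
  set f := solve hℓ hq z g
  have hr := (intervalIntegrable_ofReal hq).sub (intervalIntegrable_const (c := z))
  have hf : f = g + potentialOp hℓ hq z f := solve_eq hℓ hq z g
  have hfc := (f.continuous.Icc_extend' (h := hℓ))
  -- The future derivative of the solution: the fixed-point equation says exactly that `f` is the
  -- primitive of `d` vanishing at 0.
  let d : C(Set.Icc (0 : ℝ) ℓ, ℂ) :=
    volterra hℓ (fun s => (q s : ℂ) - z) hr f - volterra hℓ w hw one
  have hd : ∀ x, d x = volterra hℓ (fun s => (q s : ℂ) - z) hr f x - volterra hℓ w hw one x :=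
    fun _ => rfl
  let v' : ℝ → ℂ := Set.IccExtend hℓ d
  have hv'c : Continuous v' := Continuous.Icc_extend' (h := hℓ)
    d.continuous
  have e : f = volterra hℓ 1 h1 d := by
    conv_lhs => rw [hf, potentialOp_eq]
    simp only [d]
    rw [map_sub, ContinuousLinearMap.comp_apply]
    simp only [g]; abel
  have h00 : (0 : ℝ) ∈ Set.Icc 0 ℓ := ⟨le_rfl, hℓ⟩
  have f0 : Set.IccExtend hℓ f 0 = 0 := by
    rw [Set.IccExtend_of_mem hℓ _ h00, e, volterra_apply]; simp
  have v0 : v' 0 = 0 := by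
    simp only [v']
    rw [Set.IccExtend_of_mem hℓ _ h00, hd, volterra_apply, volterra_apply]
    simp
  refine ⟨v', ⟨hv'c.intervalIntegrable _ _, fun x hx => ?_⟩, ⟨?_, fun x hx => ?_⟩, f0, v0⟩
  · change Set.IccExtend hℓ f x = Set.IccExtend hℓ f 0 + _
    rw [f0, Set.IccExtend_of_mem hℓ _ hx, e, volterra_apply]
    simp [v']
  · exact (hr.mul_continuousOn hfc.continuousOn).sub hw
  · rw [v0]
    simp only [v']
    rw [Set.IccExtend_of_mem hℓ _ hx, hd, volterra_apply, volterra_apply,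
      ← intervalIntegral.integral_sub]
    · rw [zero_add]
      refine intervalIntegral.integral_congr fun t _ => ?_
      simp only [one, Set.IccExtend, Function.comp, ContinuousMap.one_apply, mul_one]
      rfl
    · exact intervalIntegrable_mono_right (hr.mul_continuousOn hfc.continuousOn) hx
    · simpa [one, Set.IccExtend] using intervalIntegrable_mono_right hw hx

end Solve

/-- Integration over `[0, ℓ]` against the weight `w`, as a functional on continuous functions. -/
def weightedIntegral {ℓ : ℝ} (hℓ : 0 ≤ ℓ) (w : ℝ → ℂ) (hw : IntervalIntegrable w volume 0 ℓ) :
    C(Set.Icc (0 : ℝ) ℓ, ℂ) →L[ℂ] ℂ :=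
  ContinuousMap.evalCLM ℂ (⟨ℓ, hℓ, le_rfl⟩ : Set.Icc (0 : ℝ) ℓ) ∘L volterra hℓ w hw

theorem weightedIntegral_apply {ℓ : ℝ} (hℓ : 0 ≤ ℓ) (w : ℝ → ℂ)
    (hw : IntervalIntegrable w volume 0 ℓ) {f : C(Set.Icc (0 : ℝ) ℓ, ℂ)} {g : ℝ → ℂ}
    (hfg : ∀ x : Set.Icc (0 : ℝ) ℓ, f x = g x) :
    weightedIntegral hℓ w hw f = ∫ s in (0 : ℝ)..ℓ, w s * g s := by
  change ∫ s in (0 : ℝ)..ℓ, w s * Set.IccExtend hℓ f s = _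
  refine intervalIntegral.integral_congr fun s hs => ?_
  rw [Set.uIcc_of_le hℓ] at hs
  simp only [Set.IccExtend_of_mem hℓ f hs, hfg]

/-! ### Analyticity of `Φ`, reality and simplicity of its zeros, norming constants. -/

namespace IsFundamentalSolution

variable {q : ℝ → ℝ} {h H ℓ : ℝ} {y y' : ℝ → ℂ → ℂ}

theorem apply_zero (hy : IsFundamentalSolution q h ℓ y y') (hℓ : 0 ≤ ℓ) (z : ℂ) : y 0 z = 1 := by
  simpa using hy.eq z 0 ⟨le_rfl, hℓ⟩

theorem deriv_apply_zero (hy : IsFundamentalSolution q h ℓ y y') (hℓ : 0 ≤ ℓ) (z : ℂ) :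
    y' 0 z = h := by
  simpa using hy.deriv_eq z 0 ⟨le_rfl, hℓ⟩

theorem isPrimitive (hy : IsFundamentalSolution q h ℓ y y') (hℓ : 0 ≤ ℓ) (z : ℂ) :
    IsPrimitive ℓ (fun x => y x z) (fun x => y' x z) :=
  ⟨ContinuousOn.intervalIntegrable (by rw [Set.uIcc_of_le hℓ]; exact hy.continuousOn_deriv z),
    fun x hx => by rw [hy.apply_zero hℓ]; exact hy.eq z x hx⟩

theorem isPrimitive_deriv (hy : IsFundamentalSolution q h ℓ y y') (hℓ : 0 ≤ ℓ)
    (hq : IntervalIntegrable q volume 0 ℓ) (z : ℂ) :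
    IsPrimitive ℓ (fun x => y' x z) (fun s => ((q s : ℂ) - z) * y s z) :=
  ⟨((intervalIntegrable_ofReal hq).sub intervalIntegrable_const).mul_continuousOn
    (by rw [Set.uIcc_of_le hℓ]; exact hy.continuousOn z),
    fun x hx => by rw [hy.deriv_apply_zero hℓ]; exact hy.deriv_eq z x hx⟩

/-- Nothing is assumed about how `y` depends on `z`; uniqueness transfers the analyticity of `solve`
to it. -/
theorem eq_solve (hy : IsFundamentalSolution q h ℓ y y') (hℓ : 0 ≤ ℓ)
    (hq : IntervalIntegrable q volume 0 ℓ) (z : ℂ) (x : Set.Icc (0 : ℝ) ℓ) :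
    solve hℓ hq z (affineIcc ℓ 1 h) x = y x z := by
  have := restrictIcc_eq_solve hℓ hq (hy.isPrimitive hℓ z) (hy.isPrimitive_deriv hℓ hq z)
  rw [hy.apply_zero hℓ, hy.deriv_apply_zero hℓ] at this
  rw [← this]; rfl

theorem differentiable_integral (hy : IsFundamentalSolution q h ℓ y y') (hℓ : 0 ≤ ℓ)
    (hq : IntervalIntegrable q volume 0 ℓ) {w : ℝ → ℂ} (hw : IntervalIntegrable w volume 0 ℓ) :
    Differentiable ℂ (fun z => ∫ s in (0 : ℝ)..ℓ, w s * y s z) := by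
  have := (weightedIntegral hℓ w hw).differentiable.comp
    (differentiable_solve hℓ hq (affineIcc ℓ 1 h))
  rwa [show (fun z => ∫ s in (0 : ℝ)..ℓ, w s * y s z) = _ from funext fun z =>
    (weightedIntegral_apply hℓ w hw (g := fun s => y s z) (hy.eq_solve hℓ hq z)).symm]

theorem differentiable_apply (hy : IsFundamentalSolution q h ℓ y y') (hℓ : 0 ≤ ℓ)
    (hq : IntervalIntegrable q volume 0 ℓ) {x : ℝ} (hx : x ∈ Set.Icc 0 ℓ) :
    Differentiable ℂ (fun z => y x z) := by
  have := (ContinuousMap.evalCLM ℂ (⟨x, hx⟩ : Set.Icc (0 : ℝ) ℓ)).differentiable.comp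
    (differentiable_solve hℓ hq (affineIcc ℓ 1 h))
  rwa [show (fun z => y x z) = _ from funext fun z => (hy.eq_solve hℓ hq z ⟨x, hx⟩).symm]

theorem differentiable_charFun (hy : IsFundamentalSolution q h ℓ y y') (hℓ : 0 ≤ ℓ)
    (hq : IntervalIntegrable q volume 0 ℓ) : Differentiable ℂ (charFun ℓ H y y') := by
  have hℓm : ℓ ∈ Set.Icc 0 ℓ := ⟨hℓ, le_rfl⟩
  have h1 := hy.differentiable_integral hℓ hq (intervalIntegrable_ofReal hq)
  have h2 := hy.differentiable_integral hℓ hq (intervalIntegrable_const (c := (1 : ℂ)))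
  -- The integrated equation expresses `y'(ℓ, z)` through functionals of `y(·, z)`, whose
  -- analyticity is already known.
  have h3 : ∀ z, y' ℓ z = (h : ℂ) + ((∫ s in (0 : ℝ)..ℓ, (q s : ℂ) * y s z)
      - z * ∫ s in (0 : ℝ)..ℓ, 1 * y s z) := fun z => by
    have hc : ContinuousOn (fun s => y s z) (Set.uIcc 0 ℓ) := by
      rw [Set.uIcc_of_le hℓ]; exact hy.continuousOn z
    rw [hy.deriv_eq z ℓ hℓm, ← intervalIntegral.integral_const_mul,
      ← intervalIntegral.integral_sub ((intervalIntegrable_ofReal hq).mul_continuousOn hc)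
        ((intervalIntegrable_const.mul_continuousOn hc).const_mul z)]
    congr 2; ext s; ring
  unfold charFun
  simp only [h3]
  exact (((h1.sub (differentiable_id.mul h2)).const_add _)).add
    ((hy.differentiable_apply hℓ hq hℓm).const_mul _)

/-- Since `q` and `h` are real, the conjugate of `y(·, z)` solves the problem for the conjugate
parameter with the same initial data; uniqueness finishes. -/
theorem apply_conj (hy : IsFundamentalSolution q h ℓ y y') (hℓ : 0 ≤ ℓ)
    (hq : IntervalIntegrable q volume 0 ℓ) (z : ℂ) {x : ℝ} (hx : x ∈ Set.Icc 0 ℓ) :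
    y x (starRingEnd ℂ z) = starRingEnd ℂ (y x z) := by
  have h1 := (hy.isPrimitive hℓ z).conj
  have h2 := (hy.isPrimitive_deriv hℓ hq z).conj
  have := restrictIcc_eq_solve (z := starRingEnd ℂ z) hℓ hq h1
    (h2.congr_deriv hℓ fun s _ => by simp)
  rw [hy.apply_zero hℓ, hy.deriv_apply_zero hℓ, map_one, Complex.conj_ofReal] at this
  rw [← hy.eq_solve hℓ hq _ ⟨x, hx⟩, ← this]; rfl

theorem deriv_apply_conj (hy : IsFundamentalSolution q h ℓ y y') (hℓ : 0 ≤ ℓ)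
    (hq : IntervalIntegrable q volume 0 ℓ) (z : ℂ) {x : ℝ} (hx : x ∈ Set.Icc 0 ℓ) :
    y' x (starRingEnd ℂ z) = starRingEnd ℂ (y' x z) := by
  rw [hy.deriv_eq _ x hx, hy.deriv_eq z x hx, map_add, Complex.conj_ofReal,
    ← intervalIntegral.intervalIntegral_conj]
  congr 1
  refine intervalIntegral.integral_congr fun s hs => ?_
  rw [Set.uIcc_of_le hx.1] at hs
  simp [hy.apply_conj hℓ hq z ⟨hs.1, hs.2.trans hx.2⟩]

theorem apply_ofReal (hy : IsFundamentalSolution q h ℓ y y') (hℓ : 0 ≤ ℓ)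
    (hq : IntervalIntegrable q volume 0 ℓ) (μ : ℝ) {x : ℝ} (hx : x ∈ Set.Icc 0 ℓ) :
    ((y x μ).re : ℂ) = y x μ := by
  rw [← Complex.conj_eq_iff_re, ← hy.apply_conj hℓ hq _ hx, Complex.conj_ofReal]

theorem deriv_apply_ofReal (hy : IsFundamentalSolution q h ℓ y y') (hℓ : 0 ≤ ℓ)
    (hq : IntervalIntegrable q volume 0 ℓ) (μ : ℝ) {x : ℝ} (hx : x ∈ Set.Icc 0 ℓ) :
    ((y' x μ).re : ℂ) = y' x μ := by
  rw [← Complex.conj_eq_iff_re, ← hy.deriv_apply_conj hℓ hq _ hx, Complex.conj_ofReal]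

theorem charFun_conj (hy : IsFundamentalSolution q h ℓ y y') (hℓ : 0 ≤ ℓ)
    (hq : IntervalIntegrable q volume 0 ℓ) (z : ℂ) :
    charFun ℓ H y y' (starRingEnd ℂ z) = starRingEnd ℂ (charFun ℓ H y y' z) := by
  simp [charFun, hy.apply_conj hℓ hq z ⟨hℓ, le_rfl⟩, hy.deriv_apply_conj hℓ hq z ⟨hℓ, le_rfl⟩]

/-- Lagrange's identity for two spectral parameters: the terms at 0 cancel because the initial data
agree, and those in `H` cancel each other. Taking `w` conjugate to `z` gives reality, two distinct
zeros give orthogonality, and `z → w` gives the norming constants. -/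
theorem mul_integral_mul (hy : IsFundamentalSolution q h ℓ y y') (hℓ : 0 ≤ ℓ)
    (hq : IntervalIntegrable q volume 0 ℓ) (H : ℝ) (z w : ℂ) :
    (w - z) * ∫ s in (0 : ℝ)..ℓ, y s z * y s w
      = charFun ℓ H y y' z * y ℓ w - charFun ℓ H y y' w * y ℓ z := by
  have := lagrange_identity hℓ (hy.isPrimitive hℓ z) (hy.isPrimitive_deriv hℓ hq z)
    (hy.isPrimitive hℓ w) (hy.isPrimitive_deriv hℓ hq w)
  simp only [hy.apply_zero hℓ, hy.deriv_apply_zero hℓ] at this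
  rw [← intervalIntegral.integral_const_mul]
  unfold charFun
  have e : ∀ s, (w - z) * (y s z * y s w)
    = ((q s : ℂ) - z) * y s z * y s w - y s z * (((q s : ℂ) - w) * y s w) := fun s => by ring
  simp only [e, this]
  ring

theorem integral_norm_sq_pos (hy : IsFundamentalSolution q h ℓ y y') (hℓ : 0 < ℓ) (z : ℂ) :
    0 < ∫ x in (0 : ℝ)..ℓ, ‖y x z‖ ^ 2 := by
  refine intervalIntegral.integral_pos hℓ ((hy.continuousOn z).norm.pow 2)
    (fun x _ => by positivity) ⟨0, ⟨le_rfl, hℓ.le⟩, ?_⟩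
  simp [hy.apply_zero hℓ.le]

theorem im_eq_zero_of_charFun_eq_zero (hy : IsFundamentalSolution q h ℓ y y') (hℓ : 0 < ℓ)
    (hq : IntervalIntegrable q volume 0 ℓ) {z : ℂ} (hz : charFun ℓ H y y' z = 0) : z.im = 0 := by
  have h1 := hy.mul_integral_mul hℓ.le hq H z (starRingEnd ℂ z)
  rw [hy.charFun_conj hℓ.le hq, hz, map_zero, zero_mul, zero_mul, sub_zero] at h1
  have h2 : ∫ s in (0 : ℝ)..ℓ, y s z * y s (starRingEnd ℂ z)
      = ((∫ x in (0 : ℝ)..ℓ, ‖y x z‖ ^ 2 : ℝ) : ℂ) := by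
    rw [← intervalIntegral.integral_ofReal]
    refine intervalIntegral.integral_congr fun s hs => ?_
    rw [Set.uIcc_of_le hℓ.le] at hs
    simp only [hy.apply_conj hℓ.le hq z hs, Complex.mul_conj, Complex.normSq_eq_norm_sq]
  rw [h2] at h1
  have h3 := (mul_eq_zero.1 h1).resolve_right
    (by exact_mod_cast (hy.integral_norm_sq_pos hℓ z).ne')
  exact Complex.conj_eq_iff_im.1 (sub_eq_zero.1 h3)

theorem integral_norm_sq_ofReal (hy : IsFundamentalSolution q h ℓ y y') (hℓ : 0 ≤ ℓ)
    (hq : IntervalIntegrable q volume 0 ℓ) (μ : ℝ) :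
    ((∫ x in (0 : ℝ)..ℓ, ‖y x μ‖ ^ 2 : ℝ) : ℂ) = ∫ s in (0 : ℝ)..ℓ, y s μ * y s μ := by
  rw [← intervalIntegral.integral_ofReal]
  refine intervalIntegral.integral_congr fun s hs => ?_
  rw [Set.uIcc_of_le hℓ] at hs
  have := hy.apply_ofReal hℓ hq μ hs
  rw [← Complex.conj_eq_iff_re] at this
  change ((‖y s μ‖ ^ 2 : ℝ) : ℂ) = y s μ * y s μ
  nth_rw 3 [← this]
  rw [Complex.mul_conj, Complex.normSq_eq_norm_sq]

theorem integral_norm_sq_eq (hy : IsFundamentalSolution q h ℓ y y') (hℓ : 0 ≤ ℓ)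
    (hq : IntervalIntegrable q volume 0 ℓ) {μ : ℝ} (hμ : charFun ℓ H y y' μ = 0) :
    ((∫ x in (0 : ℝ)..ℓ, ‖y x μ‖ ^ 2 : ℝ) : ℂ) = -(y ℓ μ) * deriv (charFun ℓ H y y') μ := by
  rw [hy.integral_norm_sq_ofReal hℓ hq]
  have hc : ContinuousOn (fun s => y s μ) (Set.uIcc 0 ℓ) := by
    rw [Set.uIcc_of_le hℓ]; exact hy.continuousOn μ
  -- Divided by `μ - z`, the Lagrange identity has an integral continuous in `z` on one side and
  -- `-y(ℓ, μ)` times a difference quotient of `Φ` on the other; the limits at `z = μ` agree.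
  have hcont := (hy.differentiable_integral hℓ hq hc.intervalIntegrable).continuous.tendsto (μ : ℂ)
  have hd : HasDerivAt (charFun ℓ H y y') (deriv (charFun ℓ H y y') μ) μ :=
    (hy.differentiable_charFun hℓ hq μ).hasDerivAt
  rw [hasDerivAt_iff_tendsto_slope] at hd
  refine tendsto_nhds_unique (hcont.mono_left nhdsWithin_le_nhds) ((hd.const_mul (-(y ℓ μ))).congr' ?_)
  filter_upwards [self_mem_nhdsWithin] with z hz
  have h1 := hy.mul_integral_mul hℓ hq H z μ
  rw [hμ, zero_mul, sub_zero] at h1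
  have hz' : z - μ ≠ 0 := sub_ne_zero.2 hz
  have e : ∀ s, y s μ * y s z = y s z * y s μ := fun s => mul_comm _ _
  simp only [e]
  rw [slope_def_field, hμ, sub_zero]
  field_simp
  linear_combination h1

theorem deriv_charFun_ne_zero (hy : IsFundamentalSolution q h ℓ y y') (hℓ : 0 < ℓ)
    (hq : IntervalIntegrable q volume 0 ℓ) {z : ℂ} (hz : charFun ℓ H y y' z = 0) :
    deriv (charFun ℓ H y y') z ≠ 0 := by
  have him := hy.im_eq_zero_of_charFun_eq_zero hℓ hq hz
  obtain ⟨μ, rfl⟩ : ∃ μ : ℝ, z = μ := ⟨z.re, Complex.ext (by simp) (by simpa using him)⟩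
  intro h0
  have h1 := hy.integral_norm_sq_eq hℓ.le hq hz
  rw [h0, mul_zero] at h1
  exact (hy.integral_norm_sq_pos hℓ μ).ne' (by exact_mod_cast h1)

theorem integral_mul_eq_zero (hy : IsFundamentalSolution q h ℓ y y') (hℓ : 0 ≤ ℓ)
    (hq : IntervalIntegrable q volume 0 ℓ) {z w : ℂ} (hz : charFun ℓ H y y' z = 0)
    (hw : charFun ℓ H y y' w = 0) (hzw : z ≠ w) : ∫ s in (0 : ℝ)..ℓ, y s z * y s w = 0 := by
  have := hy.mul_integral_mul hℓ hq H z w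
  rw [hz, hw, zero_mul, zero_mul, sub_zero] at this
  exact (mul_eq_zero.1 this).resolve_left (sub_ne_zero.2 hzw.symm)

end IsFundamentalSolution

/-! ### Asymptotics of the solutions for large spectral parameter. -/

theorem norm_exp_mul_I_le (w : ℂ) : ‖Complex.exp (w * Complex.I)‖ ≤ Real.exp |w.im| := by
  rw [Complex.norm_exp]
  simp only [Complex.mul_re, Complex.I_re, Complex.I_im, mul_zero, mul_one, zero_sub]
  exact Real.exp_le_exp.2 (neg_le_abs _)

theorem norm_exp_neg_mul_I_le (w : ℂ) : ‖Complex.exp (-w * Complex.I)‖ ≤ Real.exp |w.im| := by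
  simpa using norm_exp_mul_I_le (-w)

theorem norm_cos_le_exp (w : ℂ) : ‖Complex.cos w‖ ≤ Real.exp |w.im| := by
  rw [Complex.cos, norm_div, Complex.norm_ofNat, div_le_iff₀ two_pos]
  linarith [norm_add_le (Complex.exp (w * Complex.I)) (Complex.exp (-w * Complex.I)),
    norm_exp_mul_I_le w, norm_exp_neg_mul_I_le w]

theorem norm_sin_le_exp (w : ℂ) : ‖Complex.sin w‖ ≤ Real.exp |w.im| := by
  rw [Complex.sin, norm_div, Complex.norm_ofNat, norm_mul, Complex.norm_I, mul_one,
    div_le_iff₀ two_pos]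
  linarith [norm_sub_le (Complex.exp (-w * Complex.I)) (Complex.exp (w * Complex.I)),
    norm_exp_mul_I_le w, norm_exp_neg_mul_I_le w]

theorem abs_im_mul_ofReal (k : ℂ) {x : ℝ} (hx : 0 ≤ x) : |(k * x).im| = |k.im| * x := by
  rw [Complex.mul_im, Complex.ofReal_im, mul_zero, zero_add, Complex.ofReal_re, abs_mul,
    abs_of_nonneg hx]

/-- The growth `e^{b(x-s)}` of the kernel and `e^{bs}` of the solution multiply to `e^{bx}`,
independent of `s`, so only `∫ |q|` remains. -/
theorem norm_integral_potential_le {q : ℝ → ℝ} {ℓ x b B : ℝ}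
    (hq : IntervalIntegrable q volume 0 ℓ) (hx : x ∈ Set.Icc 0 ℓ) (hB : 0 ≤ B) {T v : ℝ → ℂ}
    (hT : ∀ s ∈ Set.Icc 0 x, ‖T s‖ ≤ Real.exp (b * (x - s)))
    (hv : ∀ s ∈ Set.Icc 0 x, ‖v s‖ ≤ B * Real.exp (b * s)) :
    ‖∫ s in (0 : ℝ)..x, (q s : ℂ) * (T s * v s)‖
      ≤ (∫ s in (0 : ℝ)..ℓ, |q s|) * (B * Real.exp (b * x)) := by
  rw [← intervalIntegral.integral_mul_const]
  calc ‖∫ s in (0 : ℝ)..x, (q s : ℂ) * (T s * v s)‖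
      ≤ ∫ s in (0 : ℝ)..x, |q s| * (B * Real.exp (b * x)) := by
        refine intervalIntegral.norm_integral_le_of_norm_le hx.1 (Eventually.of_forall
          fun s hs => ?_) ((intervalIntegrable_mono_right hq hx).abs.mul_const _)
        have hs' : s ∈ Set.Icc 0 x := ⟨hs.1.le, hs.2⟩
        rw [norm_mul, norm_mul, Complex.norm_real, Real.norm_eq_abs]
        refine mul_le_mul_of_nonneg_left ?_ (abs_nonneg _)
        refine (mul_le_mul (hT s hs') (hv s hs') (norm_nonneg _) (Real.exp_pos _).le).trans_eq ?_
        rw [mul_left_comm, ← Real.exp_add]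
        ring_nf
    _ ≤ ∫ s in (0 : ℝ)..ℓ, |q s| * (B * Real.exp (b * x)) :=
        intervalIntegral.integral_mono_interval le_rfl hx.1 hx.2
          (Eventually.of_forall fun s => by positivity) (hq.abs.mul_const _)

namespace IsFundamentalSolution

variable {q : ℝ → ℝ} {h H ℓ : ℝ} {y y' : ℝ → ℂ → ℂ}

theorem hasDerivAt_sin_sub (k : ℂ) (x s : ℝ) :
    HasDerivAt (fun s : ℝ => Complex.sin (k * (x - s : ℝ))) (-k * Complex.cos (k * (x - s : ℝ))) s := by
  have h1 : HasDerivAt (fun s : ℝ => k * ((x - s : ℝ) : ℂ)) (k * ((-1 : ℝ) : ℂ)) s :=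
    (((hasDerivAt_id s).const_sub x).ofReal_comp).const_mul k
  refine ((Complex.hasDerivAt_sin _).comp s h1).congr_deriv ?_
  push_cast; ring

theorem hasDerivAt_cos_sub (k : ℂ) (x s : ℝ) :
    HasDerivAt (fun s : ℝ => Complex.cos (k * (x - s : ℝ))) (k * Complex.sin (k * (x - s : ℝ))) s := by
  have h1 : HasDerivAt (fun s : ℝ => k * ((x - s : ℝ) : ℂ)) (k * ((-1 : ℝ) : ℂ)) s :=
    (((hasDerivAt_id s).const_sub x).ofReal_comp).const_mul k
  refine ((Complex.hasDerivAt_cos _).comp s h1).congr_deriv ?_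
  push_cast; ring

/-- Lagrange's identity on `[0, x]` against `sin(k(x - s))`, a solution of the free equation
vanishing at `s = x`. Writing `z = k²` avoids a choice of root, and the factor `k` a division at `k
= 0`. -/
theorem variation_of_constants (hy : IsFundamentalSolution q h ℓ y y')
    (hq : IntervalIntegrable q volume 0 ℓ) (k : ℂ) {x : ℝ} (hx : x ∈ Set.Icc 0 ℓ) :
    k * y x (k ^ 2) = k * Complex.cos (k * x) + h * Complex.sin (k * x)
      + ∫ s in (0 : ℝ)..x, (q s : ℂ) * (Complex.sin (k * (x - s : ℝ)) * y s (k ^ 2)) := by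
  have hℓ := hx.1.trans hx.2
  have := lagrange_identity hx.1 ((hy.isPrimitive hℓ (k ^ 2)).mono hx)
    ((hy.isPrimitive_deriv hℓ hq (k ^ 2)).mono hx)
    (IsPrimitive.of_hasDerivAt (hasDerivAt_sin_sub k x) (by fun_prop))
    (IsPrimitive.of_hasDerivAt (fun s => (hasDerivAt_cos_sub k x s).const_mul (-k)) (by fun_prop))
  simp only [hy.apply_zero hℓ, hy.deriv_apply_zero hℓ, sub_self, Complex.ofReal_zero, mul_zero,
    Complex.sin_zero, Complex.cos_zero, sub_zero] at this
  have e : ∀ s : ℝ, (q s : ℂ) * (Complex.sin (k * (x - s : ℝ)) * y s (k ^ 2))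
      = ((q s : ℂ) - k ^ 2) * y s (k ^ 2) * Complex.sin (k * (x - s : ℝ))
        - y s (k ^ 2) * (-k * (k * Complex.sin (k * (x - s : ℝ)))) := fun s => by ring
  simp only [e, this]
  ring

theorem variation_of_constants_deriv (hy : IsFundamentalSolution q h ℓ y y')
    (hq : IntervalIntegrable q volume 0 ℓ) (k : ℂ) {x : ℝ} (hx : x ∈ Set.Icc 0 ℓ) :
    y' x (k ^ 2) = -k * Complex.sin (k * x) + h * Complex.cos (k * x)
      + ∫ s in (0 : ℝ)..x, (q s : ℂ) * (Complex.cos (k * (x - s : ℝ)) * y s (k ^ 2)) := by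
  have hℓ := hx.1.trans hx.2
  have := lagrange_identity hx.1 ((hy.isPrimitive hℓ (k ^ 2)).mono hx)
    ((hy.isPrimitive_deriv hℓ hq (k ^ 2)).mono hx)
    (IsPrimitive.of_hasDerivAt (hasDerivAt_cos_sub k x) (by fun_prop))
    (IsPrimitive.of_hasDerivAt (fun s => (hasDerivAt_sin_sub k x s).const_mul k) (by fun_prop))
  simp only [hy.apply_zero hℓ, hy.deriv_apply_zero hℓ, sub_self, Complex.ofReal_zero, mul_zero,
    Complex.sin_zero, Complex.cos_zero, sub_zero] at this
  have e : ∀ s : ℝ, (q s : ℂ) * (Complex.cos (k * (x - s : ℝ)) * y s (k ^ 2))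
      = ((q s : ℂ) - k ^ 2) * y s (k ^ 2) * Complex.cos (k * (x - s : ℝ))
        - y s (k ^ 2) * (k * (-k * Complex.cos (k * (x - s : ℝ)))) := fun s => by ring
  simp only [e, this]
  ring

/-- Evaluate the integral equation where `|y(s)| e^{-|Im k| s}` attains its maximum `M`. It gives
`|k| M ≤ |k| + |h| + (∫ |q|) M`, and the last term is at most `|k| M / 2`. -/
theorem norm_apply_le (hy : IsFundamentalSolution q h ℓ y y')
    (hq : IntervalIntegrable q volume 0 ℓ) {k : ℂ} (hk : 1 ≤ ‖k‖)
    (hk' : 2 * ∫ s in (0 : ℝ)..ℓ, |q s| ≤ ‖k‖) {x : ℝ} (hx : x ∈ Set.Icc 0 ℓ) :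
    ‖y x (k ^ 2)‖ ≤ 2 * (1 + |h|) * Real.exp (|k.im| * x) := by
  have hℓ := hx.1.trans hx.2
  obtain ⟨x₀, hx₀, hmax⟩ := isCompact_Icc.exists_isMaxOn ⟨x, hx⟩
    ((hy.continuousOn (k ^ 2)).norm.mul
      (by fun_prop : ContinuousOn (fun s => Real.exp (-(|k.im| * s))) (Set.Icc 0 ℓ)))
  set M := ‖y x₀ (k ^ 2)‖ * Real.exp (-(|k.im| * x₀)) with hM
  have hM0 : 0 ≤ M := by positivity
  have hbd : ∀ s ∈ Set.Icc 0 ℓ, ‖y s (k ^ 2)‖ ≤ M * Real.exp (|k.im| * s) := fun s hs => by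
    have h1 : ‖y s (k ^ 2)‖ * Real.exp (-(|k.im| * s)) ≤ M := hmax hs
    rwa [Real.exp_neg, ← div_eq_mul_inv, div_le_iff₀ (Real.exp_pos _)] at h1
  have hint := norm_integral_potential_le (T := fun s => Complex.sin (k * (x₀ - s : ℝ)))
    (v := fun s => y s (k ^ 2)) (b := |k.im|) hq hx₀ hM0
    (fun s hs => (norm_sin_le_exp _).trans_eq (by rw [abs_im_mul_ofReal _ (by linarith [hs.2])]))
    (fun s hs => hbd s ⟨hs.1, hs.2.trans hx₀.2⟩)
  have hv := hy.variation_of_constants hq k hx₀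
  set E := Real.exp (|k.im| * x₀) with hE
  have hE0 : 0 < E := Real.exp_pos _
  have hME : M * E = ‖y x₀ (k ^ 2)‖ := by
    rw [hM, mul_assoc, ← Real.exp_add, neg_add_cancel, Real.exp_zero, mul_one]
  have hc : ‖Complex.cos (k * x₀)‖ ≤ E := by
    have := norm_cos_le_exp (k * x₀); rwa [abs_im_mul_ofReal _ hx₀.1] at this
  have hs : ‖Complex.sin (k * x₀)‖ ≤ E := by
    have := norm_sin_le_exp (k * x₀); rwa [abs_im_mul_ofReal _ hx₀.1] at this
  have h1 : ‖k‖ * (M * E) ≤ ‖k‖ * E + |h| * E + (∫ s in (0 : ℝ)..ℓ, |q s|) * (M * E) := by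
    rw [hME, ← norm_mul, hv, ← hME]
    refine (norm_add_le _ _).trans (add_le_add ((norm_add_le _ _).trans (add_le_add ?_ ?_)) hint)
    · rw [norm_mul]; gcongr
    · rw [norm_mul, Complex.norm_real, Real.norm_eq_abs]; gcongr
  have h2 : ‖k‖ * M ≤ ‖k‖ + |h| + (∫ s in (0 : ℝ)..ℓ, |q s|) * M := by
    refine le_of_mul_le_mul_right ?_ hE0
    linarith
  have h3 : ‖k‖ * M ≤ ‖k‖ * (2 * (1 + |h|)) := by
    have h4 := mul_le_mul_of_nonneg_right hk' hM0
    have h5 := mul_le_mul_of_nonneg_right hk (abs_nonneg h)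
    nlinarith
  exact (hbd x hx).trans (mul_le_mul_of_nonneg_right
    (le_of_mul_le_mul_left h3 (by linarith)) (Real.exp_pos _).le)

/-- Asymptotics of the fundamental solution for large `k = √z`. -/
theorem exists_asymptotics (hy : IsFundamentalSolution q h ℓ y y')
    (hq : IntervalIntegrable q volume 0 ℓ) :
    ∃ C K : ℝ, 0 < C ∧ 1 ≤ K ∧ ∀ k : ℂ, K ≤ ‖k‖ → ∀ x ∈ Set.Icc 0 ℓ,
      ‖y x (k ^ 2)‖ ≤ C * Real.exp (|k.im| * x) ∧
      ‖y x (k ^ 2) - Complex.cos (k * x)‖ ≤ C * Real.exp (|k.im| * x) / ‖k‖ ∧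
      ‖y' x (k ^ 2) + k * Complex.sin (k * x)‖ ≤ C * Real.exp (|k.im| * x) := by
  set Q := ∫ s in (0 : ℝ)..ℓ, |q s| with hQ
  set B := 2 * (1 + |h|) with hB
  have hB0 : 0 < B := by positivity
  refine ⟨B + |h| + |Q| * B, max 1 (2 * Q), by positivity, le_max_left _ _, fun k hk x hx => ?_⟩
  have hk1 : 1 ≤ ‖k‖ := (le_max_left _ _).trans hk
  have hk2 : 2 * Q ≤ ‖k‖ := (le_max_right _ _).trans hk
  have hkp : 0 < ‖k‖ := by linarith
  have hbd : ∀ s ∈ Set.Icc 0 ℓ, ‖y s (k ^ 2)‖ ≤ B * Real.exp (|k.im| * s) :=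
    fun s hs => hy.norm_apply_le hq hk1 hk2 hs
  have hsin := norm_integral_potential_le (T := fun s => Complex.sin (k * (x - s : ℝ)))
    (v := fun s => y s (k ^ 2)) (b := |k.im|) hq hx hB0.le
    (fun s hs => (norm_sin_le_exp _).trans_eq (by rw [abs_im_mul_ofReal _ (by linarith [hs.2])]))
    (fun s hs => hbd s ⟨hs.1, hs.2.trans hx.2⟩)
  have hcos := norm_integral_potential_le (T := fun s => Complex.cos (k * (x - s : ℝ)))
    (v := fun s => y s (k ^ 2)) (b := |k.im|) hq hx hB0.le
    (fun s hs => (norm_cos_le_exp _).trans_eq (by rw [abs_im_mul_ofReal _ (by linarith [hs.2])]))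
    (fun s hs => hbd s ⟨hs.1, hs.2.trans hx.2⟩)
  have hv := hy.variation_of_constants hq k hx
  have hv' := hy.variation_of_constants_deriv hq k hx
  set E := Real.exp (|k.im| * x) with hE
  have hE0 : 0 < E := Real.exp_pos _
  have hc : ‖Complex.cos (k * x)‖ ≤ E := by
    have := norm_cos_le_exp (k * x); rwa [abs_im_mul_ofReal _ hx.1] at this
  have hs : ‖Complex.sin (k * x)‖ ≤ E := by
    have := norm_sin_le_exp (k * x); rwa [abs_im_mul_ofReal _ hx.1] at this
  have hQE : Q * (B * E) ≤ |Q| * (B * E) :=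
    mul_le_mul_of_nonneg_right (le_abs_self Q) (by positivity)
  have hBE : 0 ≤ B * E := by positivity
  have hhE : |h| * ‖Complex.sin (k * x)‖ ≤ |h| * E := by gcongr
  have hhE' : |h| * ‖Complex.cos (k * x)‖ ≤ |h| * E := by gcongr
  refine ⟨(hbd x hx).trans ?_, ?_, ?_⟩
  · have : 0 ≤ (|h| + |Q| * B) * E := by positivity
    linarith
  · rw [le_div_iff₀ hkp, mul_comm, ← norm_mul, mul_sub, hv, add_assoc, add_sub_cancel_left]
    refine (norm_add_le _ _).trans ?_
    rw [norm_mul, Complex.norm_real, Real.norm_eq_abs]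
    linarith
  · rw [hv', show ∀ a b c : ℂ, -k * a + b + c + k * a = b + c from fun a b c => by ring]
    refine (norm_add_le _ _).trans ?_
    rw [norm_mul, Complex.norm_real, Real.norm_eq_abs]
    linarith

theorem exists_charFun_asymptotics (hy : IsFundamentalSolution q h ℓ y y') (hℓ : 0 ≤ ℓ)
    (hq : IntervalIntegrable q volume 0 ℓ) (H : ℝ) :
    ∃ C K : ℝ, 0 < C ∧ 1 ≤ K ∧ ∀ k : ℂ, K ≤ ‖k‖ →
      ‖charFun ℓ H y y' (k ^ 2) + k * Complex.sin (k * ℓ)‖ ≤ C * Real.exp (|k.im| * ℓ) := by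
  obtain ⟨C, K, hC, hK, hb⟩ := hy.exists_asymptotics hq
  refine ⟨C + |H| * C, K, by positivity, hK, fun k hk => ?_⟩
  obtain ⟨h1, -, h3⟩ := hb k hk ℓ ⟨hℓ, le_rfl⟩
  rw [charFun, add_right_comm]
  refine (norm_add_le _ _).trans ?_
  rw [norm_mul, Complex.norm_real, Real.norm_eq_abs]
  have := mul_le_mul_of_nonneg_left h1 (abs_nonneg H)
  linarith

end IsFundamentalSolution

/-! ### Entire functions: quotients, vanishing criteria, counting of zeros. -/

/-- Division of entire functions by an entire function with simple zeros. -/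
theorem exists_entire_quotient {f g : ℂ → ℂ} (hf : Differentiable ℂ f) (hg : Differentiable ℂ g)
    (hfg : ∀ z, g z = 0 → f z = 0) (hg' : ∀ z, g z = 0 → deriv g z ≠ 0) :
    ∃ Q : ℂ → ℂ, Differentiable ℂ Q ∧ ∀ z, f z = g z * Q z := by
  -- At a simple zero of `g` the quotient is given its limit; near that zero it coincides with the
  -- quotient of the two `dslope`s, which is differentiable there.
  refine ⟨fun z => if g z = 0 then deriv f z / deriv g z else f z / g z, fun z₀ => ?_, fun z => ?_⟩
  · by_cases h0 : g z₀ = 0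
    · have hdf : DifferentiableAt ℂ (dslope f z₀) z₀ :=
        ((Complex.differentiableOn_dslope univ_mem).2 hf.differentiableOn).differentiableAt univ_mem
      have hdg : DifferentiableAt ℂ (dslope g z₀) z₀ :=
        ((Complex.differentiableOn_dslope univ_mem).2 hg.differentiableOn).differentiableAt univ_mem
      have hne : dslope g z₀ z₀ ≠ 0 := by rw [dslope_same]; exact hg' z₀ h0
      refine (hdf.div hdg hne).congr_of_eventuallyEq ?_
      have hev : ∀ᶠ z in 𝓝[≠] z₀, g z ≠ 0 := by
        have := (hg z₀).hasDerivAt.eventually_ne (c := 0) (hg' z₀ h0)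
        exact this
      rw [eventually_nhdsWithin_iff] at hev
      filter_upwards [hev] with z hz
      simp only [Pi.div_apply]
      by_cases hzz : z = z₀
      · subst hzz; simp [h0, dslope_same]
      · have hz' := hz hzz
        have hsub : z - z₀ ≠ 0 := sub_ne_zero.2 hzz
        rw [if_neg hz', dslope_of_ne _ hzz, dslope_of_ne _ hzz, slope_def_field, slope_def_field,
          h0, hfg z₀ h0]
        field_simp
        ring
    · refine ((hf z₀).div (hg z₀) h0).congr_of_eventuallyEq ?_
      filter_upwards [(hg z₀).continuousAt.eventually_ne h0] with z hz
      simp [hz]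
  · simp only []
    split_ifs with h0
    · rw [h0, hfg z h0, zero_mul]
    · field_simp

/-- An entire function that tends to zero along a sequence of growing circles vanishes. -/
theorem eq_zero_of_norm_le_on_spheres {f : ℂ → ℂ} (hf : Differentiable ℂ f) {R ε : ℕ → ℝ}
    (hR : Tendsto R atTop atTop) (hε : Tendsto ε atTop (𝓝 0))
    (h : ∀ᶠ n in atTop, ∀ z, ‖z‖ = R n → ‖f z‖ ≤ ε n) (z : ℂ) : f z = 0 := by
  rw [← norm_le_zero_iff]
  refine ge_of_tendsto hε ?_
  filter_upwards [h, hR.eventually_gt_atTop ‖z‖] with n hn hzn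
  have hRn : R n ≠ 0 := ((norm_nonneg z).trans_lt hzn).ne'
  refine Complex.norm_le_of_forall_mem_frontier_norm_le (Metric.isBounded_ball (x := 0) (r := R n))
    hf.diffContOnCl (fun w hw => hn w ?_) (subset_closure ?_)
  · rw [frontier_ball _ hRn] at hw; simpa using hw
  · simpa using hzn

/-- An entire function bounded by `C / |Im z|` vanishes. -/
theorem eq_zero_of_norm_mul_abs_im_le {f : ℂ → ℂ} (hf : Differentiable ℂ f) {C : ℝ}
    (h : ∀ z, |z.im| * ‖f z‖ ≤ C) (z : ℂ) : f z = 0 := by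
  have key : ∀ R : ℝ, ‖z‖ < R → ‖f z‖ ≤ 2 * R * C / (R ^ 2 - ‖z‖ ^ 2) := fun R hzR => by
    have hR : 0 < R := (norm_nonneg z).trans_lt hzR
    -- On `|w| = R` one has `w² - R² = w (w - w̄)`, of modulus `2R |Im w|`, so this factor
    -- compensates the singular bound near the real axis and the maximum principle applies.
    have hb : ‖(z ^ 2 - (R : ℂ) ^ 2) * f z‖ ≤ 2 * R * C := by
      refine Complex.norm_le_of_forall_mem_frontier_norm_le (f := fun z => (z ^ 2 - (R : ℂ) ^ 2) * f z)
        (Metric.isBounded_ball (x := 0) (r := R))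
        (Differentiable.diffContOnCl (by fun_prop)) (fun w hw => ?_) (subset_closure (by simpa))
      rw [frontier_ball _ hR.ne'] at hw
      have hw' : ‖w‖ = R := by simpa using hw
      have e : w ^ 2 - (R : ℂ) ^ 2 = w * (w - starRingEnd ℂ w) := by
        rw [mul_sub, Complex.mul_conj, Complex.normSq_eq_norm_sq, hw']; push_cast; ring
      rw [e, Complex.sub_conj, norm_mul, norm_mul, norm_mul, hw', Complex.norm_I, mul_one,
        Complex.norm_real, Real.norm_eq_abs, abs_mul, abs_two]
      have := mul_le_mul_of_nonneg_left (h w) (by linarith : (0 : ℝ) ≤ 2 * R)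
      linarith
    have hlow : R ^ 2 - ‖z‖ ^ 2 ≤ ‖z ^ 2 - (R : ℂ) ^ 2‖ := by
      have := norm_sub_norm_le ((R : ℂ) ^ 2) (z ^ 2)
      rw [norm_sub_rev, norm_pow, norm_pow, Complex.norm_real, Real.norm_eq_abs, abs_of_pos hR] at this
      exact this
    have hpos : 0 < R ^ 2 - ‖z‖ ^ 2 := by nlinarith [norm_nonneg z]
    rw [le_div_iff₀ hpos, mul_comm]
    rw [norm_mul] at hb
    exact (mul_le_mul_of_nonneg_right hlow (norm_nonneg _)).trans hb
  rw [← norm_le_zero_iff]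
  have ht : Tendsto (fun R : ℝ => 2 * R * C / (R ^ 2 - ‖z‖ ^ 2)) atTop (𝓝 0) := by
    have h1 : Tendsto (fun R : ℝ => R - ‖z‖ ^ 2 / R) atTop atTop :=
      (tendsto_id.atTop_add ((tendsto_const_nhds (x := -‖z‖ ^ 2)).div_atTop tendsto_id)).congr
        fun R => by simp [neg_div, sub_eq_add_neg]
    refine ((tendsto_const_nhds (x := 2 * C)).div_atTop h1).congr' ?_
    filter_upwards [eventually_gt_atTop 0] with R hR
    have : R - ‖z‖ ^ 2 / R = (R ^ 2 - ‖z‖ ^ 2) / R := by field_simp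
    rw [this, div_div_eq_mul_div]; ring
  refine ge_of_tendsto ht ?_
  filter_upwards [eventually_gt_atTop ‖z‖] with R hR using key R hR

theorem finite_zeros_of_deriv_ne_zero {f : ℂ → ℂ} (hf : Differentiable ℂ f)
    (hf' : ∀ z, f z = 0 → deriv f z ≠ 0) {K : Set ℂ} (hK : IsCompact K) :
    {z | z ∈ K ∧ f z = 0}.Finite := by
  have hc : IsCompact {z | z ∈ K ∧ f z = 0} :=
    hK.inter_right (isClosed_singleton.preimage hf.continuous)
  by_contra hinf
  obtain ⟨z, hz, hacc⟩ := Set.Infinite.exists_accPt_of_subset_isCompact hinf hc subset_rfl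
  have hne : ∀ᶠ w in 𝓝[≠] z, f w ≠ 0 := (hf z).hasDerivAt.eventually_ne (c := 0) (hf' z hz.2)
  rw [accPt_iff_frequently_nhdsNE] at hacc
  obtain ⟨w, hw, hw'⟩ := (hacc.and_eventually hne).exists
  exact hw' hw.2

theorem differentiable_prod_sub (A : Finset ℂ) :
    Differentiable ℂ (fun z => ∏ a ∈ A, (z - a)) := by fun_prop

theorem prod_sub_eq_zero_iff (A : Finset ℂ) (z : ℂ) : ∏ a ∈ A, (z - a) = 0 ↔ z ∈ A := by
  simp only [Finset.prod_eq_zero_iff, sub_eq_zero]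
  exact ⟨fun ⟨a, ha, h⟩ => h ▸ ha, fun h => ⟨z, h, rfl⟩⟩

theorem deriv_prod_sub_ne_zero (A : Finset ℂ) {z : ℂ} (hz : z ∈ A) :
    deriv (fun z => ∏ a ∈ A, (z - a)) z ≠ 0 := by
  classical
  have e : (fun z => ∏ a ∈ A, (z - a)) = fun w => (w - z) * ∏ a ∈ A.erase z, (w - a) := by
    ext w; exact (Finset.mul_prod_erase A (fun a => w - a) hz).symm
  have hd := ((hasDerivAt_id z).sub_const z).mul
    (differentiable_prod_sub (A.erase z) z).hasDerivAt
  have hd' : HasDerivAt (fun z => ∏ a ∈ A, (z - a)) (∏ a ∈ A.erase z, (z - a)) z := by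
    rw [e]
    exact hd.congr_deriv (by simp)
  rw [hd'.deriv]
  exact fun h => Finset.notMem_erase z A ((prod_sub_eq_zero_iff _ z).1 h)

/-- Simple zeros of an entire function can be divided out. -/
theorem exists_eq_prod_sub_mul {f : ℂ → ℂ} (hf : Differentiable ℂ f)
    (hf' : ∀ z, f z = 0 → deriv f z ≠ 0) (A : Finset ℂ) (hA : ∀ a ∈ A, f a = 0) :
    ∃ F : ℂ → ℂ, Differentiable ℂ F ∧ (∀ z, f z = (∏ a ∈ A, (z - a)) * F z) ∧
      ∀ a ∈ A, F a ≠ 0 := by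
  obtain ⟨F, hF, hfF⟩ := exists_entire_quotient hf (differentiable_prod_sub A)
    (fun z hz => hA z ((prod_sub_eq_zero_iff A z).1 hz))
    (fun z hz => deriv_prod_sub_ne_zero A ((prod_sub_eq_zero_iff A z).1 hz))
  refine ⟨F, hF, hfF, fun a ha h0 => hf' a (hA a ha) ?_⟩
  have hd := (differentiable_prod_sub A a).hasDerivAt.mul (hF a).hasDerivAt
  rw [show f = fun z => (∏ a ∈ A, (z - a)) * F z from funext hfF]
  refine hd.deriv.trans ?_
  rw [h0, (prod_sub_eq_zero_iff A a).2 ha, mul_zero, zero_mul, add_zero]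

theorem deriv_div_eq_sum_add {f F : ℂ → ℂ} {A : Finset ℂ} (hF : Differentiable ℂ F)
    (hfF : ∀ z, f z = (∏ a ∈ A, (z - a)) * F z) {z : ℂ} (hz : z ∉ A) (hz' : F z ≠ 0) :
    deriv f z / f z = (∑ a ∈ A, (z - a)⁻¹) + deriv F z / F z := by
  have h1 := logDeriv_mul z (mt (prod_sub_eq_zero_iff A z).1 hz) hz'
    (differentiable_prod_sub A z) (hF z)
  have h2 := logDeriv_prod (s := A) (f := fun a z => z - a) (x := z)
    (fun a ha => sub_ne_zero.2 fun h => hz (h ▸ ha)) (fun a _ => by fun_prop)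
  rw [h2] at h1
  rw [show f = fun z => (∏ a ∈ A, (z - a)) * F z from funext hfF]
  refine Eq.trans h1 ?_
  congr 1
  refine Finset.sum_congr rfl fun a _ => ?_
  rw [logDeriv_apply, deriv_sub_const, deriv_id'', one_div]

theorem differentiableOn_deriv_div {f : ℂ → ℂ} (hf : Differentiable ℂ f) {s : Set ℂ}
    (hs : ∀ z ∈ s, f z ≠ 0) : DifferentiableOn ℂ (fun z => deriv f z / f z) s := fun z hz =>
  ((hf.analyticAt z).deriv.differentiableAt.div (hf z) (hs z hz)).differentiableWithinAt

theorem circleIntegrable_deriv_div {f : ℂ → ℂ} (hf : Differentiable ℂ f) {R : ℝ} (hR : 0 < R)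
    (hs : ∀ z, ‖z‖ = R → f z ≠ 0) : CircleIntegrable (fun z => deriv f z / f z) 0 R :=
  (differentiableOn_deriv_div hf fun z hz => hs z (by simpa using hz)).continuousOn.circleIntegrable
    hR.le

/-- The argument principle for an entire function with simple zeros. -/
theorem circleIntegral_deriv_div {f : ℂ → ℂ} (hf : Differentiable ℂ f)
    (hf' : ∀ z, f z = 0 → deriv f z ≠ 0) {R : ℝ} (hR : 0 < R) (hs : ∀ z, ‖z‖ = R → f z ≠ 0) :
    (∮ z in C(0, R), deriv f z / f z)
      = 2 * Real.pi * Complex.I * ({z | ‖z‖ < R ∧ f z = 0}.ncard : ℂ) := by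
  classical
  have hfin : {z | ‖z‖ < R ∧ f z = 0}.Finite :=
    (finite_zeros_of_deriv_ne_zero hf hf' (isCompact_closedBall (0 : ℂ) R)).subset
      fun z hz => ⟨by simpa using hz.1.le, hz.2⟩
  rw [Set.ncard_eq_toFinset_card _ hfin]
  have hmem : ∀ z, z ∈ hfin.toFinset ↔ ‖z‖ < R ∧ f z = 0 := fun z => by simp
  obtain ⟨A, hA⟩ : ∃ A, A = hfin.toFinset := ⟨_, rfl⟩
  rw [← hA] at hmem ⊢
  -- After the zeros are divided out, `F` has none in the closed disc: its logarithmic derivative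
  -- integrates to 0, and each zero contributes a simple pole of residue 1.
  obtain ⟨F, hF, hfF, hFA⟩ := exists_eq_prod_sub_mul hf hf' A fun a ha => ((hmem a).1 ha).2
  have hF0 : ∀ z ∈ Metric.closedBall (0 : ℂ) R, F z ≠ 0 := fun z hz h0 => by
    have hz' : ‖z‖ ≤ R := by simpa using hz
    have hfz : f z = 0 := by rw [hfF, h0, mul_zero]
    exact hFA z ((hmem z).2 ⟨lt_of_le_of_ne hz' fun h => hs z h hfz, hfz⟩) h0
  have hG := differentiableOn_deriv_div hF hF0
  have hGint := circleIntegrable_deriv_div hF hR fun z hz => hF0 z (by simpa using hz.le)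
  have hAint : ∀ a ∈ A, CircleIntegrable (fun z => (z - a)⁻¹) 0 R := fun a ha => by
    rw [circleIntegrable_sub_inv_iff]
    right
    rw [mem_sphere_zero_iff_norm, abs_of_pos hR]
    exact ((hmem a).1 ha).1.ne
  have heq : Set.EqOn (fun z => deriv f z / f z)
      (fun z => (∑ a ∈ A, (z - a)⁻¹) + deriv F z / F z) (Metric.sphere 0 R) := fun z hz => by
    have hz' : ‖z‖ = R := by simpa using hz
    exact deriv_div_eq_sum_add hF hfF (fun h => hs z hz' ((hmem z).1 h).2)
      (hF0 z (by simpa using hz'.le))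
  have hsum : CircleIntegrable (fun z => ∑ a ∈ A, (z - a)⁻¹) 0 R :=
    CircleIntegrable.fun_sum A hAint
  rw [circleIntegral.integral_congr hR.le heq, circleIntegral.integral_add hsum hGint,
    circleIntegral.integral_fun_sum hAint,
    Complex.circleIntegral_eq_zero_of_differentiable_on_off_countable hR.le Set.countable_empty
      hG.continuousOn (fun z hz => hG.differentiableAt (Metric.closedBall_mem_nhds_of_mem hz.1)),
    add_zero, Finset.sum_congr rfl fun a ha => circleIntegral.integral_sub_inv_of_mem_ball
      (show a ∈ Metric.ball 0 R by simpa using ((hmem a).1 ha).1),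
    Finset.sum_const, nsmul_eq_mul, mul_comm]

/-- Rouché's theorem for entire functions with simple zeros. -/
theorem ncard_zeros_eq_of_norm_sub_lt {f g : ℂ → ℂ} (hf : Differentiable ℂ f)
    (hf' : ∀ z, f z = 0 → deriv f z ≠ 0) (hg : Differentiable ℂ g)
    (hg' : ∀ z, g z = 0 → deriv g z ≠ 0) {R : ℝ} (hR : 0 < R)
    (h : ∀ z, ‖z‖ = R → ‖f z - g z‖ < ‖g z‖) :
    {z | ‖z‖ < R ∧ f z = 0}.ncard = {z | ‖z‖ < R ∧ g z = 0}.ncard := by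
  have hg0 : ∀ z, ‖z‖ = R → g z ≠ 0 := fun z hz => norm_pos_iff.1 ((norm_nonneg _).trans_lt (h z hz))
  have hf0 : ∀ z, ‖z‖ = R → f z ≠ 0 := fun z hz h0 => by
    have := h z hz; simp [h0] at this
  have ef := circleIntegral_deriv_div hf hf' hR hf0
  have eg := circleIntegral_deriv_div hg hg' hR hg0
  -- On the circle `f / g` stays in the unit disc about 1, so the principal logarithm of `f / g` is
  -- a primitive of the integrand.
  have hz : (∮ z in C(0, R), (deriv f z / f z - deriv g z / g z)) = 0 := by
    refine circleIntegral.integral_eq_zero_of_hasDerivWithinAt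
      (f := fun z => Complex.log (f z / g z)) hR.le fun z hz => ?_
    have hz' : ‖z‖ = R := by simpa using hz
    have hgz := hg0 z hz'
    have hfz := hf0 z hz'
    have hd := (hf z).hasDerivAt.div (hg z).hasDerivAt hgz
    have hslit : f z / g z ∈ Complex.slitPlane := by
      have : f z / g z = 1 + (f z - g z) / g z := by field_simp; ring
      rw [this]
      refine Complex.mem_slitPlane_of_norm_lt_one ?_
      rw [norm_div, div_lt_one (norm_pos_iff.2 hgz)]
      exact h z hz'
    refine ((hd.clog hslit).congr_deriv ?_).hasDerivWithinAt
    simp only [Pi.div_apply]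
    field_simp
  rw [circleIntegral.integral_sub (circleIntegrable_deriv_div hf hR hf0)
    (circleIntegrable_deriv_div hg hR hg0), ef, eg, sub_eq_zero] at hz
  have h2 : (2 * Real.pi * Complex.I : ℂ) ≠ 0 := by
    simp [Real.pi_ne_zero]
  exact_mod_cast mul_left_cancel₀ h2 hz

/-! ### Lower bounds for the sine and the free problem. -/

theorem norm_sin_sq (w : ℂ) :
    ‖Complex.sin w‖ ^ 2 = Real.sin w.re ^ 2 + Real.sinh w.im ^ 2 := by
  rw [← Complex.normSq_eq_norm_sq, Complex.normSq_apply, Complex.sin_eq]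
  simp only [← Complex.ofReal_sin, ← Complex.ofReal_cos, ← Complex.ofReal_sinh,
    ← Complex.ofReal_cosh, Complex.add_re, Complex.add_im, Complex.mul_re, Complex.mul_im,
    Complex.ofReal_re, Complex.ofReal_im, Complex.I_re, Complex.I_im]
  have h1 := Real.cosh_sq w.im
  have h2 := Real.sin_sq_add_cos_sq w.re
  ring_nf
  rw [h1]
  linear_combination (Real.sinh w.im ^ 2) * h2

theorem exp_abs_im_le_norm_sin_of_le {w : ℂ} (hw : 1 / 2 ≤ |w.im|) :
    Real.exp |w.im| ≤ 4 * ‖Complex.sin w‖ := by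
  have h1 : |Real.sinh w.im| ≤ ‖Complex.sin w‖ :=
    abs_le_of_sq_le_sq (by nlinarith [sq_nonneg (Real.sin w.re), norm_sin_sq w]) (norm_nonneg _)
  rw [Real.abs_sinh, Real.sinh_eq] at h1
  have h3 : 2 * Real.exp (-|w.im|) ≤ Real.exp |w.im| := by
    have h4 : (2 : ℝ) ≤ Real.exp (|w.im| + |w.im|) :=
      (by linarith [Real.add_one_le_exp (1 : ℝ)] : (2 : ℝ) ≤ Real.exp 1).trans
        (Real.exp_le_exp.2 (by linarith))
    rw [Real.exp_add] at h4
    rw [Real.exp_neg, mul_inv_le_iff₀ (Real.exp_pos _)]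
    exact h4
  linarith

/-- On the circles `|w| = (N + 1/2) π` the sine has the size of `e^{|Im w|}`. -/
theorem exp_abs_im_le_norm_sin {w : ℂ} {N : ℕ} (hw : ‖w‖ = (N + 1 / 2) * Real.pi) :
    Real.exp |w.im| ≤ 4 * ‖Complex.sin w‖ := by
  set a := w.re with ha
  set b := w.im with hb
  have hsq := norm_sin_sq w
  have hnorm : a ^ 2 + b ^ 2 = ((N + 1 / 2) * Real.pi) ^ 2 := by
    rw [← hw, ← Complex.normSq_eq_norm_sq, Complex.normSq_apply]; ring
  rcases le_or_gt (1 / 2) |b| with hb2 | hb2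
  · exact exp_abs_im_le_norm_sin_of_le hb2
  -- Near the real axis `|Re w|` is within 1/6 of `R`, where the cosine vanishes, hence `|sin (Re
  -- w)| ≥ 9/10`; this suffices because `e^{|Im w|} ≤ e < 36/10`.
  · have hpi := Real.pi_gt_three
    set R := ((N : ℝ) + 1 / 2) * Real.pi with hR
    have hR1 : 3 / 2 ≤ R := by
      have : (0 : ℝ) ≤ N := N.cast_nonneg
      rw [hR]; nlinarith
    have hbsq : b ^ 2 ≤ 1 / 4 := by
      rw [← sq_abs]; nlinarith [abs_nonneg b]
    have haR : |a| ≤ R := abs_le_of_sq_le_sq (by nlinarith) (by linarith)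
    have hdiff : R - |a| ≤ 1 / 6 := by
      have h1 : (R - |a|) * (R + |a|) = b ^ 2 := by rw [← sub_eq_zero]; ring_nf; rw [sq_abs]; linarith
      nlinarith [abs_nonneg a]
    have hsin : |Real.sin a| = |Real.cos (R - |a|)| := by
      have h1 : Real.cos (R - |a|) = Real.sin R * Real.sin |a| := by
        rw [Real.cos_sub]
        have : Real.cos R = 0 := by
          rw [hR, Real.cos_eq_zero_iff]; exact ⟨N, by push_cast; ring⟩
        rw [this, zero_mul, zero_add]
      have h2 : |Real.sin R| = 1 := by
        rw [hR, add_mul, Real.sin_add]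
        rw [show (1 : ℝ) / 2 * Real.pi = Real.pi / 2 by ring, Real.cos_pi_div_two,
          Real.sin_pi_div_two, mul_zero, zero_add, mul_one, Real.cos_nat_mul_pi, abs_pow]
        simp
      rw [h1, abs_mul, h2, one_mul]
      rcases abs_cases a with ⟨h, -⟩ | ⟨h, -⟩
      · rw [h]
      · rw [h, Real.sin_neg, abs_neg]
    have hcos : 9 / 10 ≤ Real.cos (R - |a|) := by
      have := Real.one_sub_sq_div_two_le_cos (x := R - |a|)
      nlinarith
    have h1 : |Real.sin a| ≤ ‖Complex.sin w‖ :=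
      abs_le_of_sq_le_sq (by nlinarith [sq_nonneg (Real.sinh b)]) (norm_nonneg _)
    have h2 : 9 / 10 ≤ |Real.sin a| := by rw [hsin]; exact hcos.trans (le_abs_self _)
    have h3 : Real.exp |b| ≤ Real.exp 1 := Real.exp_le_exp.2 (by linarith)
    linarith [Real.exp_one_lt_d9]

theorem csqrt_sq (z : ℂ) : csqrt z ^ 2 = z := by
  rw [csqrt, one_div]; exact Complex.cpow_ofNat_inv_pow z 2

theorem csqrt_pow_two (k : ℂ) : csqrt (k ^ 2) = k ∨ csqrt (k ^ 2) = -k :=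
  sq_eq_sq_iff_eq_or_eq_neg.1 (csqrt_sq (k ^ 2))

/-- Makes the free problem an instance of the general theory, so that its characteristic function is
entire with simple zeros without separate work. -/
theorem isFundamentalSolution_zero (ℓ : ℝ) :
    IsFundamentalSolution (fun _ => 0) 0 ℓ (fun x z => Complex.cos (csqrt z * x))
      (fun x z => -csqrt z * Complex.sin (csqrt z * x)) := by
  have hlin : ∀ (k : ℂ) (x : ℝ), HasDerivAt (fun s : ℝ => k * (s : ℂ)) k x := fun k x => by
    simpa using (((hasDerivAt_id x).ofReal_comp).const_mul k)
  have hcos : ∀ (k : ℂ) (x : ℝ),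
      HasDerivAt (fun s : ℝ => Complex.cos (k * s)) (-k * Complex.sin (k * x)) x := fun k x =>
    ((Complex.hasDerivAt_cos _).comp x (hlin k x)).congr_deriv (by ring)
  have hsin : ∀ (k : ℂ) (x : ℝ),
      HasDerivAt (fun s : ℝ => Complex.sin (k * s)) (k * Complex.cos (k * x)) x := fun k x =>
    ((Complex.hasDerivAt_sin _).comp x (hlin k x)).congr_deriv (by ring)
  refine ⟨fun z => by fun_prop, fun z => by fun_prop, fun z x _ => ?_, fun z x _ => ?_⟩
  · rw [intervalIntegral.integral_eq_sub_of_hasDerivAt (fun s _ => hcos (csqrt z) s)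
      (Continuous.intervalIntegrable (by fun_prop) _ _)]
    simp
  · rw [intervalIntegral.integral_eq_sub_of_hasDerivAt
      (f := fun s => -csqrt z * Complex.sin (csqrt z * s))
      (fun s _ => ((hsin (csqrt z) s).const_mul (-csqrt z)).congr_deriv ?_)
      (Continuous.intervalIntegrable (by fun_prop) _ _)]
    · simp
    · push_cast
      linear_combination (-Complex.cos (csqrt z * s)) * csqrt_sq z

/-- The characteristic function `-√z sin (ℓ √z)` of the problem with `q = h = H = 0`. -/
def freeCharFun (ℓ : ℝ) : ℂ → ℂ :=
  charFun ℓ 0 (fun x z => Complex.cos (csqrt z * x)) (fun x z => -csqrt z * Complex.sin (csqrt z * x))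

theorem freeCharFun_sq (ℓ : ℝ) (k : ℂ) : freeCharFun ℓ (k ^ 2) = -(k * Complex.sin (k * ℓ)) := by
  rcases csqrt_pow_two k with h | h <;> simp [freeCharFun, charFun, h]

theorem freeCharFun_eq_zero_iff {ℓ : ℝ} (hℓ : 0 < ℓ) (z : ℂ) :
    freeCharFun ℓ z = 0 ↔ ∃ n : ℕ, z = (((n * Real.pi / ℓ) ^ 2 : ℝ) : ℂ) := by
  have hℓ' : (ℓ : ℂ) ≠ 0 := by exact_mod_cast hℓ.ne'
  obtain ⟨k, rfl⟩ : ∃ k, z = k ^ 2 := ⟨csqrt z, (csqrt_sq z).symm⟩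
  rw [freeCharFun_sq, neg_eq_zero, mul_eq_zero, Complex.sin_eq_zero_iff]
  constructor
  · rintro (rfl | ⟨n, hn⟩)
    · exact ⟨0, by simp⟩
    · refine ⟨n.natAbs, ?_⟩
      rw [← mul_left_inj' (pow_ne_zero 2 hℓ'), ← mul_pow, hn]
      have : ((n.natAbs : ℂ)) ^ 2 = (n : ℂ) ^ 2 := by
        rw [← Int.cast_natCast, ← Int.cast_pow, Int.natAbs_sq, Int.cast_pow]
      push_cast
      rw [div_pow, div_mul_cancel₀ _ (pow_ne_zero 2 hℓ'), mul_pow, mul_pow, this]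
  · rintro ⟨n, hn⟩
    right
    push_cast at hn
    rcases sq_eq_sq_iff_eq_or_eq_neg.1 hn with h | h
    · exact ⟨n, by rw [h]; push_cast; field_simp⟩
    · exact ⟨-n, by rw [h]; push_cast; field_simp⟩

/-- `(N + 1/2) π / ℓ`. -/
def radius (ℓ : ℝ) (N : ℕ) : ℝ := (N + 1 / 2) * Real.pi / ℓ

theorem radius_pos {ℓ : ℝ} (hℓ : 0 < ℓ) (N : ℕ) : 0 < radius ℓ N := by
  unfold radius; positivity

theorem tendsto_radius {ℓ : ℝ} (hℓ : 0 < ℓ) : Tendsto (radius ℓ) atTop atTop := by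
  unfold radius
  exact ((tendsto_natCast_atTop_atTop.atTop_add tendsto_const_nhds).atTop_mul_const
    Real.pi_pos).atTop_div_const hℓ

theorem tendsto_radius_sq {ℓ : ℝ} (hℓ : 0 < ℓ) :
    Tendsto (fun N => radius ℓ N ^ 2) atTop atTop :=
  (tendsto_pow_atTop two_ne_zero).comp (tendsto_radius hℓ)

theorem exp_le_norm_freeCharFun {ℓ : ℝ} (hℓ : 0 < ℓ) {N : ℕ} {k : ℂ} (hk : ‖k‖ = radius ℓ N) :
    radius ℓ N * Real.exp (|k.im| * ℓ) ≤ 4 * ‖freeCharFun ℓ (k ^ 2)‖ := by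
  rw [freeCharFun_sq, norm_neg, norm_mul, hk]
  have h1 : ‖k * ℓ‖ = (N + 1 / 2) * Real.pi := by
    rw [norm_mul, hk, Complex.norm_real, Real.norm_eq_abs, abs_of_pos hℓ, radius]
    field_simp
  have h2 := exp_abs_im_le_norm_sin h1
  rw [abs_im_mul_ofReal _ hℓ.le] at h2
  have := mul_le_mul_of_nonneg_left h2 (radius_pos hℓ N).le
  linarith

theorem ncard_zeros_freeCharFun {ℓ : ℝ} (hℓ : 0 < ℓ) (N : ℕ) :
    {z | ‖z‖ < radius ℓ N ^ 2 ∧ freeCharFun ℓ z = 0}.ncard = N + 1 := by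
  have hinj : Function.Injective (fun n : ℕ => (((n * Real.pi / ℓ) ^ 2 : ℝ) : ℂ)) := by
    intro m n hmn
    have h1 : (m * Real.pi / ℓ) ^ 2 = (n * Real.pi / ℓ) ^ 2 := Complex.ofReal_injective hmn
    have h2 := (sq_eq_sq₀ (by positivity) (by positivity)).1 h1
    have h3 := Real.pi_pos.ne'
    field_simp at h2
    exact_mod_cast h2
  have : {z | ‖z‖ < radius ℓ N ^ 2 ∧ freeCharFun ℓ z = 0}
      = (fun n : ℕ => (((n * Real.pi / ℓ) ^ 2 : ℝ) : ℂ)) '' Set.Iio (N + 1) := by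
    have key : ∀ n : ℕ, ‖(((n * Real.pi / ℓ) ^ 2 : ℝ) : ℂ)‖ < radius ℓ N ^ 2 ↔ n < N + 1 := fun n => by
      rw [Complex.norm_real, Real.norm_eq_abs, abs_of_nonneg (by positivity),
        sq_lt_sq₀ (by positivity) (radius_pos hℓ N).le, radius, div_lt_div_iff_of_pos_right hℓ,
        mul_lt_mul_iff_left₀ Real.pi_pos]
      constructor
      · intro h
        by_contra! hn
        have : ((N + 1 : ℕ) : ℝ) ≤ n := by exact_mod_cast hn
        push_cast at this
        linarith
      · intro h
        have : (n : ℝ) ≤ N := by exact_mod_cast Nat.lt_succ_iff.1 h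
        linarith
    ext z
    rw [Set.mem_ofPred_eq, freeCharFun_eq_zero_iff hℓ]
    constructor
    · rintro ⟨h1, n, rfl⟩
      exact ⟨n, (key n).1 h1, rfl⟩
    · rintro ⟨n, hn, rfl⟩
      exact ⟨(key n).2 hn, n, rfl⟩
  rw [this, Set.ncard_image_of_injective _ hinj, ← Finset.coe_Iio, Set.ncard_coe_finset,
    Nat.card_Iio]

/-! ### Enumeration of a locally finite set of zeros. -/

section Enumeration

variable {Φ : ℂ → ℂ}

/-- Ensures that the infima defining `eigenvalue` are attained, so that the default value of `sInf`
on empty or unbounded sets never enters. -/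
theorem sInf_mem_of_finite {T : Set ℝ} (hT : T.Nonempty) (hfin : ∀ b, (T ∩ Set.Iio b).Finite) :
    IsLeast T (sInf T) := by
  obtain ⟨b, hb⟩ := hT
  obtain ⟨m, hm, hmin⟩ := (hfin (b + 1)).exists_minimalFor id _ ⟨b, hb, by simp⟩
  have hle : IsLeast T m := ⟨hm.1, fun x hx => by
    rcases lt_or_ge x (b + 1) with h | h
    · by_contra! hlt
      exact absurd (hmin ⟨hx, h⟩ hlt.le) (not_le.2 hlt)
    · exact hm.2.le.trans h⟩
  rwa [hle.csInf_eq]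

theorem isLeast_eigenvalue_zero (hfin : ∀ b, ({x : ℝ | Φ x = 0} ∩ Set.Iio b).Finite)
    (hinf : {x : ℝ | Φ x = 0}.Infinite) : IsLeast {x : ℝ | Φ x = 0} (eigenvalue Φ 0) :=
  sInf_mem_of_finite hinf.nonempty hfin

theorem isLeast_eigenvalue_succ (hfin : ∀ b, ({x : ℝ | Φ x = 0} ∩ Set.Iio b).Finite)
    (hinf : {x : ℝ | Φ x = 0}.Infinite) (n : ℕ) :
    IsLeast {x : ℝ | Φ x = 0 ∧ eigenvalue Φ n < x} (eigenvalue Φ (n + 1)) := by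
  refine sInf_mem_of_finite ?_ fun b => (hfin b).subset fun x hx => ⟨hx.1.1, hx.2⟩
  by_contra hne
  rw [Set.not_nonempty_iff_eq_empty] at hne
  refine hinf ((hfin (eigenvalue Φ n + 1)).subset fun x hx => ⟨hx, ?_⟩)
  have : x ∉ {x : ℝ | Φ x = 0 ∧ eigenvalue Φ n < x} := by rw [hne]; simp
  rw [Set.mem_Iio]
  by_contra! hlt
  exact this ⟨hx, by linarith⟩

theorem charFun_eigenvalue (hfin : ∀ b, ({x : ℝ | Φ x = 0} ∩ Set.Iio b).Finite)
    (hinf : {x : ℝ | Φ x = 0}.Infinite) : ∀ n, Φ (eigenvalue Φ n) = 0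
  | 0 => (isLeast_eigenvalue_zero hfin hinf).1
  | n + 1 => (isLeast_eigenvalue_succ hfin hinf n).1.1

theorem strictMono_eigenvalue (hfin : ∀ b, ({x : ℝ | Φ x = 0} ∩ Set.Iio b).Finite)
    (hinf : {x : ℝ | Φ x = 0}.Infinite) : StrictMono (eigenvalue Φ) :=
  strictMono_nat_of_lt_succ fun n => (isLeast_eigenvalue_succ hfin hinf n).1.2

/-- A zero missed by the enumeration would, by minimality at each stage, exceed all the listed ones,
leaving infinitely many zeros below it. -/
theorem exists_eigenvalue_eq (hfin : ∀ b, ({x : ℝ | Φ x = 0} ∩ Set.Iio b).Finite)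
    (hinf : {x : ℝ | Φ x = 0}.Infinite) {x : ℝ} (hx : Φ x = 0) : ∃ n, eigenvalue Φ n = x := by
  by_contra! hne
  have hlt : ∀ n, eigenvalue Φ n < x := fun n => by
    induction n with
    | zero => exact lt_of_le_of_ne ((isLeast_eigenvalue_zero hfin hinf).2 hx) (hne 0)
    | succ n ih =>
      exact lt_of_le_of_ne ((isLeast_eigenvalue_succ hfin hinf n).2 ⟨hx, ih⟩) (hne _)
  refine Set.infinite_range_of_injective (strictMono_eigenvalue hfin hinf).injective
    ((hfin x).subset ?_)
  rintro _ ⟨n, rfl⟩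
  exact ⟨charFun_eigenvalue hfin hinf n, hlt n⟩

/-- Converts the number of zeros below a bound into the position of the `n`-th one. -/
theorem eigenvalue_lt_iff (hfin : ∀ b, ({x : ℝ | Φ x = 0} ∩ Set.Iio b).Finite)
    (hinf : {x : ℝ | Φ x = 0}.Infinite) {b : ℝ} {N : ℕ}
    (hN : ({x : ℝ | Φ x = 0} ∩ Set.Iio b).ncard = N) (n : ℕ) : eigenvalue Φ n < b ↔ n < N := by
  have hmono := strictMono_eigenvalue hfin hinf
  have himg : eigenvalue Φ '' {n | eigenvalue Φ n < b} = {x : ℝ | Φ x = 0} ∩ Set.Iio b := by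
    ext x
    constructor
    · rintro ⟨n, hn, rfl⟩
      exact ⟨charFun_eigenvalue hfin hinf n, hn⟩
    · rintro ⟨hx, hxb⟩
      obtain ⟨n, rfl⟩ := exists_eigenvalue_eq hfin hinf hx
      exact ⟨n, hxb, rfl⟩
  have hcard : {n | eigenvalue Φ n < b}.ncard = N := by
    rw [← hN, ← himg, Set.ncard_image_of_injective _ hmono.injective]
  have hDfin : {n | eigenvalue Φ n < b}.Finite :=
    Set.Finite.of_finite_image (himg ▸ hfin b) hmono.injective.injOn
  have hIio : ∀ m : ℕ, (Set.Iio m).ncard = m := fun m => by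
    rw [← Finset.coe_Iio, Set.ncard_coe_finset, Nat.card_Iio]
  constructor
  · intro hn
    have := Set.ncard_le_ncard (s := Set.Iio (n + 1)) (t := {n | eigenvalue Φ n < b})
      (fun m hm => (hmono.monotone (Nat.lt_succ_iff.1 hm)).trans_lt hn) hDfin
    rw [hIio, hcard] at this
    omega
  · intro hn
    by_contra! hb
    have := Set.ncard_le_ncard (s := {n | eigenvalue Φ n < b}) (t := Set.Iio n)
      (fun m hm => by
        rw [Set.mem_Iio]
        by_contra! hnm
        exact absurd (hb.trans (hmono.monotone hnm)) (not_le.2 hm)) (Set.finite_Iio n)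
    rw [hIio, hcard] at this
    omega

end Enumeration

/-! ### Localization and asymptotics of the eigenvalues. -/

namespace IsFundamentalSolution

variable {q : ℝ → ℝ} {h H ℓ : ℝ} {y y' : ℝ → ℂ → ℂ}

/-- On the circles `|z| = ((N + 1/2) π / ℓ)²` the function `Φ` is close to `-√z sin (ℓ √z)`. -/
theorem exists_norm_charFun_sub_le (hy : IsFundamentalSolution q h ℓ y y') (hℓ : 0 < ℓ)
    (hq : IntervalIntegrable q volume 0 ℓ) (H : ℝ) :
    ∃ C : ℝ, 0 < C ∧ ∀ᶠ N in atTop, ∀ z, ‖z‖ = radius ℓ N ^ 2 → freeCharFun ℓ z ≠ 0 ∧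
      ‖charFun ℓ H y y' z - freeCharFun ℓ z‖ ≤ C / radius ℓ N * ‖freeCharFun ℓ z‖ := by
  obtain ⟨C, K, hC, hK, hb⟩ := hy.exists_charFun_asymptotics hℓ.le hq H
  refine ⟨4 * C, by positivity, ?_⟩
  filter_upwards [(tendsto_radius hℓ).eventually_ge_atTop K] with N hN z hz
  obtain ⟨k, rfl⟩ : ∃ k, z = k ^ 2 := ⟨csqrt z, (csqrt_sq z).symm⟩
  have hr := radius_pos hℓ N
  have hk : ‖k‖ = radius ℓ N := by
    rw [norm_pow] at hz
    exact (sq_eq_sq₀ (norm_nonneg _) hr.le).1 hz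
  have h1 := exp_le_norm_freeCharFun hℓ hk
  have h2 := hb k (hk ▸ hN)
  have hE := Real.exp_pos (|k.im| * ℓ)
  refine ⟨norm_pos_iff.1 ?_, ?_⟩
  · have := mul_pos hr hE
    linarith
  · have e : charFun ℓ H y y' (k ^ 2) - freeCharFun ℓ (k ^ 2)
        = charFun ℓ H y y' (k ^ 2) + k * Complex.sin (k * ℓ) := by
      rw [freeCharFun_sq, sub_neg_eq_add]
    rw [e]
    refine h2.trans ?_
    rw [div_mul_eq_mul_div, le_div_iff₀ hr]
    nlinarith

theorem differentiable_freeCharFun (hℓ : 0 ≤ ℓ) : Differentiable ℂ (freeCharFun ℓ) :=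
  (isFundamentalSolution_zero ℓ).differentiable_charFun hℓ intervalIntegrable_const

theorem deriv_freeCharFun_ne_zero (hℓ : 0 < ℓ) {z : ℂ} (hz : freeCharFun ℓ z = 0) :
    deriv (freeCharFun ℓ) z ≠ 0 :=
  (isFundamentalSolution_zero ℓ).deriv_charFun_ne_zero hℓ intervalIntegrable_const hz

theorem ncard_zeros_charFun (hy : IsFundamentalSolution q h ℓ y y') (hℓ : 0 < ℓ)
    (hq : IntervalIntegrable q volume 0 ℓ) (H : ℝ) :
    ∀ᶠ N in atTop, {z | ‖z‖ < radius ℓ N ^ 2 ∧ charFun ℓ H y y' z = 0}.ncard = N + 1 := by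
  obtain ⟨C, hC, hb⟩ := hy.exists_norm_charFun_sub_le hℓ hq H
  filter_upwards [hb, (tendsto_radius hℓ).eventually_gt_atTop C] with N hN hCN
  have hr := radius_pos hℓ N
  rw [← ncard_zeros_freeCharFun hℓ N]
  refine ncard_zeros_eq_of_norm_sub_lt (hy.differentiable_charFun hℓ.le hq)
    (fun z hz => hy.deriv_charFun_ne_zero hℓ hq hz) (differentiable_freeCharFun hℓ.le)
    (fun z hz => deriv_freeCharFun_ne_zero hℓ hz) (by positivity) fun z hz => ?_
  obtain ⟨h0, hle⟩ := hN z hz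
  refine hle.trans_lt (mul_lt_of_lt_one_left (norm_pos_iff.2 h0) ?_)
  rwa [div_lt_one hr]

theorem exists_lower_bound (hy : IsFundamentalSolution q h ℓ y y') (hℓ : 0 < ℓ)
    (hq : IntervalIntegrable q volume 0 ℓ) (H : ℝ) :
    ∃ T : ℝ, ∀ x : ℝ, charFun ℓ H y y' x = 0 → -T ≤ x := by
  obtain ⟨C, K, hC, hK, hb⟩ := hy.exists_charFun_asymptotics hℓ.le hq H
  -- With `k = iτ`: `K` admits the asymptotics, `1 / (2ℓ)` the lower bound of the sine, and beyond
  -- `4C` the main term exceeds the error, so `8C` is ample.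
  set τ₀ := max K (max (1 / (2 * ℓ)) (8 * C)) with hτ₀
  refine ⟨τ₀ ^ 2, fun x hx => ?_⟩
  by_contra! hlt
  set τ := Real.sqrt (-x) with hτ
  have hτ₀0 : 0 ≤ τ₀ := by linarith [le_max_left K (max (1 / (2 * ℓ)) (8 * C))]
  have hττ : τ₀ < τ := Real.lt_sqrt_of_sq_lt (by linarith)
  have hsq : τ ^ 2 = -x := Real.sq_sqrt (by nlinarith)
  have hτpos : 0 < τ := by linarith
  have h1 : K ≤ τ := (le_max_left _ _).trans hττ.le
  have h2 : 1 / (2 * ℓ) ≤ τ := ((le_max_left _ _).trans (le_max_right _ _)).trans hττ.le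
  have h3 : 8 * C ≤ τ := ((le_max_right _ _).trans (le_max_right _ _)).trans hττ.le
  have hk : ((τ : ℂ) * Complex.I) ^ 2 = x := by
    rw [mul_pow, Complex.I_sq, ← Complex.ofReal_pow, hsq]; push_cast; ring
  have hn : ‖(τ : ℂ) * Complex.I‖ = τ := by
    rw [norm_mul, Complex.norm_I, mul_one, Complex.norm_real, Real.norm_eq_abs, abs_of_pos hτpos]
  have h4 := hb (τ * Complex.I) (by rw [hn]; exact h1)
  rw [hk, hx, zero_add, norm_mul, hn] at h4
  have him : |((τ : ℂ) * Complex.I * ℓ).im| = |((τ : ℂ) * Complex.I).im| * ℓ :=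
    abs_im_mul_ofReal _ hℓ.le
  have him' : |((τ : ℂ) * Complex.I).im| = τ := by simp [abs_of_pos hτpos]
  have h5 := exp_abs_im_le_norm_sin_of_le (w := (τ : ℂ) * Complex.I * ℓ) (by
    rw [him, him']
    rw [div_le_iff₀ (by positivity)] at h2
    linarith)
  rw [him] at h5
  rw [him'] at h4 h5
  have hE := Real.exp_pos (τ * ℓ)
  nlinarith

theorem finite_real_zeros (hy : IsFundamentalSolution q h ℓ y y') (hℓ : 0 < ℓ)
    (hq : IntervalIntegrable q volume 0 ℓ) (H b : ℝ) :
    ({x : ℝ | charFun ℓ H y y' x = 0} ∩ Set.Iio b).Finite := by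
  obtain ⟨T, hT⟩ := hy.exists_lower_bound hℓ hq H
  have h1 := finite_zeros_of_deriv_ne_zero (hy.differentiable_charFun hℓ.le hq (H := H))
    (fun z hz => hy.deriv_charFun_ne_zero hℓ hq hz)
    ((isCompact_Icc (a := -T) (b := b)).image Complex.continuous_ofReal)
  refine Set.Finite.of_finite_image (f := ((↑) : ℝ → ℂ)) (h1.subset ?_)
    Complex.ofReal_injective.injOn
  rintro _ ⟨x, ⟨hx, hxb⟩, rfl⟩
  exact ⟨⟨x, ⟨hT x hx, le_of_lt hxb⟩, rfl⟩, hx⟩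

/-- The zeros are real and bounded below, so once the disc reaches past the lower bound it contains
the same zeros as the half-line. -/
theorem ncard_real_zeros (hy : IsFundamentalSolution q h ℓ y y') (hℓ : 0 < ℓ)
    (hq : IntervalIntegrable q volume 0 ℓ) (H : ℝ) :
    ∀ᶠ N in atTop,
      ({x : ℝ | charFun ℓ H y y' x = 0} ∩ Set.Iio (radius ℓ N ^ 2)).ncard = N + 1 := by
  obtain ⟨T, hT⟩ := hy.exists_lower_bound hℓ hq H
  filter_upwards [hy.ncard_zeros_charFun hℓ hq H, (tendsto_radius_sq hℓ).eventually_gt_atTop T]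
    with N hN hTN
  rw [← hN, ← Set.ncard_image_of_injective _ Complex.ofReal_injective]
  congr 1
  ext z
  constructor
  · rintro ⟨x, ⟨hx, hxb⟩, rfl⟩
    refine ⟨?_, hx⟩
    rw [Complex.norm_real, Real.norm_eq_abs, abs_lt]
    exact ⟨by linarith [hT x hx], hxb⟩
  · rintro ⟨hz, hz0⟩
    have him := hy.im_eq_zero_of_charFun_eq_zero hℓ hq hz0
    have hzr : z = (z.re : ℂ) := Complex.ext (by simp) (by simpa using him)
    refine ⟨z.re, ⟨?_, ?_⟩, hzr.symm⟩
    · rw [Set.mem_ofPred_eq, ← hzr]; exact hz0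
    · exact (Complex.re_le_norm z).trans_lt hz

theorem infinite_real_zeros (hy : IsFundamentalSolution q h ℓ y y') (hℓ : 0 < ℓ)
    (hq : IntervalIntegrable q volume 0 ℓ) (H : ℝ) :
    {x : ℝ | charFun ℓ H y y' x = 0}.Infinite := fun hfin => by
  obtain ⟨N, hN, hlt⟩ := ((hy.ncard_real_zeros hℓ hq H).and
    (eventually_ge_atTop ({x : ℝ | charFun ℓ H y y' x = 0}.ncard))).exists
  have := Set.ncard_le_ncard (Set.inter_subset_left (s := {x : ℝ | charFun ℓ H y y' x = 0})
    (t := Set.Iio (radius ℓ N ^ 2))) hfin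
  omega

/-- The enumeration of the eigenvalues: one in each of the intervals
`[((n - 1/2) π / ℓ)², ((n + 1/2) π / ℓ)²)` for large `n`. -/
theorem eventually_eigenvalue_mem (hy : IsFundamentalSolution q h ℓ y y') (hℓ : 0 < ℓ)
    (hq : IntervalIntegrable q volume 0 ℓ) (H : ℝ) :
    ∀ᶠ n in atTop, radius ℓ n ^ 2 ≤ eigenvalue (charFun ℓ H y y') (n + 1) ∧
      eigenvalue (charFun ℓ H y y') (n + 1) < radius ℓ (n + 1) ^ 2 := by
  have h1 := hy.ncard_real_zeros hℓ hq H
  filter_upwards [h1, (tendsto_add_atTop_nat 1).eventually h1] with n hn hn'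
  have hfin := hy.finite_real_zeros hℓ hq H
  have hinf := hy.infinite_real_zeros hℓ hq H
  refine ⟨?_, (eigenvalue_lt_iff hfin hinf hn' (n + 1)).2 (by omega)⟩
  rw [← not_lt, eigenvalue_lt_iff hfin hinf hn (n + 1)]
  omega

/-- At an eigenvalue `k²` the asymptotics read `k |sin(kℓ)| ≤ C`. With `d = kℓ - (n+1)π` in `[-π/2,
π/2]`, the inequality `2|d|/π ≤ |sin d|` gives `k |d| ≤ Cπ/2`; the difference of squares is `d (kℓ +
(n+1)π) / ℓ²`, with second factor at most `3kℓ`. -/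
theorem exists_abs_eigenvalue_sub_le (hy : IsFundamentalSolution q h ℓ y y') (hℓ : 0 < ℓ)
    (hq : IntervalIntegrable q volume 0 ℓ) (H : ℝ) :
    ∃ C : ℝ, ∀ᶠ n : ℕ in atTop,
      |eigenvalue (charFun ℓ H y y') (n + 1) - ((n + 1) * Real.pi / ℓ) ^ 2| ≤ C := by
  obtain ⟨C, K, hC, hK, hb⟩ := hy.exists_charFun_asymptotics hℓ.le hq H
  have hfin := hy.finite_real_zeros hℓ hq H
  have hinf := hy.infinite_real_zeros hℓ hq H
  refine ⟨3 * C * Real.pi / (2 * ℓ), ?_⟩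
  filter_upwards [hy.eventually_eigenvalue_mem hℓ hq H,
    (tendsto_radius hℓ).eventually_ge_atTop K] with n ⟨h1, h2⟩ hKn
  have h0 := charFun_eigenvalue hfin hinf (n + 1)
  set μ := eigenvalue (charFun ℓ H y y') (n + 1)
  set k := Real.sqrt μ with hk
  have hr := radius_pos hℓ n
  have hμ : k ^ 2 = μ := Real.sq_sqrt ((sq_nonneg _).trans h1)
  have hk1 : radius ℓ n ≤ k := Real.le_sqrt_of_sq_le h1
  have hk2 : k < radius ℓ (n + 1) := (Real.sqrt_lt' (radius_pos hℓ _)).2 h2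
  have hkpos : 0 < k := hr.trans_le hk1
  have h3 := hb k (by rw [Complex.norm_real, Real.norm_eq_abs, abs_of_pos hkpos]; linarith)
  rw [← Complex.ofReal_pow, hμ, h0, zero_add, Complex.ofReal_im, abs_zero, zero_mul, Real.exp_zero,
    mul_one, ← Complex.ofReal_mul, ← Complex.ofReal_sin, ← Complex.ofReal_mul, Complex.norm_real,
    Real.norm_eq_abs, abs_mul, abs_of_pos hkpos] at h3
  set d := k * ℓ - (n + 1) * Real.pi with hd
  have hsin : |Real.sin (k * ℓ)| = |Real.sin d| := by
    have : d = k * ℓ - ((n + 1 : ℕ) : ℝ) * Real.pi := by rw [hd]; push_cast; ring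
    rw [this, Real.sin_sub_nat_mul_pi, abs_mul, abs_pow, abs_neg, abs_one, one_pow, one_mul]
  unfold radius at hk1 hk2
  rw [div_le_iff₀ hℓ] at hk1
  rw [lt_div_iff₀ hℓ] at hk2
  push_cast at hk2
  have hdb : |d| ≤ Real.pi / 2 := abs_le.2 ⟨by rw [hd]; linarith, by rw [hd]; linarith⟩
  have h4 := Real.mul_abs_le_abs_sin hdb
  rw [← hsin] at h4
  have hpi := Real.pi_pos
  have h5 : k * |d| ≤ C * Real.pi / 2 := by
    rw [div_mul_eq_mul_div, div_le_iff₀ hpi] at h4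
    have h6 : 2 * (k * |d|) ≤ k * |Real.sin (k * ℓ)| * Real.pi := by nlinarith
    nlinarith
  have h7 : μ - ((n + 1) * Real.pi / ℓ) ^ 2 = d * (k * ℓ + (n + 1) * Real.pi) / ℓ ^ 2 := by
    rw [← hμ, hd]; field_simp; ring
  have hn0 : (0 : ℝ) ≤ n := n.cast_nonneg
  have h8 : (n + 1) * Real.pi ≤ 2 * (k * ℓ) := by nlinarith
  rw [h7, abs_div, abs_mul, abs_of_pos (pow_pos hℓ 2), div_le_div_iff₀ (pow_pos hℓ 2) (by positivity),
    abs_of_nonneg (by positivity : 0 ≤ k * ℓ + (n + 1) * Real.pi)]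
  have h9 : |d| * (k * ℓ + (n + 1) * Real.pi) ≤ 3 * ℓ * (C * Real.pi / 2) := by
    calc |d| * (k * ℓ + (n + 1) * Real.pi) ≤ |d| * (3 * (k * ℓ)) := by
          gcongr; linarith
      _ = 3 * ℓ * (k * |d|) := by ring
      _ ≤ _ := by gcongr
  calc |d| * (k * ℓ + (n + 1) * Real.pi) * (2 * ℓ) ≤ 3 * ℓ * (C * Real.pi / 2) * (2 * ℓ) := by gcongr
    _ = 3 * C * Real.pi * ℓ ^ 2 := by ring

theorem tendsto_mul_pi_div_sqrt_eigenvalue (hy : IsFundamentalSolution q h ℓ y y') (hℓ : 0 < ℓ)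
    (hq : IntervalIntegrable q volume 0 ℓ) (H : ℝ) :
    Tendsto (fun n : ℕ => (n : ℝ) * Real.pi / Real.sqrt (eigenvalue (charFun ℓ H y y') n))
      atTop (𝓝 ℓ) := by
  rw [← tendsto_add_atTop_iff_nat 1]
  have hpi := Real.pi_pos
  have hlim : ∀ c : ℝ, Tendsto (fun n : ℕ => ((n : ℝ) + 1) * ℓ / (n + c)) atTop (𝓝 ℓ) := fun c => by
    have h1 : Tendsto (fun n : ℕ => ℓ + (1 - c) * ℓ / ((n : ℝ) + c)) atTop (𝓝 (ℓ + 0)) :=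
      tendsto_const_nhds.add (tendsto_const_nhds.div_atTop
        (tendsto_natCast_atTop_atTop.atTop_add tendsto_const_nhds))
    rw [add_zero] at h1
    refine h1.congr' ?_
    filter_upwards [(tendsto_natCast_atTop_atTop (R := ℝ)).eventually_gt_atTop (-c)] with n hn
    have : (n : ℝ) + c ≠ 0 := by linarith
    field_simp
    ring
  refine tendsto_of_tendsto_of_tendsto_of_le_of_le' (hlim (3 / 2)) (hlim (1 / 2)) ?_ ?_
  · filter_upwards [hy.eventually_eigenvalue_mem hℓ hq H] with n ⟨h1, h2⟩
    set μ := eigenvalue (charFun ℓ H y y') (n + 1)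
    have hk1 : radius ℓ n ≤ Real.sqrt μ := Real.le_sqrt_of_sq_le h1
    have hk2 : Real.sqrt μ < radius ℓ (n + 1) := (Real.sqrt_lt' (radius_pos hℓ _)).2 h2
    have hkpos : 0 < Real.sqrt μ := (radius_pos hℓ n).trans_le hk1
    unfold radius at hk2
    rw [lt_div_iff₀ hℓ] at hk2
    push_cast at hk2 ⊢
    rw [div_le_div_iff₀ (by positivity) hkpos]
    have := mul_le_mul_of_nonneg_left hk2.le (by positivity : (0 : ℝ) ≤ n + 1)
    linarith
  · filter_upwards [hy.eventually_eigenvalue_mem hℓ hq H] with n ⟨h1, h2⟩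
    set μ := eigenvalue (charFun ℓ H y y') (n + 1)
    have hk1 : radius ℓ n ≤ Real.sqrt μ := Real.le_sqrt_of_sq_le h1
    have hkpos : 0 < Real.sqrt μ := (radius_pos hℓ n).trans_le hk1
    unfold radius at hk1
    rw [div_le_iff₀ hℓ] at hk1
    push_cast
    rw [div_le_div_iff₀ hkpos (by positivity)]
    have := mul_le_mul_of_nonneg_left hk1 (by positivity : (0 : ℝ) ≤ n + 1)
    linarith

end IsFundamentalSolution

/-! ### The product representation of `Φ`. -/

/-- The eigenvalues `(n π / ℓ)²` of the problem with `q = h = H = 0`. -/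
def freeEigenvalue (ℓ : ℝ) (n : ℕ) : ℝ := (n * Real.pi / ℓ) ^ 2

section Hadamard

variable {ℓ : ℝ} {lam : ℕ → ℝ} {C : ℝ}

/-- The normalization is the inverse of the free eigenvalue of index `n + 1`; with bounded shifts
the factors are therefore `1 + O(1/n²)`, locally uniformly in `z`. -/
theorem hadamardFactor_eq (hℓ : 0 < ℓ) (z : ℂ) (n : ℕ) :
    hadamardFactor ℓ lam z n = 1 + ((ℓ ^ 2 / (Real.pi ^ 2 * ((n : ℝ) + 1) ^ 2) : ℝ) : ℂ)
      * (((lam (n + 1) - freeEigenvalue ℓ (n + 1) : ℝ) : ℂ) - z) := by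
  have h1 : (ℓ ^ 2 / (Real.pi ^ 2 * ((n : ℝ) + 1) ^ 2)) * freeEigenvalue ℓ (n + 1) = 1 := by
    have := Real.pi_pos.ne'
    unfold freeEigenvalue
    push_cast
    field_simp
  have h2 : ((ℓ ^ 2 / (Real.pi ^ 2 * ((n : ℝ) + 1) ^ 2) : ℝ) : ℂ)
      * ((freeEigenvalue ℓ (n + 1) : ℝ) : ℂ) = 1 := by rw [← Complex.ofReal_mul, h1]; simp
  rw [hadamardFactor, Complex.ofReal_sub]
  linear_combination h2

theorem norm_hadamardFactor_sub_one_le (hC : ∀ n, |lam n - freeEigenvalue ℓ n| ≤ C) {z : ℂ} {R : ℝ}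
    (hz : ‖z‖ ≤ R) (n : ℕ) :
    ‖((ℓ ^ 2 / (Real.pi ^ 2 * ((n : ℝ) + 1) ^ 2) : ℝ) : ℂ)
      * (((lam (n + 1) - freeEigenvalue ℓ (n + 1) : ℝ) : ℂ) - z)‖
      ≤ ℓ ^ 2 / Real.pi ^ 2 * (C + R) * (1 / ((n : ℝ) + 1) ^ 2) := by
  rw [norm_mul, Complex.norm_real, Real.norm_eq_abs, abs_of_nonneg (by positivity)]
  have h1 : ‖((lam (n + 1) - freeEigenvalue ℓ (n + 1) : ℝ) : ℂ) - z‖ ≤ C + R := by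
    refine (norm_sub_le _ _).trans (add_le_add ?_ hz)
    rw [Complex.norm_real]; exact hC _
  calc _ ≤ ℓ ^ 2 / (Real.pi ^ 2 * ((n : ℝ) + 1) ^ 2) * (C + R) := by gcongr
    _ = _ := by have := Real.pi_pos.ne'; field_simp

theorem summable_one_div_succ_sq (c : ℝ) : Summable fun n : ℕ => c * (1 / ((n : ℝ) + 1) ^ 2) := by
  have := (summable_nat_add_iff 1).2 (Real.summable_one_div_nat_pow.2 one_lt_two)
  push_cast at this
  exact this.mul_left c

theorem multipliable_hadamardFactor (hℓ : 0 < ℓ) (hC : ∀ n, |lam n - freeEigenvalue ℓ n| ≤ C)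
    (z : ℂ) : Multipliable (hadamardFactor ℓ lam z) := by
  rw [show hadamardFactor ℓ lam z = _ from funext (hadamardFactor_eq hℓ z)]
  exact multipliable_one_add_of_summable ((summable_one_div_succ_sq _).of_nonneg_of_le
    (fun _ => norm_nonneg _) (norm_hadamardFactor_sub_one_le hC le_rfl))

theorem differentiable_hadamardProduct (hℓ : 0 < ℓ)
    (hC : ∀ n, |lam n - freeEigenvalue ℓ n| ≤ C) : Differentiable ℂ (hadamardProduct ℓ lam) := by
  have key : Differentiable ℂ (fun z => ∏' n, hadamardFactor ℓ lam z n) := fun z₀ => by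
    have h1 : HasProdLocallyUniformlyOn
        (fun (n : ℕ) z => 1 + ((ℓ ^ 2 / (Real.pi ^ 2 * ((n : ℝ) + 1) ^ 2) : ℝ) : ℂ)
          * (((lam (n + 1) - freeEigenvalue ℓ (n + 1) : ℝ) : ℂ) - z))
        (fun z => ∏' n : ℕ, (1 + ((ℓ ^ 2 / (Real.pi ^ 2 * ((n : ℝ) + 1) ^ 2) : ℝ) : ℂ)
          * (((lam (n + 1) - freeEigenvalue ℓ (n + 1) : ℝ) : ℂ) - z)))
        (Metric.ball (0 : ℂ) (‖z₀‖ + 1)) :=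
      Summable.hasProdLocallyUniformlyOn_nat_one_add Metric.isOpen_ball
        (summable_one_div_succ_sq _)
        (Eventually.of_forall fun n z hz =>
          norm_hadamardFactor_sub_one_le hC (mem_ball_zero_iff.1 hz).le n)
        (fun n => by fun_prop)
    simp only [hadamardFactor_eq hℓ]
    refine (h1.differentiableOn (.of_forall fun s => ?_) Metric.isOpen_ball).differentiableAt
      (Metric.isOpen_ball.mem_nhds (by simp))
    simpa [Finset.prod_fn] using DifferentiableOn.finsetProd (fun _ _ => by fun_prop)
  unfold hadamardProduct
  exact ((differentiable_const _).mul ((differentiable_const _).sub differentiable_id)).mul key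

theorem hadamardProduct_eq_zero {n : ℕ} : hadamardProduct ℓ lam (lam n) = 0 := by
  rcases n with _ | n
  · simp [hadamardProduct]
  · rw [hadamardProduct, tprod_of_exists_eq_zero ⟨n, by simp [hadamardFactor]⟩, mul_zero]

/-- `n ↦ (lam n - μ n) / (μ n - z)` with `μ n` the free eigenvalues. -/
def relativeShift (ℓ : ℝ) (lam : ℕ → ℝ) (z : ℂ) (n : ℕ) : ℂ :=
  ((lam n - freeEigenvalue ℓ n : ℝ) : ℂ) / ((freeEigenvalue ℓ n : ℂ) - z)

theorem freeCharFun_freeEigenvalue (hℓ : 0 < ℓ) (n : ℕ) :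
    freeCharFun ℓ (freeEigenvalue ℓ n) = 0 := (freeCharFun_eq_zero_iff hℓ _).2 ⟨n, rfl⟩

/-- Euler's product for the sine; the sign comes from the factor `λ_0 - z = -z` of the free problem.
-/
theorem tendsto_freeCharFun (hℓ : 0 < ℓ) (z : ℂ) :
    Tendsto (fun m : ℕ => -(ℓ * z * ∏ n ∈ Finset.range m, hadamardFactor ℓ (freeEigenvalue ℓ) z n))
      atTop (𝓝 (freeCharFun ℓ z)) := by
  obtain ⟨k, rfl⟩ : ∃ k, z = k ^ 2 := ⟨csqrt z, (csqrt_sq z).symm⟩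
  have hpi : (Real.pi : ℂ) ≠ 0 := by exact_mod_cast Real.pi_pos.ne'
  have h1 := (Complex.tendsto_euler_sin_prod (k * ℓ / Real.pi)).const_mul (-k)
  rw [mul_div_cancel₀ _ hpi] at h1
  rw [freeCharFun_sq, ← neg_mul]
  refine h1.congr fun m => ?_
  have : ∀ n ∈ Finset.range m, hadamardFactor ℓ (freeEigenvalue ℓ) (k ^ 2) n
      = 1 - (k * ℓ / Real.pi) ^ 2 / ((n : ℂ) + 1) ^ 2 := fun n _ => by
    have hn : (n : ℂ) + 1 ≠ 0 := n.cast_add_one_ne_zero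
    rw [hadamardFactor_eq hℓ]
    push_cast
    field_simp
    ring
  rw [Finset.prod_congr rfl this]
  field_simp

/-- Each factor is `(lam n - z) / (μ n - z) = 1 + relativeShift` times its free counterpart. The
separate factor `lam 0 - z` accounts for the range `m + 1`. -/
theorem prod_hadamardFactor_eq {z : ℂ} (hz : ∀ n, (freeEigenvalue ℓ n : ℂ) - z ≠ 0) (m : ℕ) :
    (ℓ : ℂ) * ((lam 0 : ℂ) - z) * ∏ n ∈ Finset.range m, hadamardFactor ℓ lam z n
      = (∏ n ∈ Finset.range (m + 1), (1 + relativeShift ℓ lam z n))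
        * -(ℓ * z * ∏ n ∈ Finset.range m, hadamardFactor ℓ (freeEigenvalue ℓ) z n) := by
  have h1 : ∀ n, (lam n : ℂ) - z = (1 + relativeShift ℓ lam z n) * ((freeEigenvalue ℓ n : ℂ) - z) :=
    fun n => by
      have := hz n
      rw [relativeShift]; push_cast; field_simp; ring
  have h2 : ∀ n, hadamardFactor ℓ lam z n
      = (1 + relativeShift ℓ lam z (n + 1)) * hadamardFactor ℓ (freeEigenvalue ℓ) z n := fun n => by
    rw [hadamardFactor, hadamardFactor, h1]; ring
  have h0 : (freeEigenvalue ℓ 0 : ℂ) = 0 := by simp [freeEigenvalue]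
  rw [Finset.prod_congr rfl fun n _ => h2 n, Finset.prod_mul_distrib, h1 0, h0,
    Finset.prod_range_succ' _ m]
  ring

/-- `∑_{j ∈ ℤ} |j - 1/2|^{-3/2}`. -/
def shiftSum : ℝ := ∑' j : ℤ, 1 / |(j : ℝ) + -1 / 2| ^ (3 / 2 : ℝ)

theorem summable_shiftSum : Summable fun j : ℤ => 1 / |(j : ℝ) + -1 / 2| ^ (3 / 2 : ℝ) :=
  (Real.summable_one_div_int_add_rpow (-1 / 2) (3 / 2)).2 (by norm_num)

/-- With `M = N + 1/2` and `d = n - M`, the denominator is at least `(π/ℓ)² |d| (n + M)`. Since `n +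
M ≥ √M √|d|`, it splits into a factor `√M`, which makes the sum over `n` small, and `|d|^{3/2}`,
which makes it converge uniformly in `N`. -/
theorem norm_relativeShift_le (hℓ : 0 < ℓ) (hC : ∀ n, |lam n - freeEigenvalue ℓ n| ≤ C) {N : ℕ}
    {z : ℂ} (hz : ‖z‖ = radius ℓ N ^ 2) (n : ℕ) :
    ‖relativeShift ℓ lam z n‖ ≤ C * (ℓ / Real.pi) ^ 2 / Real.sqrt ((N : ℝ) + 1 / 2)
      * (1 / |(((n : ℤ) - N : ℤ) : ℝ) + -1 / 2| ^ (3 / 2 : ℝ)) := by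
  have hC0 : 0 ≤ C := (abs_nonneg _).trans (hC 0)
  have hpi := Real.pi_pos
  set M : ℝ := (N : ℝ) + 1 / 2 with hM
  have hM0 : 0 < M := by positivity
  set d : ℝ := (((n : ℤ) - N : ℤ) : ℝ) + -1 / 2 with hd
  have hdM : d = n - M := by rw [hd, hM]; push_cast; ring
  have hd0 : 0 < |d| := by
    refine abs_pos.2 fun h0 => ?_
    have h2 : (2 * ((n : ℤ) - N) : ℤ) = 1 := by
      have : (2 * (((n : ℤ) - N : ℤ) : ℝ)) = 1 := by linarith
      exact_mod_cast this
    omega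
  have hn0 : (0 : ℝ) ≤ n := n.cast_nonneg
  have hlow : Real.sqrt M * |d| ^ (3 / 2 : ℝ) ≤ |d| * (n + M) := by
    have e : |d| ^ (3 / 2 : ℝ) = |d| * Real.sqrt |d| := by
      rw [Real.sqrt_eq_rpow, show (3 / 2 : ℝ) = 1 + 1 / 2 by norm_num, Real.rpow_add hd0,
        Real.rpow_one]
    have hdle : |d| ≤ n + M := by rw [hdM, abs_le]; constructor <;> linarith
    have : Real.sqrt M * Real.sqrt |d| ≤ n + M := by
      calc Real.sqrt M * Real.sqrt |d| ≤ Real.sqrt (n + M) * Real.sqrt (n + M) := by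
            gcongr; linarith
        _ = n + M := Real.mul_self_sqrt (by positivity)
    rw [e, mul_left_comm]
    exact mul_le_mul_of_nonneg_left this hd0.le
  have hden : (Real.pi / ℓ) ^ 2 * (Real.sqrt M * |d| ^ (3 / 2 : ℝ))
      ≤ ‖(freeEigenvalue ℓ n : ℂ) - z‖ := by
    have h1 := abs_norm_sub_norm_le (freeEigenvalue ℓ n : ℂ) z
    have h2 : |‖(freeEigenvalue ℓ n : ℂ)‖ - ‖z‖| = (Real.pi / ℓ) ^ 2 * (|d| * (n + M)) := by
      have h3 : freeEigenvalue ℓ n - radius ℓ N ^ 2 = (Real.pi / ℓ) ^ 2 * (d * (n + M)) := by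
        rw [freeEigenvalue, radius, ← hM, hdM]
        field_simp
        ring
      rw [hz, Complex.norm_real, Real.norm_eq_abs, abs_of_nonneg (show 0 ≤ freeEigenvalue ℓ n from
        sq_nonneg _), h3, abs_mul, abs_mul, abs_of_nonneg (sq_nonneg (Real.pi / ℓ)),
        abs_of_pos (by positivity : 0 < (n : ℝ) + M)]
    rw [h2] at h1
    exact (mul_le_mul_of_nonneg_left hlow (by positivity)).trans h1
  have hsq : 0 < Real.sqrt M := Real.sqrt_pos.2 hM0
  have hdp : 0 < |d| ^ (3 / 2 : ℝ) := Real.rpow_pos_of_pos hd0 _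
  rw [relativeShift, norm_div, Complex.norm_real, Real.norm_eq_abs]
  calc _ ≤ C / ((Real.pi / ℓ) ^ 2 * (Real.sqrt M * |d| ^ (3 / 2 : ℝ))) := by
        gcongr; exact hC n
    _ = _ := by field_simp

theorem norm_prod_relativeShift_sub_one_le (hℓ : 0 < ℓ)
    (hC : ∀ n, |lam n - freeEigenvalue ℓ n| ≤ C) {N : ℕ} {z : ℂ} (hz : ‖z‖ = radius ℓ N ^ 2)
    (m : ℕ) : ‖∏ n ∈ Finset.range m, (1 + relativeShift ℓ lam z n) - 1‖
      ≤ Real.exp (C * (ℓ / Real.pi) ^ 2 / Real.sqrt ((N : ℝ) + 1 / 2) * shiftSum) - 1 := by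
  have hC0 : 0 ≤ C := (abs_nonneg _).trans (hC 0)
  refine (Finset.norm_prod_one_add_sub_one_le _ _).trans
    (sub_le_sub_right (Real.exp_le_exp.2 ?_) _)
  have hinj : Function.Injective (fun n : ℕ => ((n : ℤ) - N)) := fun a b hab => by
    simpa using hab
  have hsum := summable_shiftSum.comp_injective hinj
  calc ∑ n ∈ Finset.range m, ‖relativeShift ℓ lam z n‖
      ≤ ∑ n ∈ Finset.range m, C * (ℓ / Real.pi) ^ 2 / Real.sqrt ((N : ℝ) + 1 / 2)
        * (1 / |(((n : ℤ) - N : ℤ) : ℝ) + -1 / 2| ^ (3 / 2 : ℝ)) :=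
        Finset.sum_le_sum fun n _ => norm_relativeShift_le hℓ hC hz n
    _ = C * (ℓ / Real.pi) ^ 2 / Real.sqrt ((N : ℝ) + 1 / 2) * ∑ n ∈ Finset.range m,
        (1 / |(((n : ℤ) - N : ℤ) : ℝ) + -1 / 2| ^ (3 / 2 : ℝ)) := by rw [Finset.mul_sum]
    _ ≤ _ := by
        refine mul_le_mul_of_nonneg_left ?_ (by positivity)
        refine (hsum.sum_le_tsum _ fun n _ => ?_).trans ?_
        · exact div_nonneg zero_le_one (Real.rpow_nonneg (abs_nonneg _) _)
        · exact hsum.tsum_le_tsum_of_inj _ hinj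
            (fun j _ => div_nonneg zero_le_one (Real.rpow_nonneg (abs_nonneg _) _))
            (fun n => le_rfl) summable_shiftSum

theorem norm_hadamardProduct_sub_le (hℓ : 0 < ℓ) (hC : ∀ n, |lam n - freeEigenvalue ℓ n| ≤ C)
    {N : ℕ} {z : ℂ} (hz : ‖z‖ = radius ℓ N ^ 2) (h0 : freeCharFun ℓ z ≠ 0) :
    ‖hadamardProduct ℓ lam z - freeCharFun ℓ z‖
      ≤ (Real.exp (C * (ℓ / Real.pi) ^ 2 / Real.sqrt ((N : ℝ) + 1 / 2) * shiftSum) - 1)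
        * ‖freeCharFun ℓ z‖ := by
  have hne : ∀ n, (freeEigenvalue ℓ n : ℂ) - z ≠ 0 := fun n h => by
    rw [sub_eq_zero] at h
    exact h0 (h ▸ freeCharFun_freeEigenvalue hℓ n)
  have h1 : Tendsto (fun m : ℕ =>
      (ℓ : ℂ) * ((lam 0 : ℂ) - z) * ∏ n ∈ Finset.range m, hadamardFactor ℓ lam z n)
      atTop (𝓝 (hadamardProduct ℓ lam z)) :=
    ((multipliable_hadamardFactor hℓ hC z).hasProd.tendsto_prod_nat).const_mul _
  have h2 := tendsto_freeCharFun hℓ z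
  refine le_of_tendsto_of_tendsto (h1.sub h2).norm (h2.norm.const_mul _)
    (Eventually.of_forall fun m => ?_)
  simp only []
  rw [prod_hadamardFactor_eq hne m, ← sub_one_mul, norm_mul]
  exact mul_le_mul_of_nonneg_right (norm_prod_relativeShift_sub_one_le hℓ hC hz _) (norm_nonneg _)

theorem tendsto_exp_sub_one (c : ℝ) :
    Tendsto (fun N : ℕ => Real.exp (c / Real.sqrt ((N : ℝ) + 1 / 2) * shiftSum) - 1)
      atTop (𝓝 0) := by
  have h1 : Tendsto (fun N : ℕ => c / Real.sqrt ((N : ℝ) + 1 / 2)) atTop (𝓝 0) :=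
    tendsto_const_nhds.div_atTop (Real.tendsto_sqrt_atTop.comp
      (tendsto_natCast_atTop_atTop.atTop_add tendsto_const_nhds))
  have h2 := (Real.continuous_exp.tendsto _).comp (h1.mul_const shiftSum)
  simpa using h2.sub_const 1

end Hadamard

namespace IsFundamentalSolution

variable {q : ℝ → ℝ} {h H ℓ : ℝ} {y y' : ℝ → ℂ → ℂ}

theorem exists_forall_abs_eigenvalue_sub_le (hy : IsFundamentalSolution q h ℓ y y') (hℓ : 0 < ℓ)
    (hq : IntervalIntegrable q volume 0 ℓ) (H : ℝ) :
    ∃ C : ℝ, ∀ n, |eigenvalue (charFun ℓ H y y') n - freeEigenvalue ℓ n| ≤ C := by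
  obtain ⟨C, hC⟩ := hy.exists_abs_eigenvalue_sub_le hℓ hq H
  have hb : IsBoundedUnder (· ≤ ·) atTop
      (fun n => |eigenvalue (charFun ℓ H y y') n - freeEigenvalue ℓ n|) := by
    refine ⟨C, ?_⟩
    rw [eventually_map]
    obtain ⟨n₀, hn₀⟩ := eventually_atTop.1 hC
    refine eventually_atTop.2 ⟨n₀ + 1, fun n hn => ?_⟩
    obtain ⟨m, rfl⟩ : ∃ m, n = m + 1 := ⟨n - 1, by omega⟩
    have := hn₀ m (by omega)
    unfold freeEigenvalue
    push_cast
    exact this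
  obtain ⟨B, hB⟩ := hb.bddAbove_range
  exact ⟨B, fun n => hB ⟨n, rfl⟩⟩

/-- The Hadamard factorization of the characteristic function. -/
theorem charFun_eq_hadamardProduct (hy : IsFundamentalSolution q h ℓ y y') (hℓ : 0 < ℓ)
    (hq : IntervalIntegrable q volume 0 ℓ) (H : ℝ) :
    charFun ℓ H y y' = hadamardProduct ℓ (eigenvalue (charFun ℓ H y y')) := by
  obtain ⟨B, hB⟩ := hy.exists_forall_abs_eigenvalue_sub_le hℓ hq H
  obtain ⟨C, hC, hb⟩ := hy.exists_norm_charFun_sub_le hℓ hq H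
  have hfin := hy.finite_real_zeros hℓ hq H
  have hinf := hy.infinite_real_zeros hℓ hq H
  set Φ := charFun ℓ H y y' with hΦ
  set P := hadamardProduct ℓ (eigenvalue Φ) with hP
  have hΦd : Differentiable ℂ Φ := hy.differentiable_charFun hℓ.le hq
  have hzero : ∀ z, Φ z = 0 → P z = 0 := fun z hz => by
    have him := hy.im_eq_zero_of_charFun_eq_zero hℓ hq hz
    have hzr : z = (z.re : ℂ) := Complex.ext (by simp) (by simpa using him)
    rw [hzr] at hz
    obtain ⟨n, hn⟩ := exists_eigenvalue_eq hfin hinf hz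
    rw [hzr, ← hn]
    exact hadamardProduct_eq_zero
  -- Dividing the product by `Φ`, and not conversely, requires only that the product vanish at the
  -- eigenvalues; its other zeros and its growth between the circles play no role.
  obtain ⟨Q, hQd, hQ⟩ := exists_entire_quotient (differentiable_hadamardProduct hℓ hB) hΦd hzero
    (fun z hz => hy.deriv_charFun_ne_zero hℓ hq hz)
  have hlim : Tendsto (fun N : ℕ => 2 * ((Real.exp (B * (ℓ / Real.pi) ^ 2
      / Real.sqrt ((N : ℝ) + 1 / 2) * shiftSum) - 1) + C / radius ℓ N)) atTop (𝓝 0) := by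
    have h1 : Tendsto (fun N => C / radius ℓ N) atTop (𝓝 0) :=
      tendsto_const_nhds.div_atTop (tendsto_radius hℓ)
    simpa using ((tendsto_exp_sub_one (B * (ℓ / Real.pi) ^ 2)).add h1).const_mul 2
  have hone : ∀ z, Q z - 1 = 0 := by
    refine eq_zero_of_norm_le_on_spheres (hQd.sub_const 1) (tendsto_radius_sq hℓ) hlim ?_
    filter_upwards [hb, (tendsto_radius hℓ).eventually_ge_atTop (2 * C)] with N hN hCN z hz
    obtain ⟨h0, h1⟩ := hN z hz
    have h2 := norm_hadamardProduct_sub_le hℓ hB hz h0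
    have hr := radius_pos hℓ N
    set δ := Real.exp (B * (ℓ / Real.pi) ^ 2 / Real.sqrt ((N : ℝ) + 1 / 2) * shiftSum) - 1
    have hF := norm_pos_iff.2 h0
    have hhalf : C / radius ℓ N ≤ 1 / 2 := by rw [div_le_iff₀ hr]; linarith
    have h3 : ‖freeCharFun ℓ z‖ / 2 ≤ ‖Φ z‖ := by
      have h4 := norm_sub_norm_le (freeCharFun ℓ z) (Φ z)
      rw [norm_sub_rev] at h4
      have h5 := mul_le_mul_of_nonneg_right hhalf hF.le
      linarith
    have h6 : ‖Φ z‖ * ‖Q z - 1‖ ≤ (δ + C / radius ℓ N) * ‖freeCharFun ℓ z‖ := by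
      rw [← norm_mul, mul_sub_one, ← hQ z,
        show hadamardProduct ℓ (eigenvalue Φ) z - Φ z
          = (hadamardProduct ℓ (eigenvalue Φ) z - freeCharFun ℓ z) - (Φ z - freeCharFun ℓ z) by ring]
      refine (norm_sub_le _ _).trans ?_
      linarith
    have h7 := mul_le_mul_of_nonneg_right h3 (norm_nonneg (Q z - 1))
    refine le_of_mul_le_mul_left ?_ hF
    linarith
  ext z
  have := hQ z
  rw [sub_eq_zero.1 (hone z), mul_one] at this
  exact this.symm

end IsFundamentalSolution

/-! ### Completeness of the eigenfunctions. -/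

theorem IsPrimitive.deriv_eq_zero {L : ℝ} (hL : 0 < L) {F f : ℝ → ℂ} (hF : IsPrimitive L F f)
    (h0 : ∀ x ∈ Set.Icc 0 L, F x = 0) (hf : ContinuousOn f (Set.Icc 0 L)) :
    ∀ x ∈ Set.Icc 0 L, f x = 0 := by
  have hIoo : Set.EqOn f 0 (Set.Ioo 0 L) := fun x hx => by
    have hx' := Set.Ioo_subset_Icc_self hx
    have h1 : HasDerivAt (fun u => ∫ s in (0 : ℝ)..u, f s) (f x) x :=
      intervalIntegral.integral_hasDerivAt_right (hF.mono hx').integrable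
        ((hf.mono Set.Ioo_subset_Icc_self).stronglyMeasurableAtFilter isOpen_Ioo x hx) (hf.continuousAt (Icc_mem_nhds hx.1 hx.2))
    have h2 : (fun u => ∫ s in (0 : ℝ)..u, f s) =ᶠ[𝓝 x] fun _ => 0 := by
      filter_upwards [Icc_mem_nhds hx.1 hx.2] with u hu
      have := hF.eq u hu
      rw [h0 u hu, h0 0 ⟨le_rfl, hL.le⟩, zero_add] at this
      exact this.symm
    exact h1.unique ((hasDerivAt_const x 0).congr_of_eventuallyEq h2)
  have := hIoo.of_subset_closure hf continuousOn_const Set.Ioo_subset_Icc_self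
    (by rw [closure_Ioo hL.ne])
  exact fun x hx => this hx

namespace IsFundamentalSolution

variable {q : ℝ → ℝ} {h H ℓ : ℝ} {y y' : ℝ → ℂ → ℂ}

/-- The energy identity for a solution of the boundary value problem with right-hand side `w`. -/
theorem im_mul_integral_norm_sq (hℓ : 0 ≤ ℓ) {w : ℝ → ℝ} (hw : ContinuousOn w (Set.Icc 0 ℓ))
    {z : ℂ} {u u' : ℝ → ℂ} (hu : IsPrimitive ℓ u u')
    (hu' : IsPrimitive ℓ u' (fun s => ((q s : ℂ) - z) * u s - w s))
    (h0 : u' 0 = h * u 0) (hL : u' ℓ = -(H * u ℓ)) :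
    z.im * ∫ s in (0 : ℝ)..ℓ, ‖u s‖ ^ 2 = (∫ s in (0 : ℝ)..ℓ, (w s : ℂ) * u s).im := by
  -- The boundary terms vanish because `u` and its conjugate satisfy the same real boundary
  -- conditions.
  have h1 := lagrange_identity hℓ hu hu' hu.conj hu'.conj
  have huc : ContinuousOn u (Set.uIcc 0 ℓ) := by rw [Set.uIcc_of_le hℓ]; exact hu.continuousOn
  have hwc : ContinuousOn (fun s => (w s : ℂ)) (Set.uIcc 0 ℓ) := by
    rw [Set.uIcc_of_le hℓ]; exact Complex.continuous_ofReal.comp_continuousOn hw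
  have hwu : IntervalIntegrable (fun s => (w s : ℂ) * u s) volume 0 ℓ := (hwc.mul huc).intervalIntegrable
  have hwu' : IntervalIntegrable (fun s => starRingEnd ℂ ((w s : ℂ) * u s)) volume 0 ℓ :=
    (Complex.continuous_conj.comp_continuousOn (hwc.mul huc)).intervalIntegrable
  have huu : IntervalIntegrable (fun s => ((‖u s‖ ^ 2 : ℝ) : ℂ)) volume 0 ℓ :=
    (Complex.continuous_ofReal.comp_continuousOn (huc.norm.pow 2)).intervalIntegrable
  have e : ∀ s, (((q s : ℂ) - z) * u s - w s) * starRingEnd ℂ (u s)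
      - u s * starRingEnd ℂ (((q s : ℂ) - z) * u s - w s)
      = (starRingEnd ℂ z - z) * ((‖u s‖ ^ 2 : ℝ) : ℂ)
        - (starRingEnd ℂ ((w s : ℂ) * u s) - (w s : ℂ) * u s) := fun s => by
    rw [← Complex.normSq_eq_norm_sq, ← Complex.mul_conj]
    simp only [map_sub, map_mul, Complex.conj_ofReal]
    ring
  simp only [e] at h1
  rw [intervalIntegral.integral_sub (huu.const_mul _) (hwu'.sub hwu),
    intervalIntegral.integral_const_mul, intervalIntegral.integral_sub hwu' hwu,
    intervalIntegral.intervalIntegral_conj, intervalIntegral.integral_ofReal, h0, hL] at h1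
  simp only [map_mul, map_neg, Complex.conj_ofReal] at h1
  have h2 := congrArg Complex.im h1
  simp only [Complex.sub_im, Complex.mul_im, Complex.sub_re, Complex.conj_im, Complex.conj_re,
    Complex.ofReal_im, Complex.ofReal_re, Complex.neg_im, Complex.neg_re, Complex.mul_re] at h2
  linarith

/-- A priori bound for the pairing of the resolvent with the right-hand side. -/
theorem abs_im_mul_norm_integral_le (hℓ : 0 ≤ ℓ) {w : ℝ → ℝ} (hw : ContinuousOn w (Set.Icc 0 ℓ))
    {z : ℂ} (hz : z.im ≠ 0) {u : ℝ → ℂ} (hu : ContinuousOn u (Set.Icc 0 ℓ))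
    (hid : z.im * ∫ s in (0 : ℝ)..ℓ, ‖u s‖ ^ 2 = (∫ s in (0 : ℝ)..ℓ, (w s : ℂ) * u s).im) :
    |z.im| * ‖∫ s in (0 : ℝ)..ℓ, (w s : ℂ) * u s‖ ≤ ∫ s in (0 : ℝ)..ℓ, w s ^ 2 := by
  set f := ∫ s in (0 : ℝ)..ℓ, (w s : ℂ) * u s
  set a := |z.im| with ha
  have ha0 : 0 < a := abs_pos.2 hz
  have huc : ContinuousOn u (Set.uIcc 0 ℓ) := by rwa [Set.uIcc_of_le hℓ]
  have hwc : ContinuousOn w (Set.uIcc 0 ℓ) := by rwa [Set.uIcc_of_le hℓ]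
  have iu : IntervalIntegrable (fun s => ‖u s‖ ^ 2) volume 0 ℓ := (huc.norm.pow 2).intervalIntegrable
  have iw : IntervalIntegrable (fun s => w s ^ 2) volume 0 ℓ := (hwc.pow 2).intervalIntegrable
  have hU : a * ∫ s in (0 : ℝ)..ℓ, ‖u s‖ ^ 2 ≤ ‖f‖ := by
    have h0 : 0 ≤ ∫ s in (0 : ℝ)..ℓ, ‖u s‖ ^ 2 :=
      intervalIntegral.integral_nonneg hℓ fun _ _ => by positivity
    rw [← abs_of_nonneg h0, ha, ← abs_mul, hid]
    exact Complex.abs_im_le_norm f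
  -- Young's inequality weighted by `a = |Im z|`, so that the energy identity bounds the second term
  -- by `‖f‖ / 2`, which is absorbed on the left.
  have h1 : ‖f‖ ≤ ∫ s in (0 : ℝ)..ℓ, (1 / (2 * a) * w s ^ 2 + a / 2 * ‖u s‖ ^ 2) := by
    refine intervalIntegral.norm_integral_le_of_norm_le hℓ (Eventually.of_forall fun s _ => ?_)
      ((iw.const_mul _).add (iu.const_mul _))
    rw [norm_mul, Complex.norm_real, Real.norm_eq_abs]
    have h2 : |w s| * ‖u s‖ * (2 * a) ≤ w s ^ 2 + a ^ 2 * ‖u s‖ ^ 2 := by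
      nlinarith [sq_nonneg (|w s| - a * ‖u s‖), sq_abs (w s)]
    have h3 : 1 / (2 * a) * w s ^ 2 + a / 2 * ‖u s‖ ^ 2
        = (w s ^ 2 + a ^ 2 * ‖u s‖ ^ 2) / (2 * a) := by field_simp
    rw [h3, le_div_iff₀ (by positivity)]
    exact h2
  rw [intervalIntegral.integral_add (iw.const_mul _) (iu.const_mul _),
    intervalIntegral.integral_const_mul, intervalIntegral.integral_const_mul] at h1
  have h4 : 1 / (2 * a) * (∫ s in (0 : ℝ)..ℓ, w s ^ 2) * (2 * a) = ∫ s in (0 : ℝ)..ℓ, w s ^ 2 := by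
    field_simp
  have h5 : ‖f‖ / 2 ≤ 1 / (2 * a) * ∫ s in (0 : ℝ)..ℓ, w s ^ 2 := by linarith
  have h6 := mul_le_mul_of_nonneg_right h5 (by positivity : 0 ≤ 2 * a)
  linarith

/-- The eigenfunctions form a complete system. -/
theorem eq_zero_of_orthogonal (hy : IsFundamentalSolution q h ℓ y y') (hℓ : 0 < ℓ)
    (hq : IntervalIntegrable q volume 0 ℓ) (H : ℝ) {w : ℝ → ℝ} (hw : ContinuousOn w (Set.Icc 0 ℓ))
    (horth : ∀ μ : ℝ, charFun ℓ H y y' μ = 0 → ∫ s in (0 : ℝ)..ℓ, (w s : ℂ) * y s μ = 0) :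
    ∀ x ∈ Set.Icc 0 ℓ, w x = 0 := by
  have hℓm : ℓ ∈ Set.Icc 0 ℓ := ⟨hℓ.le, le_rfl⟩
  have hwc : ContinuousOn (fun s => (w s : ℂ)) (Set.uIcc 0 ℓ) := by
    rw [Set.uIcc_of_le hℓ.le]; exact Complex.continuous_ofReal.comp_continuousOn hw
  have iw := hwc.intervalIntegrable (μ := volume)
  have iq := intervalIntegrable_ofReal hq
  have i1 : IntervalIntegrable (fun _ : ℝ => (1 : ℂ)) volume 0 ℓ := intervalIntegrable_const
  obtain ⟨V, hVd, hV⟩ := exists_inhomogeneous_solution hℓ.le hq iw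
  choose v' hv hv' hv0 hv'0 using hV
  have hpair : ∀ {g : ℝ → ℂ} (hg : IntervalIntegrable g volume 0 ℓ),
      Differentiable ℂ fun z => ∫ s in (0 : ℝ)..ℓ, g s * Set.IccExtend hℓ.le (V z) s := fun hg =>
    (weightedIntegral hℓ.le _ hg).differentiable.comp hVd
  have hVc : ∀ z, ContinuousOn (Set.IccExtend hℓ.le (V z)) (Set.uIcc 0 ℓ) := fun z =>
    ((V z).continuous.Icc_extend' (h := hℓ.le)).continuousOn
  have hb : Differentiable ℂ fun z => v' z ℓ + H * Set.IccExtend hℓ.le (V z) ℓ := by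
    have e1 : ∀ z, v' z ℓ = (∫ s in (0 : ℝ)..ℓ, (q s : ℂ) * Set.IccExtend hℓ.le (V z) s)
        - z * (∫ s in (0 : ℝ)..ℓ, 1 * Set.IccExtend hℓ.le (V z) s) - ∫ s in (0 : ℝ)..ℓ, (w s : ℂ) :=
      fun z => by
        rw [(hv' z).eq ℓ hℓm, hv'0, zero_add, ← intervalIntegral.integral_const_mul,
          ← intervalIntegral.integral_sub (iq.mul_continuousOn (hVc z))
            ((i1.mul_continuousOn (hVc z)).const_mul z), ← intervalIntegral.integral_sub
            ((iq.mul_continuousOn (hVc z)).sub ((i1.mul_continuousOn (hVc z)).const_mul z)) iw]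
        congr 1; ext s; ring
    have e2 : ∀ z, Set.IccExtend hℓ.le (V z) ℓ = V z ⟨ℓ, hℓm⟩ := fun z =>
      Set.IccExtend_of_mem hℓ.le _ hℓm
    simp only [e1, e2]
    exact (((hpair iq).sub (differentiable_id.mul (hpair i1))).sub_const _).add
      (((ContinuousMap.evalCLM ℂ (⟨ℓ, hℓm⟩ : Set.Icc (0 : ℝ) ℓ)).differentiable.comp hVd).const_mul _)
  have hΦd : Differentiable ℂ (charFun ℓ H y y') := hy.differentiable_charFun hℓ.le hq
  -- Orthogonality enters only here: `∫ w y(·, z)` vanishes at every zero of `Φ`, so its quotient by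
  -- `Φ` has no poles.
  obtain ⟨Q, hQd, hQ⟩ := exists_entire_quotient (hy.differentiable_integral hℓ.le hq iw) hΦd
    (fun z hz => by
      have him := hy.im_eq_zero_of_charFun_eq_zero hℓ hq hz
      have hzr : z = (z.re : ℂ) := Complex.ext (by simp) (by simpa using him)
      rw [hzr] at hz ⊢
      exact horth _ hz)
    (fun z hz => hy.deriv_charFun_ne_zero hℓ hq hz)
  -- Subtracting `c y(·, z)` from the solution with zero initial data repairs the condition at `ℓ`
  -- and keeps the one at 0; `u` is the resolvent applied to `w`, and its pairing with `w` has the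
  -- displayed entire extension.
  have key : ∀ z : ℂ, z.im ≠ 0 → ∃ u u' : ℝ → ℂ, IsPrimitive ℓ u u' ∧
      IsPrimitive ℓ u' (fun s => ((q s : ℂ) - z) * u s - w s) ∧
      (∫ s in (0 : ℝ)..ℓ, (w s : ℂ) * u s)
        = (∫ s in (0 : ℝ)..ℓ, (w s : ℂ) * Set.IccExtend hℓ.le (V z) s)
          - (v' z ℓ + H * Set.IccExtend hℓ.le (V z) ℓ) * Q z ∧
      z.im * ∫ s in (0 : ℝ)..ℓ, ‖u s‖ ^ 2 = (∫ s in (0 : ℝ)..ℓ, (w s : ℂ) * u s).im := by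
    intro z hz
    have hΦ0 : charFun ℓ H y y' z ≠ 0 := fun h0 => hz (hy.im_eq_zero_of_charFun_eq_zero hℓ hq h0)
    obtain ⟨c, hc⟩ : ∃ c, c * charFun ℓ H y y' z = v' z ℓ + H * Set.IccExtend hℓ.le (V z) ℓ :=
      ⟨_, div_mul_cancel₀ _ hΦ0⟩
    have hu := (hv z).sub ((hy.isPrimitive hℓ.le z).const_mul c)
    have hu' := (hv' z).sub ((hy.isPrimitive_deriv hℓ.le hq z).const_mul c)
    have hu'' := hu'.congr_deriv (g := fun s => ((q s : ℂ) - z)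
      * (Set.IccExtend hℓ.le (V z) s - c * y s z) - w s) hℓ.le (fun s _ => by ring)
    have hyc : ContinuousOn (fun s => y s z) (Set.uIcc 0 ℓ) := by
      rw [Set.uIcc_of_le hℓ.le]; exact hy.continuousOn z
    have i1' : IntervalIntegrable (fun s => (w s : ℂ) * Set.IccExtend hℓ.le (V z) s) volume 0 ℓ :=
      (hwc.mul (hVc z)).intervalIntegrable
    have i2' : IntervalIntegrable (fun s => c * ((w s : ℂ) * y s z)) volume 0 ℓ :=
      ((hwc.mul hyc).intervalIntegrable (μ := volume)).const_mul c
    refine ⟨_, _, hu, hu'', ?_, im_mul_integral_norm_sq hℓ.le hw hu hu'' (h := h) (H := H) ?_ ?_⟩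
    · rw [← hc, mul_assoc, ← hQ, ← intervalIntegral.integral_const_mul,
        ← intervalIntegral.integral_sub i1' i2']
      congr 1; ext s; ring
    · simp only [hv0, hv'0, hy.apply_zero hℓ.le, hy.deriv_apply_zero hℓ.le]; ring
    · simp only [charFun] at hc
      linear_combination -hc
  have hf : ∀ z, (∫ s in (0 : ℝ)..ℓ, (w s : ℂ) * Set.IccExtend hℓ.le (V z) s)
      - (v' z ℓ + H * Set.IccExtend hℓ.le (V z) ℓ) * Q z = 0 := by
    refine eq_zero_of_norm_mul_abs_im_le ((hpair iw).sub (hb.mul hQd))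
      (C := ∫ s in (0 : ℝ)..ℓ, w s ^ 2) fun z => ?_
    by_cases hz : z.im = 0
    · rw [hz, abs_zero, zero_mul]
      exact intervalIntegral.integral_nonneg hℓ.le fun _ _ => by positivity
    · obtain ⟨u, u', hu, -, h1, h2⟩ := key z hz
      have := abs_im_mul_norm_integral_le hℓ.le hw hz hu.continuousOn h2
      rwa [h1] at this
  -- Any nonreal `z` would serve: the pairing vanishes, so the energy identity gives `u = 0`, and
  -- the differential equation then gives `w = 0`.
  obtain ⟨u, u', hu, hu', h1, h2⟩ := key Complex.I (by simp)
  rw [h1, hf, Complex.zero_im, Complex.I_im, one_mul] at h2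
  have hu0 : ∀ x ∈ Set.Icc 0 ℓ, u x = 0 := fun x hx => by
    by_contra hne
    have := intervalIntegral.integral_pos hℓ (hu.continuousOn.norm.pow 2)
      (fun _ _ => sq_nonneg _)
      ⟨x, hx, pow_pos (norm_pos_iff.2 hne) 2⟩
    exact this.ne' h2
  have hu'0 := hu.deriv_eq_zero hℓ hu0 hu'.continuousOn
  have hneg := hu'.congr_deriv (g := fun s => -(w s : ℂ)) hℓ.le (fun s hs => by simp [hu0 s hs])
  intro x hx
  have := hneg.deriv_eq_zero hℓ hu'0
    (Complex.continuous_ofReal.comp_continuousOn hw).neg x hx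
  simpa using this

end IsFundamentalSolution

/-! ### Pointwise eigenfunction expansion. -/

namespace IsFundamentalSolution

variable {q : ℝ → ℝ} {h H ℓ : ℝ} {y y' : ℝ → ℂ → ℂ}

/-- Completeness of the eigenfunctions among complex-valued continuous functions. -/
theorem eq_zero_of_orthogonal_complex (hy : IsFundamentalSolution q h ℓ y y') (hℓ : 0 < ℓ)
    (hq : IntervalIntegrable q volume 0 ℓ) (H : ℝ) {w : ℝ → ℂ} (hw : ContinuousOn w (Set.Icc 0 ℓ))
    (horth : ∀ μ : ℝ, charFun ℓ H y y' μ = 0 → ∫ s in (0 : ℝ)..ℓ, w s * y s μ = 0) :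
    ∀ x ∈ Set.Icc 0 ℓ, w x = 0 := by
  have hwy : ∀ μ : ℝ, IntervalIntegrable (fun s => w s * y s μ) volume 0 ℓ := fun μ =>
    ContinuousOn.intervalIntegrable (by
      rw [Set.uIcc_of_le hℓ.le]; exact hw.mul (hy.continuousOn μ))
  have hwy' : ∀ μ : ℝ, IntervalIntegrable (fun s => starRingEnd ℂ (w s * y s μ)) volume 0 ℓ :=
    fun μ => ContinuousOn.intervalIntegrable (by
      rw [Set.uIcc_of_le hℓ.le]
      exact Complex.continuous_conj.comp_continuousOn (hw.mul (hy.continuousOn μ)))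
  have hreal : ∀ (μ : ℝ) {s : ℝ}, s ∈ Set.Icc 0 ℓ → starRingEnd ℂ (y s μ) = y s μ := fun μ s hs =>
    Complex.conj_eq_iff_re.2 (hy.apply_ofReal hℓ.le hq μ hs)
  have hconj : ∀ μ : ℝ, charFun ℓ H y y' μ = 0 →
      ∫ s in (0 : ℝ)..ℓ, starRingEnd ℂ (w s * y s μ) = 0 := fun μ hμ => by
    rw [intervalIntegral.intervalIntegral_conj, horth μ hμ, map_zero]
  have hre := hy.eq_zero_of_orthogonal hℓ hq H (w := fun s => (w s).re)
    (Complex.continuous_re.comp_continuousOn hw) fun μ hμ => by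
      have : ∫ s in (0 : ℝ)..ℓ, ((w s).re : ℂ) * y s μ
          = ∫ s in (0 : ℝ)..ℓ, 1 / 2 * (w s * y s μ + starRingEnd ℂ (w s * y s μ)) :=
        intervalIntegral.integral_congr fun s hs => by
          rw [Set.uIcc_of_le hℓ.le] at hs
          simp only [map_mul, hreal μ hs, Complex.re_eq_add_conj]
          ring
      rw [this, intervalIntegral.integral_const_mul, intervalIntegral.integral_add (hwy μ) (hwy' μ),
        horth μ hμ, hconj μ hμ]
      simp
  have him := hy.eq_zero_of_orthogonal hℓ hq H (w := fun s => (w s).im)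
    (Complex.continuous_im.comp_continuousOn hw) fun μ hμ => by
      have : ∫ s in (0 : ℝ)..ℓ, ((w s).im : ℂ) * y s μ
          = ∫ s in (0 : ℝ)..ℓ, 1 / (2 * Complex.I) * (w s * y s μ - starRingEnd ℂ (w s * y s μ)) :=
        intervalIntegral.integral_congr fun s hs => by
          rw [Set.uIcc_of_le hℓ.le] at hs
          simp only [map_mul, hreal μ hs, Complex.im_eq_sub_conj]
          ring
      rw [this, intervalIntegral.integral_const_mul, intervalIntegral.integral_sub (hwy μ) (hwy' μ),
        horth μ hμ, hconj μ hμ]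
      simp
  exact fun x hx => Complex.ext (hre x hx) (him x hx)

theorem tendsto_sqrt_eigenvalue (hy : IsFundamentalSolution q h ℓ y y') (hℓ : 0 < ℓ)
    (hq : IntervalIntegrable q volume 0 ℓ) (H : ℝ) :
    Tendsto (fun n => Real.sqrt (eigenvalue (charFun ℓ H y y') n)) atTop atTop := by
  rw [← tendsto_add_atTop_iff_nat 1]
  refine tendsto_atTop_mono' _ ?_ (tendsto_radius hℓ)
  filter_upwards [hy.eventually_eigenvalue_mem hℓ hq H] with n hn
  exact Real.le_sqrt_of_sq_le hn.1

theorem tendsto_eigenvalue (hy : IsFundamentalSolution q h ℓ y y') (hℓ : 0 < ℓ)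
    (hq : IntervalIntegrable q volume 0 ℓ) (H : ℝ) :
    Tendsto (eigenvalue (charFun ℓ H y y')) atTop atTop :=
  tendsto_atTop_mono' _ (by
    filter_upwards [(hy.tendsto_sqrt_eigenvalue hℓ hq H).eventually_ge_atTop 1] with n hn
    have h1 : 0 ≤ eigenvalue (charFun ℓ H y y') n := by
      by_contra! hneg
      rw [Real.sqrt_eq_zero_of_nonpos hneg.le] at hn
      linarith
    nlinarith [Real.sq_sqrt h1]) (hy.tendsto_sqrt_eigenvalue hℓ hq H)

theorem eventually_norm_apply_le (hy : IsFundamentalSolution q h ℓ y y')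
    (hq : IntervalIntegrable q volume 0 ℓ) :
    ∃ C, 0 < C ∧ ∀ᶠ k : ℝ in atTop, ∀ x ∈ Set.Icc 0 ℓ, ‖y x ((k ^ 2 : ℝ) : ℂ)‖ ≤ C ∧
      ‖y x ((k ^ 2 : ℝ) : ℂ) - Complex.cos (k * x)‖ ≤ C / k := by
  obtain ⟨C, K, hC, hK, hb⟩ := hy.exists_asymptotics hq
  refine ⟨C, hC, ?_⟩
  filter_upwards [eventually_ge_atTop K] with k hk x hx
  have hk0 : 0 ≤ k := by linarith
  have hn : ‖(k : ℂ)‖ = k := by rw [Complex.norm_real, Real.norm_of_nonneg hk0]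
  obtain ⟨h1, h2, -⟩ := hb k (by rwa [hn]) x hx
  simp only [Complex.ofReal_im, abs_zero, zero_mul, Real.exp_zero, mul_one, hn] at h1 h2
  push_cast
  exact ⟨h1, h2⟩

theorem integral_cos_mul_sq {k : ℝ} (hk : k ≠ 0) (ℓ : ℝ) :
    ∫ x in (0 : ℝ)..ℓ, Real.cos (k * x) ^ 2 = ℓ / 2 + Real.cos (k * ℓ) * Real.sin (k * ℓ) / (2 * k) := by
  rw [intervalIntegral.integral_comp_mul_left (fun x => Real.cos x ^ 2) hk, integral_cos_sq]
  simp
  field_simp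
  ring

/-- As `y` is within `C/k` of `cos(kx)`, one has `|y|² ≥ cos²(kx)/2 - (C/k)²`, whose integral tends
to `ℓ/4`. -/
theorem eventually_le_integral_norm_sq (hy : IsFundamentalSolution q h ℓ y y') (hℓ : 0 < ℓ)
    (hq : IntervalIntegrable q volume 0 ℓ) :
    ∀ᶠ k : ℝ in atTop, ℓ / 8 ≤ ∫ x in (0 : ℝ)..ℓ, ‖y x ((k ^ 2 : ℝ) : ℂ)‖ ^ 2 := by
  obtain ⟨C, hC, hb⟩ := hy.eventually_norm_apply_le hq
  have hinv : Tendsto (fun k : ℝ => ℓ / 4 - (1 / 4 * k⁻¹ + ℓ * C ^ 2 * (k⁻¹ * k⁻¹))) atTop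
      (𝓝 (ℓ / 4 - (1 / 4 * 0 + ℓ * C ^ 2 * (0 * 0)))) :=
    tendsto_const_nhds.sub ((tendsto_inv_atTop_zero.const_mul _).add
      ((tendsto_inv_atTop_zero.mul tendsto_inv_atTop_zero).const_mul _))
  filter_upwards [hb, eventually_gt_atTop 0, hinv.eventually_const_le
    (show ℓ / 8 < _ by linarith)] with k hk hk0 hlim
  have hyc : ContinuousOn (fun x => ‖y x ((k ^ 2 : ℝ) : ℂ)‖ ^ 2) (Set.uIcc 0 ℓ) := by
    rw [Set.uIcc_of_le hℓ.le]; exact (hy.continuousOn _).norm.pow 2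
  have hcos : Continuous fun x : ℝ => Real.cos (k * x) ^ 2 / 2 - (C / k) ^ 2 := by fun_prop
  have hcos' : IntervalIntegrable (fun x : ℝ => Real.cos (k * x) ^ 2 / 2) volume 0 ℓ :=
    Continuous.intervalIntegrable (by fun_prop) _ _
  have hmono := intervalIntegral.integral_mono_on hℓ.le (hcos.intervalIntegrable 0 ℓ)
    hyc.intervalIntegrable (μ := volume) fun x hx => by
      have h1 := (hk x hx).2
      set a := ‖y x ((k ^ 2 : ℝ) : ℂ)‖
      have h2 : |Real.cos (k * x)| ≤ a + C / k := by
        have := norm_sub_norm_le (Complex.cos (k * x)) (y x ((k ^ 2 : ℝ) : ℂ))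
        rw [norm_sub_rev, ← Complex.ofReal_mul, ← Complex.ofReal_cos, Complex.norm_real,
          Real.norm_eq_abs] at this
        rw [← Complex.ofReal_mul, ← Complex.ofReal_cos] at h1
        linarith
      have h3 : 0 ≤ a := norm_nonneg _
      have h4 : Real.cos (k * x) ^ 2 ≤ (a + C / k) ^ 2 := by
        rw [← sq_abs]; exact pow_le_pow_left₀ (abs_nonneg _) h2 2
      nlinarith [sq_nonneg (a - C / k)]
  refine le_trans ?_ hmono
  rw [intervalIntegral.integral_sub hcos' intervalIntegrable_const,
    intervalIntegral.integral_div, integral_cos_mul_sq hk0.ne', intervalIntegral.integral_const]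
  have h5 : -1 ≤ Real.cos (k * ℓ) * Real.sin (k * ℓ) := by
    nlinarith [Real.cos_sq_add_sin_sq (k * ℓ), sq_nonneg (Real.cos (k * ℓ) + Real.sin (k * ℓ))]
  have h6 : -1 / (2 * k) ≤ Real.cos (k * ℓ) * Real.sin (k * ℓ) / (2 * k) := by gcongr
  have h7 : -1 / (2 * k) = -(1 / 2) * k⁻¹ := by field_simp
  have h8 : (ℓ - 0) • (C / k) ^ 2 = ℓ * C ^ 2 * (k⁻¹ * k⁻¹) := by
    simp only [smul_eq_mul]; field_simp; ring
  rw [h8]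
  linarith

/-- The eigenfunction expansion of a continuous function whose Fourier coefficients are
absolutely summable. -/
theorem hasSum_eigenfunction_expansion (hy : IsFundamentalSolution q h ℓ y y') (hℓ : 0 < ℓ)
    (hq : IntervalIntegrable q volume 0 ℓ) (H : ℝ) {lam : ℕ → ℝ}
    (hlam : lam = eigenvalue (charFun ℓ H y y')) {w : ℝ → ℂ} (hw : ContinuousOn w (Set.Icc 0 ℓ))
    (hs : Summable fun n => ‖∫ s in (0 : ℝ)..ℓ, w s * y s (lam n)‖) {x : ℝ}
    (hx : x ∈ Set.Icc 0 ℓ) :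
    HasSum (fun n => (∫ s in (0 : ℝ)..ℓ, w s * y s (lam n))
      / ((∫ s in (0 : ℝ)..ℓ, ‖y s (lam n)‖ ^ 2 : ℝ) : ℂ) * y x (lam n)) (w x) := by
  have hfin := hy.finite_real_zeros hℓ hq H
  have hinf := hy.infinite_real_zeros hℓ hq H
  have hzero : ∀ n, charFun ℓ H y y' (lam n) = 0 := fun n => by
    rw [hlam]; exact charFun_eigenvalue hfin hinf n
  have hinj : Function.Injective lam := by rw [hlam]; exact (strictMono_eigenvalue hfin hinf).injective
  set b := fun n => ∫ s in (0 : ℝ)..ℓ, w s * y s (lam n) with hb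
  set N := fun n => ∫ s in (0 : ℝ)..ℓ, ‖y s (lam n)‖ ^ 2 with hN
  have hN0 : ∀ n, 0 < N n := fun n => hy.integral_norm_sq_pos hℓ _
  let Y : ℕ → C(Set.Icc (0 : ℝ) ℓ, ℂ) := fun n => solve hℓ.le hq (lam n) (affineIcc ℓ 1 h)
  have hY : ∀ n (x : Set.Icc (0 : ℝ) ℓ), Y n x = y x (lam n) := fun n => hy.eq_solve hℓ.le hq _
  -- Convergence in the sup norm: for large `n` the eigenfunctions are uniformly bounded and the
  -- norming constants are at least `ℓ/8`, so the coefficients `b n` control the series.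
  have hsum : Summable fun n => (b n / (N n : ℂ)) • Y n := by
    obtain ⟨C, hC, hle⟩ := hy.eventually_norm_apply_le hq
    have hk : Tendsto (fun n => Real.sqrt (lam n)) atTop atTop := by
      rw [hlam]; exact hy.tendsto_sqrt_eigenvalue hℓ hq H
    have hpos : ∀ᶠ n in atTop, 0 < lam n := by
      rw [hlam]; exact (hy.tendsto_eigenvalue hℓ hq H).eventually_gt_atTop 0
    refine Summable.of_norm_bounded_eventually_nat (hs.mul_right (8 / ℓ * C)) ?_
    filter_upwards [hk.eventually hle, hk.eventually (hy.eventually_le_integral_norm_sq hℓ hq), hpos]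
      with n h1 h2 h3
    rw [Real.sq_sqrt h3.le] at h1 h2
    have hYn : ‖Y n‖ ≤ C := (ContinuousMap.norm_le _ hC.le).2 fun x => by
      rw [hY]; exact (h1 x x.2).1
    rw [norm_smul, norm_div, Complex.norm_real, Real.norm_of_nonneg (hN0 n).le, div_mul_eq_mul_div,
      mul_comm (8 / ℓ), ← mul_assoc, ← mul_div_assoc]
    rw [div_le_div_iff₀ (hN0 n) hℓ]
    have h4 : ‖b n‖ * ‖Y n‖ ≤ ‖b n‖ * C := by gcongr
    have h5 : ℓ ≤ 8 * N n := by linarith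
    calc ‖b n‖ * ‖Y n‖ * ℓ ≤ ‖b n‖ * C * (8 * N n) := by gcongr
      _ = ‖b n‖ * C * 8 * N n := by ring
  set S := ∑' n, (b n / (N n : ℂ)) • Y n with hS
  have hc : ∀ μ : ℝ, ContinuousOn (fun s => y s μ) (Set.uIcc 0 ℓ) := fun μ => by
    rw [Set.uIcc_of_le hℓ.le]; exact hy.continuousOn μ
  have hpair : ∀ m, ∫ s in (0 : ℝ)..ℓ, y s (lam m) * Set.IccExtend hℓ.le S s = b m := fun m => by
    have i := (hc (lam m)).intervalIntegrable (μ := volume)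
    have h1 := hsum.hasSum.mapL (weightedIntegral hℓ.le _ i)
    have h2 : ∀ n, n ≠ m → weightedIntegral hℓ.le _ i ((b n / (N n : ℂ)) • Y n) = 0 := fun n hn => by
      rw [map_smul, weightedIntegral_apply hℓ.le _ i (g := fun s => y s (lam n)) (hY n),
        hy.integral_mul_eq_zero hℓ.le hq (hzero m) (hzero n), smul_zero]
      exact fun h => hn (hinj (Complex.ofReal_injective h)).symm
    have h3 := h1.unique (hasSum_single m h2)
    rw [map_smul, weightedIntegral_apply hℓ.le _ i (g := fun s => y s (lam m)) (hY m),
      ← hy.integral_norm_sq_ofReal hℓ.le hq, smul_eq_mul,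
      div_mul_cancel₀ _ (Complex.ofReal_ne_zero.2 (hN0 m).ne')] at h3
    rw [← h3, weightedIntegral_apply hℓ.le _ i (g := Set.IccExtend hℓ.le S)]
    exact fun x => (Set.IccExtend_of_mem hℓ.le S x.2).symm
  have hSc : ContinuousOn (Set.IccExtend hℓ.le S) (Set.Icc 0 ℓ) :=
    (S.continuous.Icc_extend' (h := hℓ.le)).continuousOn
  -- The continuous sum `S` has the same coefficients as `w`, so completeness identifies the two.
  have hz := hy.eq_zero_of_orthogonal_complex hℓ hq H (hw.sub hSc) (fun μ hμ => by
    obtain ⟨m, hm⟩ := exists_eigenvalue_eq hfin hinf hμ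
    rw [← hlam] at hm
    have i1 : IntervalIntegrable (fun s => w s * y s μ) volume 0 ℓ :=
      ContinuousOn.intervalIntegrable (by
        rw [Set.uIcc_of_le hℓ.le]; exact hw.mul (hy.continuousOn μ))
    have i2 : IntervalIntegrable (fun s => y s μ * Set.IccExtend hℓ.le S s) volume 0 ℓ :=
      ContinuousOn.intervalIntegrable (by
        rw [Set.uIcc_of_le hℓ.le]; exact (hy.continuousOn μ).mul hSc)
    have : ∫ s in (0 : ℝ)..ℓ, (w s - Set.IccExtend hℓ.le S s) * y s μ
        = ∫ s in (0 : ℝ)..ℓ, (w s * y s μ - y s μ * Set.IccExtend hℓ.le S s) := by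
      congr 1; ext s; ring
    refine this.trans ?_
    rw [intervalIntegral.integral_sub i1 i2, ← hm, hpair m, sub_self]) x hx
  have h1 := hsum.hasSum.mapL (ContinuousMap.evalCLM ℂ (⟨x, hx⟩ : Set.Icc (0 : ℝ) ℓ))
  have h2 : w x = S ⟨x, hx⟩ := by
    rw [Pi.sub_apply, Set.IccExtend_of_mem hℓ.le S hx, sub_eq_zero] at hz
    exact hz
  rw [h2]
  refine h1.congr_fun fun n => ?_
  change _ = (b n / (N n : ℂ)) * Y n ⟨x, hx⟩
  rw [hY]

end IsFundamentalSolution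

/-! ### Time evolution of a mode and coefficients of the initial velocity. -/

section Oscillator

variable {c d : ℝ → ℂ} {k : ℂ}

theorem eq_of_hasDerivWithinAt_zero {F : ℝ → ℂ} {t : ℝ} (ht : 0 ≤ t)
    (hF : ∀ τ, 0 ≤ τ → HasDerivWithinAt F 0 (Set.Ici 0) τ) : F t = F 0 :=
  constant_of_has_deriv_right_zero
    (fun τ hτ => ((hF τ hτ.1).continuousWithinAt).mono fun _ hx => hx.1)
    (fun τ hτ => (hF τ hτ.1).mono (Set.Ici_subset_Ici.2 hτ.1)) t ⟨ht, le_rfl⟩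

/-- The solution of `c'' = -k² c` with `c (0) = 0`. -/
theorem mul_eq_mul_sin (hc : ∀ t, 0 ≤ t → HasDerivWithinAt c (d t) (Set.Ici 0) t)
    (hd : ∀ t, 0 ≤ t → HasDerivWithinAt d (-(k ^ 2 * c t)) (Set.Ici 0) t) (h0 : c 0 = 0)
    {t : ℝ} (ht : 0 ≤ t) : k * c t = d 0 * Complex.sin (t * k) := by
  -- This combination is constant in `τ`: it equals `k c(t)` at `τ = t` and, since `c(0) = 0`, `d(0)
  -- sin(tk)` at `τ = 0`.
  have key := eq_of_hasDerivWithinAt_zero ht (F := fun τ =>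
    c τ * (k * Complex.cos ((t - τ) * k)) + d τ * Complex.sin ((t - τ) * k)) fun τ hτ => by
      have h1 : HasDerivAt (fun τ : ℝ => ((t : ℂ) - τ) * k) (-k) τ := by
        simpa using ((Complex.ofRealCLM.hasDerivAt (x := τ)).const_sub (t : ℂ)).mul_const k
      have h2 := ((Complex.hasDerivAt_cos _).comp τ h1).hasDerivWithinAt (s := Set.Ici 0)
      have h3 := ((Complex.hasDerivAt_sin _).comp τ h1).hasDerivWithinAt (s := Set.Ici 0)
      refine (((hc τ hτ).mul (h2.const_mul k)).add ((hd τ hτ).mul h3)).congr_deriv ?_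
      simp only [Function.comp]
      ring
  simpa [h0, mul_comm (c t)] using key

/-- The case of zero frequency. -/
theorem eq_mul_of_hasDerivWithinAt_zero (hc : ∀ t, 0 ≤ t → HasDerivWithinAt c (d t) (Set.Ici 0) t)
    (hd : ∀ t, 0 ≤ t → HasDerivWithinAt d 0 (Set.Ici 0) t) (h0 : c 0 = 0)
    {t : ℝ} (ht : 0 ≤ t) : c t = d 0 * t := by
  have hd0 : ∀ τ, 0 ≤ τ → d τ = d 0 := fun τ hτ => eq_of_hasDerivWithinAt_zero hτ hd
  have key := eq_of_hasDerivWithinAt_zero ht (F := fun τ => c τ - d 0 * τ) fun τ hτ => by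
    have h1 := ((Complex.ofRealCLM.hasDerivAt (x := τ)).const_mul (d 0)).hasDerivWithinAt
      (s := Set.Ici 0)
    refine ((hc τ hτ).sub h1).congr_deriv ?_
    rw [hd0 τ hτ]; simp
  simpa [h0, sub_eq_zero] using key

end Oscillator

section InitialVelocity

variable {ε : ℝ} {K : ℝ → ℝ → ℝ}

theorem mul_integral_sq_mul_cos (ε : ℝ) (k : ℂ) :
    k ^ 3 * ∫ x in (0 : ℝ)..ε, ((x : ℂ) - ε) ^ 2 * Complex.cos (x * k)
      = 2 * (ε * k - Complex.sin (ε * k)) := by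
  rw [← intervalIntegral.integral_const_mul,
    intervalIntegral.integral_eq_sub_of_hasDerivAt (f := fun x : ℝ =>
      k ^ 2 * (((x : ℂ) - ε) ^ 2 * Complex.sin (x * k))
        + 2 * k * (((x : ℂ) - ε) * Complex.cos (x * k)) - 2 * Complex.sin (x * k))]
  · simp; ring
  · intro x _
    have h0 : HasDerivAt (fun x : ℝ => (x : ℂ)) 1 x := Complex.ofRealCLM.hasDerivAt
    have h1 : HasDerivAt (fun x : ℝ => (x : ℂ) * k) k x := by simpa using h0.mul_const k
    have h2 := (Complex.hasDerivAt_cos _).comp x h1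
    have h3 := (Complex.hasDerivAt_sin _).comp x h1
    have h4 := h0.sub_const (ε : ℂ)
    refine (((((h4.pow 2).mul h3).const_mul (k ^ 2)).add ((h4.mul h2).const_mul (2 * k))).sub
      (h3.const_mul 2)).congr_deriv ?_
    simp only [Function.comp, Pi.pow_apply]
    push_cast
    ring
  · exact Continuous.intervalIntegrable (by fun_prop) _ _

theorem integral_sq_sub (ε : ℝ) :
    ∫ x in (0 : ℝ)..ε, ((x : ℂ) - ε) ^ 2 = (ε : ℂ) ^ 3 / 3 := by
  rw [intervalIntegral.integral_eq_sub_of_hasDerivAt (f := fun x : ℝ => ((x : ℂ) - ε) ^ 3 / 3)]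
  · simp; ring
  · intro x _
    have h4 := (Complex.ofRealCLM.hasDerivAt (x := x)).sub_const (ε : ℂ)
    refine ((h4.pow 3).div_const 3).congr_deriv ?_
    simp
  · exact Continuous.intervalIntegrable (by fun_prop) _ _

/-- Provides the hypothesis of Fubini's theorem: the kernel is controlled only on the closed
triangle, which is compact. -/
theorem IsTransmutationKernel.integrable_indicator {y : ℝ → ℂ → ℂ}
    (hK : IsTransmutationKernel ε y K) {ψ φ : ℝ → ℂ} (hψ : ContinuousOn ψ (Set.Icc 0 ε))
    (hφ : ContinuousOn φ (Set.Icc 0 ε)) :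
    Integrable ({p : ℝ × ℝ | p.2 ≤ p.1}.indicator (fun p => ψ p.1 * (K p.1 p.2 * φ p.2)))
      ((volume.restrict (Set.Ioc 0 ε)).prod (volume.restrict (Set.Ioc 0 ε))) := by
  set T : Set (ℝ × ℝ) := {p | 0 ≤ p.2 ∧ p.2 ≤ p.1 ∧ p.1 ≤ ε} with hT
  have hTsub : T ⊆ Set.Icc 0 ε ×ˢ Set.Icc 0 ε := fun p hp =>
    ⟨⟨hp.1.trans hp.2.1, hp.2.2⟩, ⟨hp.1, hp.2.1.trans hp.2.2⟩⟩
  have hTc : IsClosed T := by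
    refine IsClosed.inter (isClosed_le continuous_const continuous_snd)
      (IsClosed.inter (isClosed_le continuous_snd continuous_fst)
        (isClosed_le continuous_fst continuous_const))
  have hTk : IsCompact T := (isCompact_Icc.prod isCompact_Icc).of_isClosed_subset hTc hTsub
  have hcont : ContinuousOn (fun p : ℝ × ℝ => ψ p.1 * (K p.1 p.2 * φ p.2)) T :=
    (hψ.comp continuousOn_fst fun p hp => (hTsub hp).1).mul
      ((Complex.continuous_ofReal.comp_continuousOn hK.continuousOn).mul
        (hφ.comp continuousOn_snd fun p hp => (hTsub hp).2))
  rw [integrable_indicator_iff (measurableSet_le measurable_snd measurable_fst),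
    Measure.prod_restrict, IntegrableOn, Measure.restrict_restrict
      (measurableSet_le measurable_snd measurable_fst)]
  exact (hcont.integrableOn_compact hTk (μ := volume)).mono_set fun p hp =>
    ⟨hp.2.2.1.le, hp.1, hp.2.1.2⟩

/-- The transmutation operator turns the Fourier coefficients of the initial velocity into those
of `(x - ε)²` with respect to the cosines. -/
theorem IsFundamentalSolution.integral_initialVelocity_mul {q : ℝ → ℝ} {h ℓ : ℝ}
    {y y' : ℝ → ℂ → ℂ} (hy : IsFundamentalSolution q h ℓ y y') (hε : 0 < ε) (hεℓ : ε ≤ ℓ)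
    (hK : IsTransmutationKernel ε y K) (z : ℂ) :
    ∫ x in (0 : ℝ)..ℓ, (initialVelocity ε K x : ℂ) * y x z
      = ∫ x in (0 : ℝ)..ε, ((x : ℂ) - ε) ^ 2 * Complex.cos (x * csqrt z) := by
  have hyc : ContinuousOn (fun x => y x z) (Set.Icc 0 ε) :=
    (hy.continuousOn z).mono (Set.Icc_subset_Icc_right hεℓ)
  have hψ : ContinuousOn (fun x : ℝ => ((x : ℂ) - ε) ^ 2) (Set.Icc 0 ε) :=
    Continuous.continuousOn (by fun_prop)
  have hint := hK.integrable_indicator hψ hyc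
  -- The initial velocity is the transpose of the transmutation operator applied to `ψ(x) = (x -
  -- ε)²`; exchanging the integrals moves the operator onto `y`, which it turns into the cosine.
  have hswap := integral_triangle_swap
    (fun x t => ((x : ℂ) - ε) ^ 2 * (K x t * y t z)) hε.le hint
  have e1 : ∫ x in (0 : ℝ)..ℓ, (initialVelocity ε K x : ℂ) * y x z
      = ∫ x in (0 : ℝ)..ε, (((x : ℂ) - ε) ^ 2 * y x z
        + ∫ t in x..ε, ((t : ℂ) - ε) ^ 2 * (K t x * y x z)) := by
    rw [intervalIntegral.integral_of_le (hε.le.trans hεℓ), intervalIntegral.integral_of_le hε.le,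
      integral_Ioc_eq_integral_Ioo, integral_Ioc_eq_integral_Ioo]
    have : ∀ x, (initialVelocity ε K x : ℂ) * y x z = (Set.Ioo 0 ε).indicator
        (fun x => ((x : ℂ) - ε) ^ 2 * y x z
          + ∫ t in x..ε, ((t : ℂ) - ε) ^ 2 * (K t x * y x z)) x := fun x => by
      rw [initialVelocity]
      by_cases hx : x ∈ Set.Ioo 0 ε
      · rw [Set.indicator_of_mem hx, Set.indicator_of_mem hx]
        push_cast
        rw [add_mul, ← intervalIntegral.integral_ofReal, ← intervalIntegral.integral_mul_const]
        congr 2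
        ext t; push_cast; ring
      · simp [Set.indicator_of_notMem hx]
    simp only [this]
    rw [setIntegral_indicator measurableSet_Ioo, Set.inter_eq_right.2 (Set.Ioo_subset_Ioo_right hεℓ)]
  have e2 : ∫ x in (0 : ℝ)..ε, ((x : ℂ) - ε) ^ 2 * Complex.cos (x * csqrt z)
      = ∫ x in (0 : ℝ)..ε, (((x : ℂ) - ε) ^ 2 * y x z
        + ∫ t in (0 : ℝ)..x, ((x : ℂ) - ε) ^ 2 * (K x t * y t z)) := by
    rw [intervalIntegral.integral_of_le hε.le, intervalIntegral.integral_of_le hε.le,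
      integral_Ioc_eq_integral_Ioo, integral_Ioc_eq_integral_Ioo]
    refine setIntegral_congr_fun measurableSet_Ioo fun x hx => ?_
    simp only [hK.eq z x hx, mul_add, intervalIntegral.integral_const_mul]
  have i0 : IntervalIntegrable (fun x : ℝ => ((x : ℂ) - ε) ^ 2 * y x z) volume 0 ε :=
    ContinuousOn.intervalIntegrable (by rw [Set.uIcc_of_le hε.le]; exact hψ.mul hyc)
  rw [e1, e2, intervalIntegral.integral_add i0 ?_, intervalIntegral.integral_add i0 ?_, hswap]
  · rw [intervalIntegrable_iff_integrableOn_Ioc_of_le hε.le]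
    refine hint.integral_prod_left.congr ?_
    filter_upwards [ae_restrict_mem measurableSet_Ioc] with s hs
    exact integral_indicator_triangle_right
      (fun x t => ((x : ℂ) - ε) ^ 2 * (K x t * y t z)) hs
  · rw [intervalIntegrable_iff_integrableOn_Ioc_of_le hε.le]
    refine hint.integral_prod_right.congr ?_
    filter_upwards [ae_restrict_mem measurableSet_Ioc] with t ht
    exact integral_indicator_triangle_left
      (fun x t => ((x : ℂ) - ε) ^ 2 * (K x t * y t z)) ht

end InitialVelocity

/-! ### The weak solution and its boundary trace. -/

theorem IsH1.isPrimitive {ℓ : ℝ} (hℓ : 0 ≤ ℓ) {v v' : ℝ → ℝ} (hv : IsH1 ℓ v v') :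
    IsPrimitive ℓ (fun x => (v x : ℂ)) (fun x => (v' x : ℂ)) :=
  ⟨intervalIntegrable_ofReal ((intervalIntegrable_iff_integrableOn_Ioc_of_le hℓ).2
    (hv.1.integrable one_le_two)), fun x hx => by
    rw [hv.2 x hx, intervalIntegral.integral_ofReal, Complex.ofReal_add]⟩

theorem norm_traceNumerator_le {ε t μ : ℝ} (hε : 0 ≤ ε) (hμ : 1 ≤ μ) :
    ‖traceNumerator ε t μ‖ ≤ 2 * (1 + ε) / μ := by
  have hμ0 : 0 < μ := by linarith
  -- Only the reality of the root is needed, so that the sines are bounded by 1; its sign is left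
  -- open.
  obtain ⟨r, hr, hr2⟩ : ∃ r : ℝ, csqrt μ = r ∧ r ^ 2 = μ := by
    have hs := Real.sq_sqrt hμ0.le
    have h1 := csqrt_pow_two (Real.sqrt μ)
    rw [← Complex.ofReal_pow, hs] at h1
    rcases h1 with h1 | h1
    · exact ⟨_, h1, hs⟩
    · exact ⟨-Real.sqrt μ, by rw [h1, Complex.ofReal_neg], by rw [neg_sq, hs]⟩
  have hrμ : |r| ≤ μ := by
    rw [← sq_abs] at hr2
    nlinarith [abs_nonneg r]
  rw [traceNumerator, if_neg hμ0.ne', hr]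
  have e : 2 * (Complex.sin (ε * r) - ε * r) / (μ : ℂ) ^ 2 * Complex.sin (t * r)
      = ((2 * (Real.sin (ε * r) - ε * r) / μ ^ 2 * Real.sin (t * r) : ℝ) : ℂ) := by push_cast; rfl
  rw [e, Complex.norm_real, Real.norm_eq_abs, abs_mul, abs_div, abs_mul, abs_two,
    abs_of_pos (pow_pos hμ0 2)]
  have h1 : |Real.sin (ε * r) - ε * r| ≤ 1 + ε * |r| := by
    refine (abs_sub _ _).trans (add_le_add (Real.abs_sin_le_one _) ?_)
    rw [abs_mul, abs_of_nonneg hε]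
  have h2 : 1 + ε * |r| ≤ (1 + ε) * μ := by nlinarith
  calc 2 * |Real.sin (ε * r) - ε * r| / μ ^ 2 * |Real.sin (t * r)|
      ≤ 2 * ((1 + ε) * μ) / μ ^ 2 * 1 := by
        gcongr
        · exact h1.trans h2
        · exact Real.abs_sin_le_one _
    _ = 2 * (1 + ε) / μ := by field_simp

namespace IsFundamentalSolution

variable {q : ℝ → ℝ} {h H ℓ : ℝ} {y y' : ℝ → ℂ → ℂ}

/-- Admits the eigenfunctions as test functions in the weak formulation. -/
theorem isH1 (hy : IsFundamentalSolution q h ℓ y y') (hℓ : 0 ≤ ℓ)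
    (hq : IntervalIntegrable q volume 0 ℓ) (μ : ℝ) :
    IsH1 ℓ (fun x => (y x μ).re) (fun x => (y' x μ).re) := by
  have hc : ContinuousOn (fun x => (y' x μ).re) (Set.Icc 0 ℓ) :=
    Complex.continuous_re.comp_continuousOn (hy.continuousOn_deriv μ)
  refine ⟨(memLp_two_iff_integrable_sq ((hc.mono Set.Ioc_subset_Icc_self).aestronglyMeasurable
    measurableSet_Ioc)).2 ?_, fun x hx => ?_⟩
  · exact ((hc.pow 2).integrableOn_Icc).mono_set Set.Ioc_subset_Icc_self
  · have h0 : (0 : ℝ) ∈ Set.Icc 0 ℓ := ⟨le_rfl, hℓ⟩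
    refine Complex.ofReal_injective ?_
    rw [Complex.ofReal_add, ← intervalIntegral.integral_ofReal, hy.apply_ofReal hℓ hq μ hx,
      hy.apply_ofReal hℓ hq μ h0, (hy.isPrimitive hℓ μ).eq x hx]
    congr 1
    refine intervalIntegral.integral_congr fun s hs => ?_
    rw [Set.uIcc_of_le hx.1] at hs
    exact (hy.deriv_apply_ofReal hℓ hq μ ⟨hs.1, hs.2.trans hx.2⟩).symm

theorem ofReal_integral_mul_re (hy : IsFundamentalSolution q h ℓ y y') (hℓ : 0 ≤ ℓ)
    (hq : IntervalIntegrable q volume 0 ℓ) (μ : ℝ) (v : ℝ → ℝ) :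
    ((∫ x in (0 : ℝ)..ℓ, v x * (y x μ).re : ℝ) : ℂ) = ∫ x in (0 : ℝ)..ℓ, (v x : ℂ) * y x μ := by
  rw [← intervalIntegral.integral_ofReal]
  refine intervalIntegral.integral_congr fun s hs => ?_
  rw [Set.uIcc_of_le hℓ] at hs
  simp only [Complex.ofReal_mul, hy.apply_ofReal hℓ hq μ hs]

/-- Green's formula: an eigenfunction is an eigenvector of the energy form. -/
theorem energyForm_eq (hy : IsFundamentalSolution q h ℓ y y') (hℓ : 0 ≤ ℓ)
    (hq : IntervalIntegrable q volume 0 ℓ) {μ : ℝ} (hμ : charFun ℓ H y y' μ = 0)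
    {v v' : ℝ → ℝ} (hv : IsH1 ℓ v v') :
    energyForm q h H ℓ v v' (fun x => (y x μ).re) (fun x => (y' x μ).re)
      = μ * ∫ x in (0 : ℝ)..ℓ, v x * (y x μ).re := by
  have hvp := hv.isPrimitive hℓ
  have hvc : ContinuousOn (fun x => (v x : ℂ)) (Set.uIcc 0 ℓ) := by
    rw [Set.uIcc_of_le hℓ]; exact hvp.continuousOn
  have hyc : ContinuousOn (fun x => y x μ) (Set.uIcc 0 ℓ) := by
    rw [Set.uIcc_of_le hℓ]; exact hy.continuousOn μ
  have hyc' : ContinuousOn (fun x => y' x μ) (Set.uIcc 0 ℓ) := by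
    rw [Set.uIcc_of_le hℓ]; exact hy.continuousOn_deriv μ
  have hp := hy.isPrimitive_deriv hℓ hq μ
  have hmul := hp.mul hℓ hvp
  have i1 : IntervalIntegrable (fun x => ((q x : ℂ) - μ) * y x μ * v x + y' x μ * v' x) volume 0 ℓ :=
    (hp.integrable.mul_continuousOn hvc).add (hvp.integrable.continuousOn_mul hyc')
  have i2 : IntervalIntegrable (fun x => (μ : ℂ) * ((v x : ℂ) * y x μ)) volume 0 ℓ :=
    ((hvc.mul hyc).intervalIntegrable (μ := volume)).const_mul _
  have e : ((∫ x in (0 : ℝ)..ℓ, (v' x * (y' x μ).re + q x * v x * (y x μ).re) : ℝ) : ℂ)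
      = ∫ x in (0 : ℝ)..ℓ, ((((q x : ℂ) - μ) * y x μ * v x + y' x μ * v' x)
        + (μ : ℂ) * ((v x : ℂ) * y x μ)) := by
    rw [← intervalIntegral.integral_ofReal]
    refine intervalIntegral.integral_congr fun s hs => ?_
    rw [Set.uIcc_of_le hℓ] at hs
    simp only [Complex.ofReal_add, Complex.ofReal_mul, hy.apply_ofReal hℓ hq μ hs,
      hy.deriv_apply_ofReal hℓ hq μ hs]
    ring
  refine Complex.ofReal_injective ?_
  rw [energyForm]
  push_cast
  rw [e, intervalIntegral.integral_add i1 i2, hmul, intervalIntegral.integral_const_mul,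
    hy.ofReal_integral_mul_re hℓ hq, hy.apply_ofReal hℓ hq μ ⟨le_rfl, hℓ⟩,
    hy.apply_ofReal hℓ hq μ ⟨hℓ, le_rfl⟩, hy.apply_zero hℓ, hy.deriv_apply_zero hℓ]
  -- The terms at 0 have cancelled through `y'(0) = h`; those at `ℓ` combine to `v(ℓ) Φ(μ) = 0`.
  rw [charFun] at hμ
  linear_combination (v ℓ : ℂ) * hμ

/-- The Fourier coefficients of the weak solution. -/
theorem integral_weakSolution_mul (hy : IsFundamentalSolution q h ℓ y y') {ε : ℝ} (hε : 0 < ε)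
    (hεℓ : ε ≤ ℓ) (hq : IntervalIntegrable q volume 0 ℓ) {μ : ℝ} (hμ : charFun ℓ H y y' μ = 0)
    {K : ℝ → ℝ → ℝ} (hK : IsTransmutationKernel ε y K) {u : ℝ → ℝ → ℝ}
    (hu : IsWeakSolution q h H ℓ (fun _ => 0) (initialVelocity ε K) u) {t : ℝ} (ht : 0 ≤ t) :
    ∫ x in (0 : ℝ)..ℓ, (u x t : ℂ) * y x μ = -traceNumerator ε t μ := by
  have hℓ : 0 ≤ ℓ := hε.le.trans hεℓ
  obtain ⟨ux, ut, hux, -, hder, hu0, hut0⟩ := hu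
  set c : ℝ → ℂ := fun τ => ((∫ x in (0 : ℝ)..ℓ, u x τ * (y x μ).re : ℝ) : ℂ)
  set d : ℝ → ℂ := fun τ => ((∫ x in (0 : ℝ)..ℓ, ut x τ * (y x μ).re : ℝ) : ℂ)
  set k := csqrt μ
  have hk : k ^ 2 = μ := csqrt_sq _
  have hc : ∀ τ, 0 ≤ τ → HasDerivWithinAt c (d τ) (Set.Ici 0) τ := fun τ hτ =>
    ((hder _ _ (hy.isH1 hℓ hq μ) τ hτ).1).ofReal_comp
  have hd : ∀ τ, 0 ≤ τ → HasDerivWithinAt d (-(k ^ 2 * c τ)) (Set.Ici 0) τ := fun τ hτ => by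
    refine (((hder _ _ (hy.isH1 hℓ hq μ) τ hτ).2).ofReal_comp).congr_deriv ?_
    rw [hy.energyForm_eq hℓ hq hμ (hux τ hτ), hk]
    push_cast
    rfl
  have hc0 : c 0 = 0 := by
    have : ∫ x in (0 : ℝ)..ℓ, u x 0 * (y x μ).re = ∫ x in (0 : ℝ)..ℓ, (0 : ℝ) :=
      intervalIntegral.integral_congr fun s hs => by
        rw [Set.uIcc_of_le hℓ] at hs
        simp only [hu0 s hs, zero_mul]
    simp only [c, this, intervalIntegral.integral_zero, Complex.ofReal_zero]
  have hd0 : d 0 = ∫ x in (0 : ℝ)..ε, ((x : ℂ) - ε) ^ 2 * Complex.cos (x * k) := by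
    rw [← hy.integral_initialVelocity_mul hε hεℓ hK, ← hy.ofReal_integral_mul_re hℓ hq]
    simp only [d]
    congr 1
    refine intervalIntegral.integral_congr_ae_restrict ?_
    rw [Set.uIoc_of_le hℓ]
    filter_upwards [hut0] with x hx
    rw [hx]
  rw [← hy.ofReal_integral_mul_re hℓ hq]
  change c t = _
  rw [traceNumerator]
  split_ifs with h0
  · have hk0 : k = 0 := by
      rw [h0, Complex.ofReal_zero] at hk
      exact pow_eq_zero_iff two_ne_zero |>.1 hk
    have h1 := eq_mul_of_hasDerivWithinAt_zero hc (fun τ hτ => by simpa [hk0] using hd τ hτ) hc0 ht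
    rw [h1, hd0, hk0]
    simp only [mul_zero, Complex.cos_zero, mul_one, integral_sq_sub]
    ring
  · have hk0 : k ≠ 0 := fun h => h0 (by
      rw [h] at hk
      exact_mod_cast (by simpa using hk.symm : (μ : ℂ) = 0))
    -- The two identities are `k c(t) = d(0) sin(tk)` and `k³ d(0) = 2(εk - sin(εk))`, which give
    -- `c(t)` after division by `k⁴ = μ²`.
    have h1 := mul_eq_mul_sin hc hd hc0 ht
    have h2 := mul_integral_sq_mul_cos ε k
    rw [← hd0] at h2
    rw [show csqrt (μ : ℂ) = k from rfl]
    clear_value k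
    rw [← hk]
    generalize Complex.sin (t * k) = A at h1 ⊢
    generalize Complex.sin (ε * k) = B at h2 ⊢
    field_simp
    linear_combination k ^ 3 * h1 + A * h2

theorem summable_norm_traceNumerator (hy : IsFundamentalSolution q h ℓ y y') (hℓ : 0 < ℓ)
    (hq : IntervalIntegrable q volume 0 ℓ) (H : ℝ) {ε : ℝ} (hε : 0 ≤ ε) (t : ℝ) :
    Summable fun n => ‖traceNumerator ε t (eigenvalue (charFun ℓ H y y') n)‖ := by
  have hpi := Real.pi_pos
  rw [← summable_nat_add_iff 1]
  refine Summable.of_norm_bounded_eventually_nat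
    (summable_one_div_succ_sq (2 * (1 + ε) * (4 * ℓ ^ 2 / Real.pi ^ 2))) ?_
  filter_upwards [hy.eventually_eigenvalue_mem hℓ hq H, (tendsto_add_atTop_nat 1).eventually
    ((hy.tendsto_eigenvalue hℓ hq H).eventually_ge_atTop 1)] with n h1 h2
  rw [norm_norm]
  refine (norm_traceNumerator_le hε h2).trans ?_
  have h3 : ((n + 1) / 2 * Real.pi / ℓ) ^ 2 ≤ eigenvalue (charFun ℓ H y y') (n + 1) := by
    refine le_trans ?_ h1.1
    rw [radius]
    gcongr
    linarith [(Nat.cast_nonneg n : (0 : ℝ) ≤ n)]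
  calc 2 * (1 + ε) / eigenvalue (charFun ℓ H y y') (n + 1)
      ≤ 2 * (1 + ε) / ((n + 1) / 2 * Real.pi / ℓ) ^ 2 := by gcongr
    _ = _ := by field_simp; ring

/-- The boundary trace of the weak solution. -/
theorem hasSum_trace (hy : IsFundamentalSolution q h ℓ y y') {ε : ℝ} (hε : 0 < ε)
    (hεℓ : ε ≤ ℓ) (hq : IntervalIntegrable q volume 0 ℓ)
    {K : ℝ → ℝ → ℝ} (hK : IsTransmutationKernel ε y K) {u : ℝ → ℝ → ℝ}
    (hu : IsWeakSolution q h H ℓ (fun _ => 0) (initialVelocity ε K) u) {t : ℝ} (ht : 0 ≤ t) :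
    HasSum (fun n => traceNumerator ε t (eigenvalue (charFun ℓ H y y') n)
      / deriv (charFun ℓ H y y') (eigenvalue (charFun ℓ H y y') n)) (u ℓ t : ℂ) := by
  have hℓ : 0 < ℓ := hε.trans_le hεℓ
  have hzero := charFun_eigenvalue (hy.finite_real_zeros hℓ hq H) (hy.infinite_real_zeros hℓ hq H)
  have hcoef := fun n => hy.integral_weakSolution_mul hε hεℓ hq (hzero n) hK hu ht
  have huc : ContinuousOn (fun x => (u x t : ℂ)) (Set.Icc 0 ℓ) := by
    obtain ⟨ux, ut, hux, -⟩ := hu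
    exact ((hux t ht).isPrimitive hℓ.le).continuousOn
  have hsum := hy.hasSum_eigenfunction_expansion hℓ hq H rfl huc (by
    simp only [hcoef, norm_neg]
    exact hy.summable_norm_traceNumerator hℓ hq H hε.le t) (x := ℓ) ⟨hℓ.le, le_rfl⟩
  refine hsum.congr_fun fun n => ?_
  have h1 := hy.integral_norm_sq_eq hℓ.le hq (hzero n)
  have h2 := hy.deriv_charFun_ne_zero hℓ hq (hzero n)
  have h3 : y ℓ (eigenvalue (charFun ℓ H y y') n) ≠ 0 := fun h0 => by
    rw [h0, neg_zero, zero_mul] at h1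
    exact (hy.integral_norm_sq_pos hℓ _).ne' (by exact_mod_cast h1)
  -- The coefficient is minus the trace numerator and the norming constant is `-y(ℓ, λ_n) Φ'(λ_n)`:
  -- the signs and the boundary values `y(ℓ, λ_n)` cancel.
  rw [hcoef, h1]
  field_simp

end IsFundamentalSolution

end WaveTrace

end

theorem mainTheorem3
    (q : ℝ → ℝ) (h H ℓ ε : ℝ) (hℓ : 0 < ℓ) (hε : 0 < ε) (hεℓ : ε ≤ ℓ)
    (hq : IntervalIntegrable q volume 0 ℓ)
    (y y' : ℝ → ℂ → ℂ) (hy : WaveTrace.IsFundamentalSolution q h ℓ y y')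
    (Φ : ℂ → ℂ) (hΦ : Φ = WaveTrace.charFun ℓ H y y')
    (lam : ℕ → ℝ) (hlam : lam = WaveTrace.eigenvalue Φ) :
    -- the eigenvalues are real, and are all the zeros of the entire function `Φ`
    (Differentiable ℂ Φ ∧ StrictMono lam ∧
      Set.range (fun n => (lam n : ℂ)) = {z : ℂ | Φ z = 0}) ∧
    -- they determine `ℓ`
    Tendsto (fun n : ℕ => (n : ℝ) * Real.pi / Real.sqrt (lam n)) atTop (𝓝 ℓ) ∧
    -- they determine `Φ`
    ((∀ z : ℂ, Multipliable (WaveTrace.hadamardFactor ℓ lam z)) ∧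
      Φ = WaveTrace.hadamardProduct ℓ lam) ∧
    -- the norming constants
    (∀ n : ℕ, deriv Φ (lam n) ≠ 0 ∧
      ((∫ x in (0 : ℝ)..ℓ, ‖y x (lam n)‖ ^ 2 : ℝ) : ℂ) = -(y ℓ (lam n)) * deriv Φ (lam n)) ∧
    -- the boundary trace
    (∀ K : ℝ → ℝ → ℝ, WaveTrace.IsTransmutationKernel ε y K →
      ∀ u : ℝ → ℝ → ℝ,
        WaveTrace.IsWeakSolution q h H ℓ (fun _ => 0) (WaveTrace.initialVelocity ε K) u →
        ∀ t : ℝ, 0 ≤ t →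
          HasSum (fun n : ℕ => WaveTrace.traceNumerator ε t (lam n) / deriv Φ (lam n))
            ((u ℓ t : ℝ) : ℂ)) := by
  subst hΦ
  subst hlam
  have hfin := hy.finite_real_zeros hℓ hq H
  have hinf := hy.infinite_real_zeros hℓ hq H
  have hzero := WaveTrace.charFun_eigenvalue hfin hinf
  refine ⟨⟨hy.differentiable_charFun hℓ.le hq, WaveTrace.strictMono_eigenvalue hfin hinf, ?_⟩,
    hy.tendsto_mul_pi_div_sqrt_eigenvalue hℓ hq H,
    ⟨fun z => ?_, hy.charFun_eq_hadamardProduct hℓ hq H⟩,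
    fun n => ⟨hy.deriv_charFun_ne_zero hℓ hq (hzero n), hy.integral_norm_sq_eq hℓ.le hq (hzero n)⟩,
    fun K hK u hu t ht => hy.hasSum_trace hε hεℓ hq hK hu ht⟩
  · ext z
    refine ⟨fun ⟨n, hn⟩ => hn ▸ hzero n, fun hz => ?_⟩
    have him := hy.im_eq_zero_of_charFun_eq_zero hℓ hq hz
    have hzr : z = (z.re : ℂ) := Complex.ext (by simp) (by simpa using him)
    rw [hzr] at hz
    obtain ⟨n, hn⟩ := WaveTrace.exists_eigenvalue_eq hfin hinf hz
    exact ⟨n, by simp only [hn]; exact hzr.symm⟩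
  · obtain ⟨C, hC⟩ := hy.exists_forall_abs_eigenvalue_sub_le hℓ hq H
    exact WaveTrace.multipliable_hadamardFactor hℓ hC z
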